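/- Let $n\ge 0$ and $\omega=e^{2\pi i/(n+1)}$. A tt*-structure of rank $n+1$ over $\mathbb C^*$ is a tuple $(E,\eta,g,\Phi)$ of a holomorphic vector bundle $E\to\mathbb C^*$ of rank $n+1$, a holomorphic nondegenerate symmetric bilinear form $\eta$, a Hermitian metric $g$ (conjugate-linear in the first argument) and a holomorphic $\mathrm{End}(E)$-valued 1-form $\Phi$, such that $\Phi$ is $\eta$-self-adjoint, the conjugate-linear map $\kappa$ with $g(a,b)=\eta(\kappa(a),b)$ satisfies $\kappa^2=\mathrm{Id}$, and $D+\lambda^{-1}\Phi+\lambda\Phi^{\dagger_g}$ is flat for all $\lambda\in S^1$, where $D$ is the Chern connection. An isomorphism is a holomorphic bundle isomorphism over $\mathrm{id}_{\mathbb C^*}$ preserving $\eta$, $g$ and $\Phi$. Let $(E,\eta,g,\Phi)$ be such a structure with $\Phi$ nowhere zero. It represents a $\mathbb Z_{n+1}$-fixed point if $(E,\eta,g,\Phi)\cong(E,\eta,g,\omega\Phi)$. It represents a $\rho$-fixed point if for every rotation $\rho_z(t)=e^zt$, $z\in i\mathbb R$, there is an isomorphism $T_z:(\rho_z^*E,\rho_z^*\eta,\rho_z^*g,e^{-z}\rho_z^*\Phi)\to(E,\eta,g,\Phi)$,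 depending only on the rotation $\rho_z$ (that is, $T_{z+2\pi i}=T_z$), with $T_z(a)$ continuous in $z$ for each $a\in E$. Let (I) be the set of isomorphism classes that are both $\mathbb Z_{n+1}$-fixed and $\rho$-fixed with nowhere vanishing $\Phi$. For $c\in\mathbb C^*$, the coordinate $\tau=ct$ of $\mathbb C^*$ is called adapted to a class if the eigenvalues of $\Phi$ are $d\tau,\omega\,d\tau,\dots,\omega^n d\tau$ at every point. Let (II) be the set of smooth radial solutions $w_j:\mathbb C^*\to\mathbb R$ ($j\in\mathbb Z$) of the tt*-Toda equation $(w_j)_{t\bar t}=e^{w_j-w_{j-1}}-e^{w_{j+1}-w_j}$, $w_{j+n+1}=w_j$, with $w_j+w_{l-j-1}=0$ for some $l\in\mathbb Z$ and all $j$, and $w_j(t)=w_j(|t|)$, modulo cyclic shifts $(w_j)_j\sim(w_{j+s})_j$, $s\in\mathbb Z$. Then every class in (I) has an adapted coordinate $\tau=ct$, and there is a map $F$ from (I) to (II) such that: 1. if $\tau=ct$ is adapted to $(E,\eta,g,\Phi)$, then $F([E,\eta,g,\Phi])=[w]$ if and only if there are $l\in\mathbb Z$ and a global holomorphic frame $e_0,\dots,e_n$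 of $E$ with $\eta(e_i,e_j)=1$ if $i+j\equiv l-1$ mod $n+1$ and $\eta(e_i,e_j)=0$ otherwise, $\Phi(e_j)=e_{j+1}\,d\tau$ (indices mod $n+1$), and $g(e_i,e_j)=\delta_{ij}e^{w_j(\tau)}$; 2. for every $c\in\mathbb C^*$ (in particular for $c=1$, where $\tau=t$ is the standard coordinate), $F$ restricts to a bijection from the classes in (I) to which $\tau=ct$ is adapted onto (II). -/

import Mathlib

open Bundle Manifold Matrix
open scoped ContDiff

noncomputable section

namespace TTStar

/-! ## Calculus on the punctured plane `ℂ* = ℂˣ` -/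

/-- A function on `ℂ*`, regarded as a function on the plane (with value `0` at the origin). -/
def onPlane {X : Type*} [Zero X] (f : ℂˣ → X) : ℂ → X :=
  fun z => if h : z = 0 then 0 else f (Units.mk0 z h)

/-- The Wirtinger derivative `∂/∂t = (∂/∂x - i ∂/∂y) / 2`, as an operator on functions on `ℂ*`. -/
def dt (f : ℂˣ → ℂ) : ℂˣ → ℂ := fun t =>
  (1 / 2) * (fderiv ℝ (onPlane f) (t : ℂ) 1 - Complex.I * fderiv ℝ (onPlane f) (t : ℂ) Complex.I)

/-- The Wirtinger derivative `∂/∂t̄ = (∂/∂x + i ∂/∂y) / 2`, as an operator on functions on `ℂ*`. -/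
def dtbar (f : ℂˣ → ℂ) : ℂˣ → ℂ := fun t =>
  (1 / 2) * (fderiv ℝ (onPlane f) (t : ℂ) 1 + Complex.I * fderiv ℝ (onPlane f) (t : ℂ) Complex.I)

/-- A real or complex valued function on `ℂ*` is of class `C^∞` (in the real sense) on `U`. -/
def SmoothOn {X : Type*} [NormedAddCommGroup X] [NormedSpace ℝ X] (f : ℂˣ → X) (U : Set ℂˣ) :
    Prop :=
  ContDiffOn ℝ ∞ (onPlane f) (Units.val '' U)

/-! ## Holomorphic vector bundles over `ℂ*` -/

/-- A holomorphic vector bundle of rank `r` over `ℂ*`. -/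
structure HolBundle (r : ℕ) where
  E : ℂˣ → Type
  [addCommGroup : ∀ t, AddCommGroup (E t)]
  [module : ∀ t, Module ℂ (E t)]
  [topTotal : TopologicalSpace (TotalSpace (Fin r → ℂ) E)]
  [topFiber : ∀ t, TopologicalSpace (E t)]
  [fiberBundle : FiberBundle (Fin r → ℂ) E]
  [vectorBundle : VectorBundle ℂ (Fin r → ℂ) E]
  [holomorphic : ContMDiffVectorBundle ω (Fin r → ℂ) E 𝓘(ℂ, ℂ)]

attribute [instance] HolBundle.addCommGroup HolBundle.module HolBundle.topTotal
  HolBundle.topFiber HolBundle.fiberBundle HolBundle.vectorBundle HolBundle.holomorphic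

/-- Holomorphic sections of `B` over `U` (values outside `U` are irrelevant). -/
def HolBundle.IsHolSection {r : ℕ} (B : HolBundle r) (U : Set ℂˣ) (s : ∀ t, B.E t) : Prop :=
  ContMDiffOn 𝓘(ℂ, ℂ) (𝓘(ℂ, ℂ).prod 𝓘(ℂ, Fin r → ℂ)) ω
    (fun t => TotalSpace.mk' (Fin r → ℂ) t (s t)) U

/-- Holomorphic frames of `B` over `U`. -/
def HolBundle.IsHolFrame {r : ℕ} (B : HolBundle r) (U : Set ℂˣ) (e : Fin r → ∀ t, B.E t) : Prop :=
  IsLocalFrameOn 𝓘(ℂ, ℂ) (Fin r → ℂ) ω e U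

/-- Multiplication by `u` on `ℂ*`, as a holomorphic map. -/
def mulMap (u : ℂˣ) : ContMDiffMap 𝓘(ℂ, ℂ) 𝓘(ℂ, ℂ) ℂˣ ℂˣ ω :=
  ⟨fun t => u * t, contMDiff_mul_left⟩

/-- The pullback of a holomorphic bundle along `t ↦ u t`; its fibre at `t` is `E_{u t}`. -/
def HolBundle.pull {r : ℕ} (u : ℂˣ) (B : HolBundle r) : HolBundle r where
  E := (mulMap u : ℂˣ → ℂˣ) *ᵖ B.E
  addCommGroup := fun t => B.addCommGroup (u * t)
  module := fun t => B.module (u * t)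
  topTotal := Pullback.TotalSpace.topologicalSpace (Fin r → ℂ) B.E (mulMap u)
  topFiber := fun t => B.topFiber (u * t)
  fiberBundle := FiberBundle.pullback (F := Fin r → ℂ) (E := B.E) (mulMap u)
  vectorBundle := VectorBundle.pullback (𝕜 := ℂ) (F := Fin r → ℂ) (E := B.E) (mulMap u)
  holomorphic := ContMDiffVectorBundle.pullback (Fin r → ℂ) B.E 𝓘(ℂ, ℂ) (mulMap u)

/-! ## tt*-structures -/

/-- The data `(E, η, g, Φ)` of a tt*-structure of rank `r`, without the axioms. Here `g` is
conjugate-linear in its first argument, and `Φ t X` is the endomorphism `Φ_X` of `E_t`, for a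
tangent vector `X ∈ T_t ℂ* = ℂ`. -/
structure Data (r : ℕ) extends HolBundle r where
  η : ∀ t, E t →ₗ[ℂ] E t →ₗ[ℂ] ℂ
  g : ∀ t, E t →ₗ⋆[ℂ] E t →ₗ[ℂ] ℂ
  Φ : ∀ t, ℂ →ₗ[ℂ] E t →ₗ[ℂ] E t

namespace Data

variable {r : ℕ}

/-- The Gram matrix `(g(e_i, e_j))` of the metric in a frame. -/
def gram (S : Data r) (e : Fin r → ∀ t, S.E t) (t : ℂˣ) : Matrix (Fin r) (Fin r) ℂ :=
  Matrix.of fun i j => S.g t (e i t) (e j t)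

/-- The `dt`-part of the matrix of `D + lam⁻¹ Φ + lam Φ^†` in a holomorphic frame `e`, namely
`h⁻¹ ∂h + lam⁻¹ φ`, where `h` is the Gram matrix and `φ dt` is the matrix of `Φ`. -/
def connDt (S : Data r) (e : Fin r → ∀ t, S.E t) (φ : ℂˣ → Matrix (Fin r) (Fin r) ℂ)
    (lam : Circle) (t : ℂˣ) : Matrix (Fin r) (Fin r) ℂ :=
  (S.gram e t)⁻¹ * Matrix.of (fun i j => dt (fun s => S.gram e s i j) t) + (lam : ℂ)⁻¹ • φ t

/-- The `dt̄`-part of the matrix of `D + lam⁻¹ Φ + lam Φ^†` in a holomorphic frame `e`, namely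
`lam φ^†` with `φ^† = h⁻¹ φᴴ h`. -/
def connDtbar (S : Data r) (e : Fin r → ∀ t, S.E t) (φ : ℂˣ → Matrix (Fin r) (Fin r) ℂ)
    (lam : Circle) (t : ℂˣ) : Matrix (Fin r) (Fin r) ℂ :=
  (lam : ℂ) • ((S.gram e t)⁻¹ * (φ t)ᴴ * S.gram e t)

/-- The `dt ∧ dt̄`-coefficient of the curvature matrix `dA + A ∧ A` of `D + lam⁻¹ Φ + lam Φ^†`
in a holomorphic frame. -/
def curvature (S : Data r) (e : Fin r → ∀ t, S.E t) (φ : ℂˣ → Matrix (Fin r) (Fin r) ℂ)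
    (lam : Circle) (t : ℂˣ) : Matrix (Fin r) (Fin r) ℂ :=
  Matrix.of (fun i j => dt (fun s => S.connDtbar e φ lam s i j) t)
    - Matrix.of (fun i j => dtbar (fun s => S.connDt e φ lam s i j) t)
    + S.connDt e φ lam t * S.connDtbar e φ lam t - S.connDtbar e φ lam t * S.connDt e φ lam t

/-- `(E, η, g, Φ)` is a tt*-structure over `ℂ*`. -/
structure IsTTStar (S : Data r) : Prop where
  /-- `η` is a holomorphic nondegenerate symmetric bilinear form. -/
  η_symm : ∀ t a b, S.η t a b = S.η t b a
  η_nondeg : ∀ t a, (∀ b, S.η t a b = 0) → a = 0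
  η_hol : ∀ U : Set ℂˣ, IsOpen U → ∀ s s', S.IsHolSection U s → S.IsHolSection U s' →
    ContMDiffOn 𝓘(ℂ, ℂ) 𝓘(ℂ, ℂ) ω (fun t => S.η t (s t) (s' t)) U
  /-- `g` is a (smooth) Hermitian metric. -/
  g_herm : ∀ t a b, S.g t a b = starRingEnd ℂ (S.g t b a)
  g_pos : ∀ t a, a ≠ 0 → 0 < (S.g t a a).re
  g_smooth : ∀ U : Set ℂˣ, IsOpen U → ∀ s s', S.IsHolSection U s → S.IsHolSection U s' →
    SmoothOn (fun t => S.g t (s t) (s' t)) U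
  /-- `Φ` is a holomorphic `End(E)`-valued 1-form, self-adjoint with respect to `η`. -/
  Φ_hol : ∀ U : Set ℂˣ, IsOpen U → ∀ s, S.IsHolSection U s →
    S.IsHolSection U (fun t => S.Φ t 1 (s t))
  Φ_selfAdj : ∀ t X a b, S.η t (S.Φ t X a) b = S.η t a (S.Φ t X b)
  /-- The conjugate-linear map `κ` with `g(a, b) = η(κ(a), b)` is an involution. -/
  κ_invol : ∀ t, ∃ κ : S.E t →ₗ⋆[ℂ] S.E t,
    (∀ a b, S.g t a b = S.η t (κ a) b) ∧ ∀ a, κ (κ a) = a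
  /-- The connection `D + lam⁻¹ Φ + lam Φ^†` (`D` the Chern connection) is flat for `lam ∈ S¹`. -/
  flat : ∀ U : Set ℂˣ, IsOpen U → ∀ e, S.IsHolFrame U e →
    ∀ φ : ℂˣ → Matrix (Fin r) (Fin r) ℂ,
      (∀ t ∈ U, ∀ j, S.Φ t 1 (e j t) = ∑ i, φ t i j • e i t) →
      ∀ lam : Circle, ∀ t ∈ U, S.curvature e φ lam t = 0

/-- Isomorphisms of tt*-structures: isomorphisms of holomorphic vector bundles over the identity
of `ℂ*` that preserve `η`, `g` and `Φ`. -/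
structure Iso (S₁ S₂ : Data r) where
  map : ∀ t, S₁.E t ≃ₗ[ℂ] S₂.E t
  hol : ContMDiff (𝓘(ℂ, ℂ).prod 𝓘(ℂ, Fin r → ℂ)) (𝓘(ℂ, ℂ).prod 𝓘(ℂ, Fin r → ℂ)) ω
    (fun p : TotalSpace (Fin r → ℂ) S₁.E => TotalSpace.mk' (Fin r → ℂ) p.1 (map p.1 p.2))
  hol_symm : ContMDiff (𝓘(ℂ, ℂ).prod 𝓘(ℂ, Fin r → ℂ)) (𝓘(ℂ, ℂ).prod 𝓘(ℂ, Fin r → ℂ)) ω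
    (fun p : TotalSpace (Fin r → ℂ) S₂.E => TotalSpace.mk' (Fin r → ℂ) p.1 ((map p.1).symm p.2))
  map_η : ∀ t a b, S₁.η t a b = S₂.η t (map t a) (map t b)
  map_g : ∀ t a b, S₁.g t a b = S₂.g t (map t a) (map t b)
  map_Φ : ∀ t X a, map t (S₁.Φ t X a) = S₂.Φ t X (map t a)

/-- The action `μ · (E, η, g, Φ) = (E, η, g, μ Φ)`. -/
def smulΦ (μ : ℂ) (S : Data r) : Data r :=
  { S with Φ := fun t => μ • S.Φ t }

/-- The `ρ_z`-action `(ρ_z^* E, ρ_z^* η, ρ_z^* g, e^{-z} ρ_z^* Φ)`, where `ρ_z` is multiplication by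
`u = e^z` on `ℂ*`. -/
def rho (u : ℂˣ) (S : Data r) : Data r where
  toHolBundle := S.toHolBundle.pull u
  η := fun t => (S.η (u * t) : S.E (u * t) →ₗ[ℂ] S.E (u * t) →ₗ[ℂ] ℂ)
  g := fun t => (S.g (u * t) : S.E (u * t) →ₗ⋆[ℂ] S.E (u * t) →ₗ[ℂ] ℂ)
  Φ := fun t => (u : ℂ)⁻¹ • (S.Φ (u * t)).comp (LinearMap.lsmul ℂ ℂ (u : ℂ))

/-- The class of `S` is a fixed point of multiplication of `Φ` by `e^{2πi/r}`. -/
def IsCyclicFixed (S : Data r) : Prop :=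
  Nonempty (Iso S (S.smulΦ (Complex.exp (2 * Real.pi * Complex.I / r))))

/-- The class of `S` is a `ρ`-fixed point: for every rotation `ρ_z`, `z ∈ iℝ`, i.e. for every
`u = e^z ∈ S¹`, there is an isomorphism `T_u : ρ_z · S → S`, such that for each
`a ∈ E_x = (ρ_z^* E)_{u⁻¹ x}` the point `T_u(a)` of the total space is continuous in `u`. (The isomorphism depends only on the
rotation `ρ_z`, so as a function of `z ∈ iℝ` it is `2πi`-periodic.) -/
def IsRhoFixed (S : Data r) : Prop :=
  ∃ T : ∀ u : Circle, Iso (S.rho (Circle.toUnits u)) S,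
    ∀ (x : ℂˣ) (a : S.E x), Continuous fun u : Circle =>
      TotalSpace.mk' (Fin r → ℂ) ((Circle.toUnits u)⁻¹ * x)
        ((T u).map ((Circle.toUnits u)⁻¹ * x)
          (cast (congrArg S.E (mul_inv_cancel_left (Circle.toUnits u) x).symm) a))

/-- `Φ` vanishes at no point of `ℂ*`. -/
def NonVanishing (S : Data r) : Prop := ∀ t, S.Φ t ≠ 0

/-- `τ = c t` is a coordinate adapted to `Φ`: at every point the eigenvalues of `Φ` are
`ω^j dτ`, `j = 0, …, r - 1`, where `ω = e^{2πi/r}`. -/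
def IsAdapted (S : Data r) (c : ℂˣ) : Prop :=
  ∀ (t : ℂˣ) (j : Fin r), Module.End.HasEigenvalue (S.Φ t 1 : Module.End ℂ (S.E t))
    (Complex.exp (2 * Real.pi * Complex.I / r) ^ (j : ℕ) * c)

/-- In the coordinate `τ = c t` of `ℂ*`, the structure `S` is the Toda-type tt*-structure of
`w_0, …, w_n`: there are `l` and a global holomorphic frame `e_0, …, e_n` with
`η(e_i, e_j) = 1` if `i + j ≡ l - 1` mod `n + 1` and `η(e_i, e_j) = 0` otherwise,
`Φ(e_j) = e_{j+1} dτ` (indices mod `n + 1`) and `g(e_i, e_j) = δ_{ij} e^{w_j(τ)}`. -/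
def HasTodaFrame {n : ℕ} (S : Data (n + 1)) (c : ℂˣ) (w : ℤ → ℂˣ → ℝ) : Prop :=
  ∃ (l : ℤ) (e : Fin (n + 1) → ∀ t, S.E t), S.IsHolFrame Set.univ e ∧
    (∀ t i j, S.η t (e i t) (e j t) =
      if (i : ℤ) + (j : ℤ) ≡ l - 1 [ZMOD ((n : ℤ) + 1)] then 1 else 0) ∧
    (∀ t X j, S.Φ t X (e j t) = (c * X : ℂ) • e (j + 1) t) ∧
    ∀ t i j, S.g t (e i t) (e j t) =
      if i = j then (Real.exp (w ((j : ℕ) : ℤ) (c * t)) : ℂ) else 0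

/-- The identity isomorphism. -/
def Iso.refl (S : Data r) : Iso S S where
  map _ := LinearEquiv.refl ℂ _
  hol := contMDiff_id
  hol_symm := contMDiff_id
  map_η _ _ _ := rfl
  map_g _ _ _ := rfl
  map_Φ _ _ _ := rfl

/-- The inverse isomorphism. -/
def Iso.symm {S₁ S₂ : Data r} (T : Iso S₁ S₂) : Iso S₂ S₁ where
  map t := (T.map t).symm
  hol := T.hol_symm
  hol_symm := T.hol
  map_η t a b := by simp [T.map_η]
  map_g t a b := by simp [T.map_g]
  map_Φ t X a := by rw [LinearEquiv.symm_apply_eq, T.map_Φ, LinearEquiv.apply_symm_apply]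

/-- The composition of isomorphisms. -/
def Iso.trans {S₁ S₂ S₃ : Data r} (T : Iso S₁ S₂) (T' : Iso S₂ S₃) : Iso S₁ S₃ where
  map t := (T.map t).trans (T'.map t)
  hol := T'.hol.comp T.hol
  hol_symm := T.hol_symm.comp T'.hol_symm
  map_η t a b := by rw [T.map_η, T'.map_η]; rfl
  map_g t a b := by rw [T.map_g, T'.map_g]; rfl
  map_Φ t X a := by simp [T.map_Φ, T'.map_Φ]

end Data

/-- The tt*-structures of rank `n + 1` over `ℂ*` with non-vanishing `Φ` that represent both a
`ℤ_{n+1}`-fixed point and a `ρ`-fixed point. -/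
def FixedStructure (n : ℕ) : Type 1 :=
  {S : Data (n + 1) // S.IsTTStar ∧ S.NonVanishing ∧ S.IsCyclicFixed ∧ S.IsRhoFixed}

/-- Isomorphism of tt*-structures. -/
instance fixedSetoid (n : ℕ) : Setoid (FixedStructure n) where
  r S S' := Nonempty (Data.Iso S.1 S'.1)
  iseqv := ⟨fun S => ⟨Data.Iso.refl S.1⟩, fun ⟨T⟩ => ⟨T.symm⟩, fun ⟨T⟩ ⟨T'⟩ => ⟨T.trans T'⟩⟩

/-- Isomorphism classes that are both `ℤ_{n+1}`-fixed and `ρ`-fixed, with non-vanishing `Φ`. -/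
def FixedClass (n : ℕ) : Type 1 := Quotient (fixedSetoid n)

/-! ## The tt*-Toda equation -/

/-- `w_j : ℂ* → ℝ`, `j ∈ ℤ`, is a (smooth) solution of the tt*-Toda equation. -/
structure IsTodaSolution (n : ℕ) (w : ℤ → ℂˣ → ℝ) : Prop where
  smooth : ∀ j, SmoothOn (w j) Set.univ
  eqn : ∀ j t, dt (dtbar fun s => (w j s : ℂ)) t =
    (Real.exp (w j t - w (j - 1) t) - Real.exp (w (j + 1) t - w j t) : ℝ)
  periodic : ∀ j, w (j + (n + 1)) = w j
  antisymm : ∃ l : ℤ, ∀ j t, w j t + w (l - j - 1) t = 0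

/-- `w_j(t)` depends only on `|t|`. -/
def IsRadial (w : ℤ → ℂˣ → ℝ) : Prop :=
  ∀ j (s t : ℂˣ), ‖(s : ℂ)‖ = ‖(t : ℂ)‖ → w j s = w j t

/-- Radial solutions of the tt*-Toda equation. -/
def RadialSolution (n : ℕ) : Type := {w : ℤ → ℂˣ → ℝ // IsTodaSolution n w ∧ IsRadial w}

/-- Two solutions are equivalent if they differ by a cyclic shift of the index. -/
instance shiftSetoid (n : ℕ) : Setoid (RadialSolution n) where
  r w w' := ∃ s : ℤ, ∀ j, w'.1 j = w.1 (j + s)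
  iseqv := ⟨fun w => ⟨0, fun j => by rw [add_zero]⟩,
    fun ⟨s, h⟩ => ⟨-s, fun j => by rw [h, neg_add_cancel_right]⟩,
    fun ⟨s, h⟩ ⟨s', h'⟩ => ⟨s' + s, fun j => by rw [h', h, add_assoc]⟩⟩

/-- Cyclic-shift classes of radial solutions of the tt*-Toda equation. -/
def SolutionClass (n : ℕ) : Type := Quotient (shiftSetoid n)

end TTStar

end

noncomputable section

namespace TTStar

open Filter Topology

/-! ## Holomorphic functions on `ℂ*` -/

/-! The `ℤ_{n+1}`-symmetry is a bundle automorphism `A` that preserves `η` and `g` and satisfies `A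
Φ = ω Φ A`. Hence the characteristic polynomial of `Φ` is invariant under `x ↦ ωx`, only its leading
and constant terms survive, and `Φ^{n+1}` is a scalar function times `(dt)^{n+1}`. This function is
holomorphic and invariant under rotations, so it is a constant (`exists_Φ_pow_eq`).

The constant is not zero. Otherwise `Φ` is nilpotent everywhere, and flatness yields a Bochner
inequality for `tr(Φ Φ^†)`, whose commutator term is bounded below because a nonzero nilpotent
matrix is never normal. The rotations make this norm radial, and in the variable `s = log |t|` the
inequality becomes `v'' ≥ C e^v` on the whole line, which has no solution (`not_nilpotent`).

So `Φ^{n+1} = c^{n+1} (dt)^{n+1}` with `c ≠ 0`, and `A` permutes the eigenlines of `Φ` cyclically.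
The eigenvectors for `c` with `η(v, v) = 1` form a double cover of `ℂ*`. The maps `T_u` carry such a
vector once around the circle, and since they depend only on the rotation the resulting loop closes;
the cover therefore has no monodromy and there is a global holomorphic unit eigensection `s`. The
discrete Fourier transform of `s, As, …, A^n s` diagonalises `A` and turns `Φ` into the cyclic
shift, and the invariance of `g` under `A` makes `g` diagonal (`exists_todaFrame`). In such a frame
flatness is the Toda equation and `κ² = Id` is the antisymmetry.

Two Toda frames with the same `c` differ by a circulant matrix, and this forces the metrics to agree
up to a cyclic shift (`exists_shift`). This gives both the radial symmetry of the solution and its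
uniqueness. For injectivity, equal solutions may still come with different index sums in `η`; then
the solution is invariant under a shift, and a unitary square root of that shift adjusts `η`
(`change_pairing`). Surjectivity is the explicit structure `modelData` on the trivial bundle. -/

theorem onPlane_coe {X : Type*} [Zero X] (f : ℂˣ → X) (t : ℂˣ) : onPlane f (t : ℂ) = f t := by
  simp [onPlane]

theorem onPlane_of_ne {X : Type*} [Zero X] (f : ℂˣ → X) {z : ℂ} (h : z ≠ 0) :
    onPlane f z = f (Units.mk0 z h) := by
  simp [onPlane, h]

theorem eventually_ne_zero (t : ℂˣ) : ∀ᶠ z in 𝓝 (t : ℂ), z ≠ 0 :=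
  isOpen_ne.mem_nhds t.ne_zero

theorem eventually_nhds_units {p : ℂˣ → Prop} {t : ℂˣ} :
    (∀ᶠ s in 𝓝 t, p s) ↔ ∀ᶠ z in 𝓝 (t : ℂ), ∀ h : z ≠ 0, p (Units.mk0 z h) := by
  rw [← Units.isOpenEmbedding_val.map_nhds_eq t, eventually_map]
  refine eventually_congr (Eventually.of_forall fun s => ?_)
  simp

/-- Holomorphy of a vector valued function on `ℂ*` at a point. -/
def HolFunAt {V : Type*} [NormedAddCommGroup V] [NormedSpace ℂ V] (f : ℂˣ → V) (t : ℂˣ) : Prop :=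
  ContMDiffAt 𝓘(ℂ, ℂ) 𝓘(ℂ, V) ω f t

theorem holFunAt_iff {V : Type*} [NormedAddCommGroup V] [NormedSpace ℂ V] {f : ℂˣ → V} {t : ℂˣ} :
    HolFunAt f t ↔ ContDiffAt ℂ ω (onPlane f) t := by
  constructor
  · intro h
    have h1 := contMDiffOn_isOpenEmbedding_symm (I := 𝓘(ℂ, ℂ)) (n := ω)
      (Units.isOpenEmbedding_val (R := ℂ))
    have h2 := h1.contMDiffAt (x := (t : ℂ)) (Units.isOpenEmbedding_val.isOpen_range.mem_nhds ⟨t, rfl⟩)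
    have h3 := ContMDiffAt.comp_of_eq (g := f) (x := (t : ℂ)) (y := t) h h2
      ((Units.isOpenEmbedding_val (R := ℂ)).toOpenPartialHomeomorph_left_inv)
    refine contMDiffAt_iff_contDiffAt.1 (h3.congr_of_eventuallyEq ?_)
    filter_upwards [eventually_ne_zero t] with z hz
    rw [onPlane_of_ne f hz, Function.comp_apply]
    congr 1
    exact ((Units.isOpenEmbedding_val (R := ℂ)).toOpenPartialHomeomorph_left_inv
      (x := Units.mk0 z hz)).symm
  · intro h
    have h1 : ContMDiffAt 𝓘(ℂ, ℂ) 𝓘(ℂ, V) ω (onPlane f ∘ (Units.val : ℂˣ → ℂ)) t :=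
      ContMDiffAt.comp t (contMDiffAt_iff_contDiffAt.2 h) Units.contMDiff_val.contMDiffAt
    refine h1.congr_of_eventuallyEq (Eventually.of_forall fun s => ?_)
    simp [onPlane_coe]

/-! ### Holomorphic sections, frames and maps of bundles over `ℂ*`. -/

variable {r : ℕ}

/-- Holomorphy of a section at a point. -/
def HolBundle.HolAt (B : HolBundle r) (s : ∀ t, B.E t) (t : ℂˣ) : Prop :=
  ContMDiffAt 𝓘(ℂ, ℂ) (𝓘(ℂ, ℂ).prod 𝓘(ℂ, Fin r → ℂ)) ω
    (fun t => TotalSpace.mk' (Fin r → ℂ) t (s t)) t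

theorem HolBundle.isHolSection_iff (B : HolBundle r) {U : Set ℂˣ} (hU : IsOpen U)
    {s : ∀ t, B.E t} : B.IsHolSection U s ↔ ∀ t ∈ U, B.HolAt s t := by
  constructor
  · intro h t ht
    exact (h t ht).contMDiffAt (hU.mem_nhds ht)
  · intro h t ht
    exact (h t ht).contMDiffWithinAt

theorem HolBundle.HolAt.congr {B : HolBundle r} {s s' : ∀ t, B.E t} {t : ℂˣ} (h : B.HolAt s t)
    (h' : ∀ᶠ x in 𝓝 t, s' x = s x) : B.HolAt s' t :=
  ContMDiffAt.congr_of_eventuallyEq h (h'.mono fun x hx => by simp [hx])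

theorem HolBundle.HolAt.smul {B : HolBundle r} {s : ∀ t, B.E t} {f : ℂˣ → ℂ} {t : ℂˣ}
    (hf : HolFunAt f t) (h : B.HolAt s t) : B.HolAt (fun x => f x • s x) t :=
  ContMDiffAt.smul_section hf h

theorem HolBundle.HolAt.sum {B : HolBundle r} {ι : Type*} {I : Finset ι} {s : ι → ∀ t, B.E t}
    {t : ℂˣ} (h : ∀ i ∈ I, B.HolAt (s i) t) : B.HolAt (fun x => ∑ i ∈ I, s i x) t :=
  ContMDiffAt.sum_section h

theorem HolBundle.HolAt.const_smul {B : HolBundle r} {s : ∀ t, B.E t} {t : ℂˣ} (a : ℂ)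
    (h : B.HolAt s t) : B.HolAt (fun x => a • s x) t :=
  HolBundle.HolAt.smul (f := fun _ => a) contMDiffAt_const h

/-- The holomorphic frame of a local trivialization. -/
def HolBundle.trivFrame (B : HolBundle r) (x : ℂˣ) : Fin r → ∀ t, B.E t :=
  (trivializationAt (Fin r → ℂ) B.E x).localFrame (Pi.basisFun ℂ (Fin r))

def HolBundle.trivSet (B : HolBundle r) (x : ℂˣ) : Set ℂˣ :=
  (trivializationAt (Fin r → ℂ) B.E x).baseSet

theorem HolBundle.isOpen_trivSet (B : HolBundle r) (x : ℂˣ) : IsOpen (B.trivSet x) :=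
  (trivializationAt (Fin r → ℂ) B.E x).open_baseSet

theorem HolBundle.mem_trivSet (B : HolBundle r) (x : ℂˣ) : x ∈ B.trivSet x :=
  mem_baseSet_trivializationAt _ _ _

theorem HolBundle.isHolFrame_trivFrame (B : HolBundle r) (x : ℂˣ) :
    B.IsHolFrame (B.trivSet x) (B.trivFrame x) :=
  (trivializationAt (Fin r → ℂ) B.E x).isLocalFrameOn_localFrame_baseSet 𝓘(ℂ, ℂ) ω _

theorem HolBundle.IsHolFrame.holAt {B : HolBundle r} {U : Set ℂˣ} {e : Fin r → ∀ t, B.E t}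
    (he : B.IsHolFrame U e) (hU : IsOpen U) {t : ℂˣ} (ht : t ∈ U) (i : Fin r) : B.HolAt (e i) t :=
  he.contMDiffAt hU ht i

/-- Coordinates of a section in the frame of a local trivialization. -/
def HolBundle.trivCoord (B : HolBundle r) (x t : ℂˣ) (v : B.E t) : Fin r → ℂ :=
  (trivializationAt (Fin r → ℂ) B.E x ⟨t, v⟩).2

theorem HolBundle.sum_trivCoord (B : HolBundle r) (x : ℂˣ) {t : ℂˣ} (ht : t ∈ B.trivSet x)
    (v : B.E t) : v = ∑ i, B.trivCoord x t v i • B.trivFrame x i t := by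
  have h := ((trivializationAt (Fin r → ℂ) B.E x).basisAt (Pi.basisFun ℂ (Fin r)) ht).sum_repr v
  rw [← h]
  refine Finset.sum_congr rfl fun i _ => ?_
  rw [h, HolBundle.trivFrame, Trivialization.localFrame_apply_of_mem_baseSet _ _ ht]
  congr 1

theorem HolBundle.holFunAt_trivCoord (B : HolBundle r) (x : ℂˣ) {t : ℂˣ} (ht : t ∈ B.trivSet x)
    {s : ∀ t, B.E t} (hs : B.HolAt s t) (i : Fin r) :
    HolFunAt (fun y => B.trivCoord x y (s y) i) t := by
  have h1 := ((trivializationAt (Fin r → ℂ) B.E x).contMDiffAt_section_iff ht).1 hs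
  exact contMDiffAt_pi_space.1 h1 i

theorem HolBundle.trivCoord_map (B : HolBundle r) (x : ℂˣ) {t : ℂˣ} (ht : t ∈ B.trivSet x)
    {ι : Type*} (I : Finset ι) (a : ι → ℂ) (v : ι → B.E t) :
    B.trivCoord x t (∑ i ∈ I, a i • v i) = ∑ i ∈ I, a i • B.trivCoord x t (v i) := by
  have h : ∀ v, B.trivCoord x t v =
      (trivializationAt (Fin r → ℂ) B.E x).linearEquivAt (R := ℂ) t ht v := fun v => rfl
  simp only [h, map_sum, map_smul]

/-- A fibrewise linear map that preserves holomorphy of sections is holomorphic on total spaces. -/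
theorem contMDiff_totalMap {B B' : HolBundle r} (L : ∀ t, B.E t →ₗ[ℂ] B'.E t)
    (hL : ∀ U, IsOpen U → ∀ s, (∀ t ∈ U, B.HolAt s t) →
      ∀ t ∈ U, B'.HolAt (fun x => L x (s x)) t) :
    ContMDiff (𝓘(ℂ, ℂ).prod 𝓘(ℂ, Fin r → ℂ)) (𝓘(ℂ, ℂ).prod 𝓘(ℂ, Fin r → ℂ)) ω
      (fun p : TotalSpace (Fin r → ℂ) B.E => TotalSpace.mk' (Fin r → ℂ) p.1 (L p.1 p.2)) := by
  intro p
  rw [contMDiffAt_totalSpace]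
  refine ⟨contMDiffAt_proj B.E, ?_⟩
  change ContMDiffAt _ _ ω
    (fun q : TotalSpace (Fin r → ℂ) B.E => B'.trivCoord p.1 q.1 (L q.1 q.2)) p
  have hp : ContMDiffAt (𝓘(ℂ, ℂ).prod 𝓘(ℂ, Fin r → ℂ)) 𝓘(ℂ, ℂ) ω
    (fun q : TotalSpace (Fin r → ℂ) B.E => q.1) p := contMDiffAt_proj B.E
  -- By linearity the fibre coordinate is a finite sum of coordinates of the vector times images of
  -- frame sections; each factor is holomorphic.
  have h1 : ContMDiffAt (𝓘(ℂ, ℂ).prod 𝓘(ℂ, Fin r → ℂ)) 𝓘(ℂ, Fin r → ℂ) ω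
      (fun q : TotalSpace (Fin r → ℂ) B.E => ∑ i, B.trivCoord p.1 q.1 q.2 i •
        B'.trivCoord p.1 q.1 (L q.1 (B.trivFrame p.1 i q.1))) p := by
    refine contMDiffAt_finsetSum fun i _ => ?_
    have ha : ContMDiffAt (𝓘(ℂ, ℂ).prod 𝓘(ℂ, Fin r → ℂ)) 𝓘(ℂ, ℂ) ω
        (fun q : TotalSpace (Fin r → ℂ) B.E => B.trivCoord p.1 q.1 q.2 i) p := by
      have := ((contMDiffAt_totalSpace (f := fun q : TotalSpace (Fin r → ℂ) B.E => q)
        (IM := 𝓘(ℂ, ℂ).prod 𝓘(ℂ, Fin r → ℂ)) (IB := 𝓘(ℂ, ℂ)) (n := ω) (x₀ := p)).1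
          contMDiffAt_id).2
      exact contMDiffAt_pi_space.1 this i
    have hb : ContMDiffAt (𝓘(ℂ, ℂ).prod 𝓘(ℂ, Fin r → ℂ)) 𝓘(ℂ, Fin r → ℂ) ω
        (fun q : TotalSpace (Fin r → ℂ) B.E =>
          B'.trivCoord p.1 q.1 (L q.1 (B.trivFrame p.1 i q.1))) p := by
      have h2 := hL _ (B.isOpen_trivSet p.1) _ (fun t ht =>
        (B.isHolFrame_trivFrame p.1).holAt (B.isOpen_trivSet p.1) ht i) _ (B.mem_trivSet p.1)
      have h3 := (contMDiffAt_section p.1).1 h2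
      exact ContMDiffAt.comp p (f := fun q : TotalSpace (Fin r → ℂ) B.E => q.1) h3 hp
    exact ha.smul hb
  refine h1.congr_of_eventuallyEq ?_
  have h2 : ∀ᶠ q in 𝓝 p, q.1 ∈ B.trivSet p.1 ∩ B'.trivSet p.1 :=
    hp.continuousAt.eventually_mem (((B.isOpen_trivSet p.1).inter (B'.isOpen_trivSet p.1)).mem_nhds
      ⟨B.mem_trivSet p.1, B'.mem_trivSet p.1⟩)
  filter_upwards [h2] with q hq
  conv_lhs => rw [B.sum_trivCoord p.1 hq.1 q.2]
  rw [map_sum]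
  simp_rw [map_smul]
  exact B'.trivCoord_map p.1 hq.2 _ _ _

theorem Data.Iso.holAt {S₁ S₂ : Data r} (T : Data.Iso S₁ S₂) {s : ∀ t, S₁.E t} {t : ℂˣ}
    (hs : S₁.HolAt s t) : S₂.HolAt (fun x => T.map x (s x)) t :=
  ContMDiffAt.comp t (T.hol _) hs

/-- Build an isomorphism from fibrewise maps preserving holomorphic sections. -/
def Data.Iso.ofSections {S₁ S₂ : Data r} (L : ∀ t, S₁.E t ≃ₗ[ℂ] S₂.E t)
    (h : ∀ U, IsOpen U → ∀ s, (∀ t ∈ U, S₁.HolAt s t) →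
      ∀ t ∈ U, S₂.HolAt (fun x => L x (s x)) t)
    (h' : ∀ U, IsOpen U → ∀ s, (∀ t ∈ U, S₂.HolAt s t) →
      ∀ t ∈ U, S₁.HolAt (fun x => (L x).symm (s x)) t)
    (hη : ∀ t a b, S₁.η t a b = S₂.η t (L t a) (L t b))
    (hg : ∀ t a b, S₁.g t a b = S₂.g t (L t a) (L t b))
    (hΦ : ∀ t X a, L t (S₁.Φ t X a) = S₂.Φ t X (L t a)) : Data.Iso S₁ S₂ where
  map := L
  hol := contMDiff_totalMap (fun t => (L t : S₁.E t →ₗ[ℂ] S₂.E t)) h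
  hol_symm := contMDiff_totalMap (fun t => ((L t).symm : S₂.E t →ₗ[ℂ] S₁.E t)) h'
  map_η := hη
  map_g := hg
  map_Φ := hΦ

theorem HolBundle.HolAt.pull {B : HolBundle r} {s : ∀ t, B.E t} {u t : ℂˣ}
    (hs : B.HolAt s (u * t)) : (B.pull u).HolAt (fun x => (s (u * x) : B.E (u * x))) t := by
  refine (contMDiffAt_section (F := Fin r → ℂ) (E := (B.pull u).E) t).2 ?_
  have h1 := (contMDiffAt_section (F := Fin r → ℂ) (E := B.E) (u * t)).1 hs
  exact ContMDiffAt.comp t (f := mulMap u) h1 (mulMap u).contMDiff.contMDiffAt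

end TTStar
end

noncomputable section

namespace TTStar

open Filter Topology

/-! ## Wirtinger derivatives -/

section Wirtinger

variable {V : Type*} [NormedAddCommGroup V] [NormedSpace ℂ V]

/-- The operators `∂/∂z` (`ε = -1`) and `∂/∂z̄` (`ε = 1`). -/
def wirt (ε : ℝ) (f : ℂ → V) (z : ℂ) : V :=
  (1 / 2 : ℂ) • (fderiv ℝ f z 1 + ((ε : ℂ) * Complex.I) • fderiv ℝ f z Complex.I)

theorem wirt_congr {ε : ℝ} {f g : ℂ → V} {z : ℂ} (h : f =ᶠ[𝓝 z] g) : wirt ε f z = wirt ε g z := by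
  simp only [wirt, h.fderiv_eq]

theorem wirt_eventuallyEq {ε : ℝ} {f g : ℂ → V} {z : ℂ} (h : f =ᶠ[𝓝 z] g) :
    wirt ε f =ᶠ[𝓝 z] wirt ε g :=
  h.eventuallyEq_nhds.mono fun _ hx => wirt_congr hx

@[simp] theorem wirt_const (ε : ℝ) (v : V) (z : ℂ) : wirt ε (fun _ => v) z = 0 := by
  simp [wirt]

theorem wirt_add {ε : ℝ} {f g : ℂ → V} {z : ℂ} (hf : DifferentiableAt ℝ f z)
    (hg : DifferentiableAt ℝ g z) : wirt ε (fun x => f x + g x) z = wirt ε f z + wirt ε g z := by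
  simp only [wirt, fderiv_fun_add hf hg, _root_.add_apply]
  module

theorem wirt_sub {ε : ℝ} {f g : ℂ → V} {z : ℂ} (hf : DifferentiableAt ℝ f z)
    (hg : DifferentiableAt ℝ g z) : wirt ε (fun x => f x - g x) z = wirt ε f z - wirt ε g z := by
  simp only [wirt, fderiv_fun_sub hf hg, _root_.sub_apply]
  module

theorem wirt_const_smul {ε : ℝ} {f : ℂ → V} {z : ℂ} (c : ℂ) (hf : DifferentiableAt ℝ f z) :
    wirt ε (fun x => c • f x) z = c • wirt ε f z := by
  simp only [wirt, fderiv_fun_const_smul hf, _root_.smul_apply]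
  module

theorem wirt_clm {W : Type*} [NormedAddCommGroup W] [NormedSpace ℂ W] {ε : ℝ} {f : ℂ → V} {z : ℂ} (L : V →L[ℂ] W)
    (hf : DifferentiableAt ℝ f z) : wirt ε (fun x => L (f x)) z = L (wirt ε f z) := by
  have h : HasFDerivAt (fun x => L (f x)) ((L.restrictScalars ℝ).comp (fderiv ℝ f z)) z :=
    (L.restrictScalars ℝ).hasFDerivAt.comp z hf.hasFDerivAt
  simp [wirt, h.fderiv]

/-- Conjugate-linearity exchanges `∂` and `∂̄`, whence the sign change of `ε`. The real-linear map
`L'` is the same map in the form that can be composed with a real Fréchet derivative. -/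
theorem wirt_conj_clm {W : Type*} [NormedAddCommGroup W] [NormedSpace ℂ W] {ε : ℝ} {f : ℂ → V} {z : ℂ} (L : V →L⋆[ℂ] W) (L' : V →L[ℝ] W)
    (hL : ∀ v, L v = L' v)
    (hf : DifferentiableAt ℝ f z) : wirt ε (fun x => L (f x)) z = L (wirt (-ε) f z) := by
  have h : HasFDerivAt (fun x => L' (f x)) (L'.comp (fderiv ℝ f z)) z :=
    L'.hasFDerivAt.comp z hf.hasFDerivAt
  have h' : fderiv ℝ (fun x => L (f x)) z = L'.comp (fderiv ℝ f z) := by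
    simp_rw [hL]; exact h.fderiv
  simp only [wirt, h', ContinuousLinearMap.comp_apply, ← hL]
  simp [map_smulₛₗ, Complex.conj_ofNat]

theorem wirt_mul {A : Type*} [NormedRing A] [NormedAlgebra ℂ A] {ε : ℝ} {f g : ℂ → A} {z : ℂ} (hf : DifferentiableAt ℝ f z)
    (hg : DifferentiableAt ℝ g z) :
    wirt ε (fun x => f x * g x) z = wirt ε f z * g z + f z * wirt ε g z := by
  simp only [wirt, fderiv_fun_mul' hf hg, _root_.add_apply,
    _root_.smul_apply, MulOpposite.smul_eq_mul_unop, smul_eq_mul,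
    MulOpposite.unop_op, smul_add, add_mul, mul_add, smul_mul_assoc, mul_smul_comm]
  abel

/-- A holomorphic substitution does not mix `∂` and `∂̄`: the chain rule contributes `ψ'` to the
first and its conjugate to the second. -/
theorem wirt_comp_hol {ε : ℝ} {f : ℂ → V} {ψ : ℂ → ℂ} {z d : ℂ} (hε : ε = -1 ∨ ε = 1)
    (hf : DifferentiableAt ℝ f (ψ z)) (hψ : HasDerivAt ψ d z) :
    wirt ε (fun x => f (ψ x)) z =
      (if ε = -1 then d else starRingEnd ℂ d) • wirt ε f (ψ z) := by
  have h1 : HasFDerivAt ψ ((ContinuousLinearMap.toSpanSingleton ℂ d).restrictScalars ℝ) z :=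
    hψ.hasFDerivAt.restrictScalars ℝ
  have h : HasFDerivAt (fun x => f (ψ x)) _ z := hf.hasFDerivAt.comp z h1
  -- The derivative is only real-linear, so its value in a complex direction is split along `1` and
  -- `I`.
  have key : ∀ c : ℂ, fderiv ℝ f (ψ z) c =
      (c.re : ℂ) • fderiv ℝ f (ψ z) 1 + (c.im : ℂ) • fderiv ℝ f (ψ z) Complex.I := by
    intro c
    have hc : c = c.re • (1 : ℂ) + c.im • Complex.I := by
      simp [Complex.re_add_im]
    conv_lhs => rw [hc]
    rw [map_add, map_smul, map_smul]
    rfl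
  simp only [wirt, h.fderiv, ContinuousLinearMap.comp_apply,
    ContinuousLinearMap.coe_restrictScalars', ContinuousLinearMap.toSpanSingleton_apply,
    smul_eq_mul, one_mul]
  rw [key d, key (Complex.I * d)]
  have hd := Complex.re_add_im d
  have hI := Complex.I_mul_I
  rcases hε with rfl | rfl
  · rw [if_pos rfl]
    conv_rhs => rw [← hd]
    simp only [Complex.mul_re, Complex.mul_im, Complex.I_re, Complex.I_im, zero_mul, one_mul,
      zero_sub, zero_add]
    push_cast
    match_scalars
    · ring
    · linear_combination (1 / 2 * (d.im : ℂ)) * hI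
  · rw [if_neg (by norm_num)]
    conv_rhs => rw [← hd]
    simp only [Complex.mul_re, Complex.mul_im, Complex.I_re, Complex.I_im, zero_mul, one_mul,
      zero_sub, zero_add, map_add, map_mul, Complex.conj_ofReal, Complex.conj_I]
    push_cast
    match_scalars
    · ring
    · linear_combination (1 / 2 * (d.im : ℂ)) * hI

theorem wirt_one_of_differentiableAt {f : ℂ → V} {z : ℂ} (hf : DifferentiableAt ℂ f z) :
    wirt 1 f z = 0 := by
  have h : HasFDerivAt f ((fderiv ℂ f z).restrictScalars ℝ) z := hf.hasFDerivAt.restrictScalars ℝ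
  have hI : fderiv ℂ f z Complex.I = Complex.I • fderiv ℂ f z 1 := by
    rw [← map_smul]; simp
  simp only [wirt, h.fderiv, ContinuousLinearMap.coe_restrictScalars', hI, smul_smul]
  simp

theorem contDiffAt_wirt {ε : ℝ} {f : ℂ → V} {z : ℂ} (hf : ContDiffAt ℝ ∞ f z) :
    ContDiffAt ℝ ∞ (wirt ε f) z := by
  have h : ContDiffAt ℝ ∞ (fderiv ℝ f) z := hf.fderiv_right (by simp)
  have h1 : ContDiffAt ℝ ∞ (fun x => fderiv ℝ f x 1) z := h.clm_apply contDiffAt_const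
  have h2 : ContDiffAt ℝ ∞ (fun x => fderiv ℝ f x Complex.I) z := h.clm_apply contDiffAt_const
  exact (h1.add (h2.const_smul ((ε : ℂ) * Complex.I))).const_smul (1 / 2 : ℂ)

/-- Both sides are combinations of second derivatives of `f`, and the second derivative is
symmetric. -/
theorem wirt_comm {ε ε' : ℝ} {f : ℂ → V} {z : ℂ} (hf : ContDiffAt ℝ ∞ f z) :
    wirt ε (wirt ε' f) z = wirt ε' (wirt ε f) z := by
  have h : DifferentiableAt ℝ (fderiv ℝ f) z :=
    (hf.fderiv_right (m := ∞) (by simp)).differentiableAt (by simp)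
  have hv : ∀ v : ℂ, HasFDerivAt (fun x => fderiv ℝ f x v)
      ((ContinuousLinearMap.apply ℝ V v).comp (fderiv ℝ (fderiv ℝ f) z)) z := fun v =>
    (ContinuousLinearMap.apply ℝ V v).hasFDerivAt.comp z h.hasFDerivAt
  have hs : IsSymmSndFDerivAt ℝ f z := hf.isSymmSndFDerivAt (by simp; exact WithTop.coe_le_coe.2 le_top)
  have hw : ∀ δ : ℝ, HasFDerivAt (wirt δ f) _ z := fun δ =>
    ((hv 1).add ((hv Complex.I).const_smul ((δ : ℂ) * Complex.I))).const_smul (1 / 2 : ℂ)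
  unfold wirt at hw ⊢
  rw [(hw ε).fderiv, (hw ε').fderiv]
  simp only [_root_.smul_apply, _root_.add_apply,
    ContinuousLinearMap.comp_apply, ContinuousLinearMap.apply_apply]
  rw [hs.eq 1 Complex.I]
  module

end Wirtinger

theorem dt_eq (f : ℂˣ → ℂ) (t : ℂˣ) : dt f t = wirt (-1) (onPlane f) t := by
  simp [dt, wirt, sub_eq_add_neg]

theorem dtbar_eq (f : ℂˣ → ℂ) (t : ℂˣ) : dtbar f t = wirt 1 (onPlane f) t := by
  simp [dtbar, wirt]

theorem onPlane_eventuallyEq {X : Type*} [Zero X] {f : ℂˣ → X} {F : ℂ → X} {t : ℂˣ}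
    (h : ∀ᶠ s : ℂˣ in 𝓝 t, f s = F s) : onPlane f =ᶠ[𝓝 (t : ℂ)] F := by
  filter_upwards [eventually_nhds_units.1 h, eventually_ne_zero t] with z hz h0
  rw [onPlane_of_ne f h0, hz h0, Units.val_mk0]

theorem dt_congr {f : ℂˣ → ℂ} {F : ℂ → ℂ} {t : ℂˣ} (h : ∀ᶠ s : ℂˣ in 𝓝 t, f s = F s) :
    dt f t = wirt (-1) F t := by
  rw [dt_eq]; exact wirt_congr (onPlane_eventuallyEq h)

theorem dtbar_congr {f : ℂˣ → ℂ} {F : ℂ → ℂ} {t : ℂˣ} (h : ∀ᶠ s : ℂˣ in 𝓝 t, f s = F s) :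
    dtbar f t = wirt 1 F t := by
  rw [dtbar_eq]; exact wirt_congr (onPlane_eventuallyEq h)


/-! ## Matrix valued functions -/

section MatrixCalculus

variable {N : ℕ}

/-- A normed ring structure on matrices, used for calculus. -/
@[reducible] def matNormedRing (N : ℕ) : NormedRing (Matrix (Fin N) (Fin N) ℂ) :=
  Matrix.linftyOpNormedRing

attribute [local instance] matNormedRing

/-- The complex normed algebra structure on matrices, used for calculus. -/
@[reducible] def matNormedAlgebra (N : ℕ) : NormedAlgebra ℂ (Matrix (Fin N) (Fin N) ℂ) :=
  Matrix.linftyOpNormedAlgebra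

attribute [local instance] matNormedAlgebra

/-- The entries of a matrix as continuous linear maps. -/
def entryCLM (i j : Fin N) : Matrix (Fin N) (Fin N) ℂ →L[ℂ] ℂ :=
  LinearMap.toContinuousLinearMap (Matrix.entryLinearMap ℂ ℂ i j)

@[simp] theorem entryCLM_apply (i j : Fin N) (M : Matrix (Fin N) (Fin N) ℂ) :
    entryCLM i j M = M i j := rfl

theorem contDiffAt_matrix {n : WithTop ℕ∞}
    {M : ℂ → Matrix (Fin N) (Fin N) ℂ} {z : ℂ} :
    ContDiffAt ℂ n M z ↔ ∀ i j, ContDiffAt ℂ n (fun x => M x i j) z := by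
  constructor
  · intro h i j
    exact ContDiffAt.comp z (g := entryCLM i j) ((entryCLM i j).contDiff).contDiffAt h
  · intro h
    have : M = fun x => ∑ i, ∑ j,
        ContinuousLinearMap.toSpanSingleton ℂ (Matrix.single i j (1 : ℂ)) (M x i j) := by
      funext x
      conv_lhs => rw [Matrix.matrix_eq_sum_single (M x)]
      simp [Matrix.smul_single]
    rw [this]
    refine ContDiffAt.sum fun i _ => ContDiffAt.sum fun j _ => ?_
    exact ContDiffAt.comp z (g := ContinuousLinearMap.toSpanSingleton ℂ (Matrix.single i j (1 : ℂ)))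
      ((ContinuousLinearMap.contDiff _)).contDiffAt (h i j)

theorem contDiffAt_matrix_real {n : WithTop ℕ∞}
    {M : ℂ → Matrix (Fin N) (Fin N) ℂ} {z : ℂ} :
    ContDiffAt ℝ n M z ↔ ∀ i j, ContDiffAt ℝ n (fun x => M x i j) z := by
  constructor
  · intro h i j
    exact ContDiffAt.comp z (g := entryCLM i j) ((entryCLM i j).contDiff.restrict_scalars ℝ).contDiffAt h
  · intro h
    have : M = fun x => ∑ i, ∑ j,
        ContinuousLinearMap.toSpanSingleton ℂ (Matrix.single i j (1 : ℂ)) (M x i j) := by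
      funext x
      conv_lhs => rw [Matrix.matrix_eq_sum_single (M x)]
      simp [Matrix.smul_single]
    rw [this]
    refine ContDiffAt.sum fun i _ => ContDiffAt.sum fun j _ => ?_
    exact ContDiffAt.comp z (g := ContinuousLinearMap.toSpanSingleton ℂ (Matrix.single i j (1 : ℂ)))
      ((ContinuousLinearMap.contDiff _).restrict_scalars ℝ).contDiffAt (h i j)

theorem wirt_apply {ε : ℝ} {M : ℂ → Matrix (Fin N) (Fin N) ℂ} {z : ℂ}
    (hM : DifferentiableAt ℝ M z) (i j : Fin N) :
    wirt ε M z i j = wirt ε (fun x => M x i j) z :=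
  (wirt_clm (entryCLM i j) hM).symm

theorem contDiffAt_inv {M : ℂ → Matrix (Fin N) (Fin N) ℂ} {z : ℂ}
    (hM : ContDiffAt ℝ ∞ M z) (h : IsUnit (M z)) : ContDiffAt ℝ ∞ (fun x => (M x)⁻¹) z := by
  obtain ⟨u, hu⟩ := h
  have := (contDiffAt_ringInverse ℝ u (n := ∞))
  rw [hu] at this
  simpa only [Function.comp_def, Matrix.nonsing_inv_eq_ringInverse] using this.comp z hM

/-- Differentiate `M * M⁻¹ = 1`, which holds near `z` because the units form an open set. -/
theorem wirt_inv {ε : ℝ} {M : ℂ → Matrix (Fin N) (Fin N) ℂ} {z : ℂ}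
    (hM : ContDiffAt ℝ ∞ M z) (h : IsUnit (M z)) :
    wirt ε (fun x => (M x)⁻¹) z = -((M z)⁻¹ * wirt ε M z * (M z)⁻¹) := by
  have hu : ∀ᶠ x in 𝓝 z, IsUnit (M x) := hM.continuousAt.eventually_mem (Units.isOpen.mem_nhds h)
  have h1 := wirt_mul (ε := ε) (hM.differentiableAt (by simp))
    ((contDiffAt_inv hM h).differentiableAt (by simp))
  have h2 : wirt ε (fun x => M x * (M x)⁻¹) z = 0 := by
    rw [wirt_congr (g := fun _ => 1) (hu.mono fun x hx => ?_), wirt_const]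
    exact Matrix.mul_nonsing_inv _ ((Matrix.isUnit_iff_isUnit_det _).1 hx)
  rw [h2] at h1
  have h3 := congrArg (fun X => (M z)⁻¹ * X) h1
  simp only [mul_zero, mul_add, ← mul_assoc,
    Matrix.nonsing_inv_mul _ ((Matrix.isUnit_iff_isUnit_det _).1 h), one_mul] at h3
  exact eq_neg_of_add_eq_zero_right h3.symm

/-- The conjugate transpose as a continuous conjugate-linear map. -/
def conjTransposeCLM : Matrix (Fin N) (Fin N) ℂ →L⋆[ℂ] Matrix (Fin N) (Fin N) ℂ where
  toFun := conjTranspose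
  map_add' := conjTranspose_add
  map_smul' c M := by simp
  cont := by
    have h : Continuous (fun M : Matrix (Fin N) (Fin N) ℂ => ∑ i, ∑ j,
        star (entryCLM j i M) • Matrix.single i j (1 : ℂ)) := by fun_prop
    convert h using 2 with M
    conv_lhs => rw [Matrix.matrix_eq_sum_single Mᴴ]
    simp [Matrix.smul_single]

def conjTransposeRealCLM : Matrix (Fin N) (Fin N) ℂ →L[ℝ] Matrix (Fin N) (Fin N) ℂ where
  toFun := conjTranspose
  map_add' := conjTranspose_add
  map_smul' c M := by
    ext i j
    simp [← Complex.coe_smul]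
  cont := conjTransposeCLM.cont

theorem wirt_conjTranspose {ε : ℝ} {M : ℂ → Matrix (Fin N) (Fin N) ℂ} {z : ℂ}
    (hM : DifferentiableAt ℝ M z) : wirt ε (fun x => (M x)ᴴ) z = (wirt (-ε) M z)ᴴ :=
  wirt_conj_clm conjTransposeCLM conjTransposeRealCLM (fun _ => rfl) hM

theorem contDiffAt_conjTranspose {M : ℂ → Matrix (Fin N) (Fin N) ℂ} {z : ℂ}
    (hM : ContDiffAt ℝ ∞ M z) : ContDiffAt ℝ ∞ (fun x => (M x)ᴴ) z :=
  conjTransposeRealCLM.contDiff.contDiffAt.comp z hM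

/-- The Chern connection matrix `h⁻¹ ∂h`. -/
def chern (h : ℂ → Matrix (Fin N) (Fin N) ℂ) (z : ℂ) : Matrix (Fin N) (Fin N) ℂ :=
  (h z)⁻¹ * wirt (-1) h z

/-- The adjoint `h⁻¹ φᴴ h` of `φ` with respect to `h`. -/
def adj (h φ : Matrix (Fin N) (Fin N) ℂ) : Matrix (Fin N) (Fin N) ℂ := h⁻¹ * φᴴ * h

theorem contDiffAt_chern {h : ℂ → Matrix (Fin N) (Fin N) ℂ} {z : ℂ}
    (hh : ContDiffAt ℝ ∞ h z) (hu : IsUnit (h z)) : ContDiffAt ℝ ∞ (chern h) z :=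
  (contDiffAt_inv hh hu).mul (contDiffAt_wirt hh)

theorem contDiffAt_adj {h φ : ℂ → Matrix (Fin N) (Fin N) ℂ} {z : ℂ}
    (hh : ContDiffAt ℝ ∞ h z) (hu : IsUnit (h z)) (hφ : ContDiffAt ℝ ∞ φ z) :
    ContDiffAt ℝ ∞ (fun x => adj (h x) (φ x)) z :=
  ((contDiffAt_inv hh hu).mul (contDiffAt_conjTranspose hφ)).mul hh

theorem ContDiffAt.toReal {V : Type*} [NormedAddCommGroup V] [NormedSpace ℂ V] {f : ℂ → V} {z : ℂ}
    (hf : ContDiffAt ℂ ω f z) : ContDiffAt ℝ ∞ f z :=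
  (hf.restrict_scalars ℝ).of_le le_top

theorem wirt_one_hol {V : Type*} [NormedAddCommGroup V] [NormedSpace ℂ V] {f : ℂ → V} {z : ℂ}
    (hf : ContDiffAt ℂ ω f z) : wirt 1 f z = 0 :=
  wirt_one_of_differentiableAt (hf.differentiableAt (by simp))

/-- `∂(φ^†) = [φ^†, h⁻¹∂h]` for holomorphic `φ`. -/
theorem wirt_adj {h φ : ℂ → Matrix (Fin N) (Fin N) ℂ} {z : ℂ}
    (hh : ContDiffAt ℝ ∞ h z) (hu : IsUnit (h z)) (hφ : ContDiffAt ℂ ω φ z) :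
    wirt (-1) (fun x => adj (h x) (φ x)) z =
      adj (h z) (φ z) * chern h z - chern h z * adj (h z) (φ z) := by
  have hφ' := ContDiffAt.toReal hφ
  have d1 := (contDiffAt_inv hh hu).differentiableAt (n := ∞) (by simp)
  have d2 := (contDiffAt_conjTranspose hφ').differentiableAt (n := ∞) (by simp)
  unfold adj
  rw [wirt_mul (f := fun x => (h x)⁻¹ * (φ x)ᴴ) (d1.mul d2) (hh.differentiableAt (by simp)), wirt_mul d1 d2, wirt_inv hh hu,
    wirt_conjTranspose (hφ'.differentiableAt (by simp)), neg_neg, wirt_one_hol hφ]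
  have hi := Matrix.mul_nonsing_inv (h z) ((Matrix.isUnit_iff_isUnit_det _).1 hu)
  simp only [conjTranspose_zero, mul_zero, add_zero, chern]
  have e : (h z)⁻¹ * (φ z)ᴴ * h z * ((h z)⁻¹ * wirt (-1) h z) =
      (h z)⁻¹ * (φ z)ᴴ * (h z * (h z)⁻¹) * wirt (-1) h z := by noncomm_ring
  rw [e, hi]
  noncomm_ring


/-- For holomorphic `φ`, the curvature of `D + lam⁻¹ φ + lam φ^†` is `[φ, φ^†] - ∂̄(h⁻¹∂h)`. -/
theorem curvature_formula {h φ : ℂ → Matrix (Fin N) (Fin N) ℂ} {z : ℂ} {lam : ℂ} (hl : lam ≠ 0)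
    (hh : ContDiffAt ℝ ∞ h z) (hu : IsUnit (h z)) (hφ : ContDiffAt ℂ ω φ z) :
    wirt (-1) (fun x => lam • adj (h x) (φ x)) z - wirt 1 (fun x => chern h x + lam⁻¹ • φ x) z
      + (chern h z + lam⁻¹ • φ z) * (lam • adj (h z) (φ z))
      - (lam • adj (h z) (φ z)) * (chern h z + lam⁻¹ • φ z) =
    φ z * adj (h z) (φ z) - adj (h z) (φ z) * φ z - wirt 1 (chern h) z := by
  have hφ' := ContDiffAt.toReal hφ
  have d1 := (contDiffAt_adj hh hu hφ').differentiableAt (n := ∞) (by simp)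
  have d2 := (contDiffAt_chern hh hu).differentiableAt (n := ∞) (by simp)
  have d3 := hφ'.differentiableAt (n := ∞) (by simp)
  rw [wirt_const_smul lam d1, wirt_add d2 (d3.fun_const_smul lam⁻¹), wirt_const_smul lam⁻¹ d3,
    wirt_one_hol hφ, wirt_adj hh hu hφ]
  generalize adj (h z) (φ z) = B
  generalize wirt 1 (chern h) z = C
  generalize chern h z = A
  generalize φ z = P
  simp only [add_mul, mul_add, smul_mul_assoc, mul_smul_comm, smul_smul, mul_inv_cancel₀ hl,
    inv_mul_cancel₀ hl, one_smul, smul_sub, smul_add, smul_zero, add_zero]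
  abel

end MatrixCalculus

end TTStar
end

/-! ### The flatness equation of a tt*-structure in a holomorphic frame. -/

noncomputable section

namespace TTStar

open Filter Topology ComplexOrder

attribute [local instance] matNormedRing
attribute [local instance] matNormedAlgebra

variable {r n : ℕ}

theorem onPlane_apply {N : ℕ} (M : ℂˣ → Matrix (Fin N) (Fin N) ℂ) (z : ℂ) (i j : Fin N) :
    onPlane M z i j = onPlane (fun s => M s i j) z := by
  unfold onPlane; split_ifs <;> rfl

theorem eventually_units {p : ℂ → Prop} {t : ℂˣ} (h : ∀ᶠ z in 𝓝 (t : ℂ), p z) :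
    ∀ᶠ s : ℂˣ in 𝓝 t, p s :=
  Units.continuous_val.continuousAt.eventually h

theorem SmoothOn.contDiffAt {X : Type*} [NormedAddCommGroup X] [NormedSpace ℝ X] {f : ℂˣ → X}
    {U : Set ℂˣ} (hf : SmoothOn f U) (hU : IsOpen U) {t : ℂˣ} (ht : t ∈ U) :
    ContDiffAt ℝ ∞ (onPlane f) t :=
  ContDiffOn.contDiffAt hf
    ((Units.isOpenEmbedding_val.isOpenMap U hU).mem_nhds (Set.mem_image_of_mem _ ht))

theorem smoothOn_of_contDiffAt {X : Type*} [NormedAddCommGroup X] [NormedSpace ℝ X] {f : ℂˣ → X}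
    {U : Set ℂˣ} (h : ∀ t ∈ U, ContDiffAt ℝ ∞ (onPlane f) t) : SmoothOn f U := by
  rintro _ ⟨t, ht, rfl⟩
  exact (h t ht).contDiffWithinAt

/-- The curvature in a holomorphic frame, for any value of the spectral parameter. -/
theorem Data.curvature_eq (S : Data r) {e : Fin r → ∀ t, S.E t}
    {φ : ℂˣ → Matrix (Fin r) (Fin r) ℂ} {t : ℂˣ} (lam : Circle)
    (hh : ContDiffAt ℝ ∞ (onPlane (S.gram e)) t) (hu : IsUnit (S.gram e t))
    (hφ : ContDiffAt ℂ ω (onPlane φ) t) :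
    S.curvature e φ lam t = φ t * adj (S.gram e t) (φ t) - adj (S.gram e t) (φ t) * φ t -
      wirt 1 (chern (onPlane (S.gram e))) t := by
  have hu' : IsUnit (onPlane (S.gram e) t) := by rwa [onPlane_coe]
  have hφ' := ContDiffAt.toReal hφ
  -- `connDt` differentiates the Gram matrix entry by entry and `chern` as a matrix. The two agree
  -- where it is differentiable, and agreement on a whole neighbourhood is needed in order to
  -- differentiate once more.
  have hev : ∀ᶠ s : ℂˣ in 𝓝 t, DifferentiableAt ℝ (onPlane (S.gram e)) s :=
    eventually_units ((hh.of_le (m := 1) (by simp)).eventually (by simp) |>.mono fun z hz => hz.differentiableAt (by simp))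
  have hA : ∀ s : ℂˣ, DifferentiableAt ℝ (onPlane (S.gram e)) s →
      S.connDt e φ lam s = chern (onPlane (S.gram e)) s + (lam : ℂ)⁻¹ • onPlane φ s := by
    intro s hs
    rw [Data.connDt, chern, onPlane_coe, onPlane_coe]
    congr 2
    ext i j
    rw [wirt_apply hs, Matrix.of_apply, dt_eq]
    congr 1
    funext z
    exact (onPlane_apply _ _ _ _).symm
  have hB : ∀ s : ℂˣ, S.connDtbar e φ lam s =
      (lam : ℂ) • adj (onPlane (S.gram e) s) (onPlane φ s) := by
    intro s
    rw [Data.connDtbar, adj, onPlane_coe, onPlane_coe]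
  rw [Data.curvature, hA t hev.self_of_nhds, hB t]
  have d1 := (contDiffAt_adj hh hu' hφ').differentiableAt (n := ∞) (by simp)
  have d2 := (contDiffAt_chern hh hu').differentiableAt (n := ∞) (by simp)
  have d3 := hφ'.differentiableAt (n := ∞) (by simp)
  have e1 : Matrix.of (fun i j => dt (fun s => S.connDtbar e φ lam s i j) t) =
      wirt (-1) (fun x => (lam : ℂ) • adj (onPlane (S.gram e) x) (onPlane φ x)) t := by
    ext i j
    rw [wirt_apply (d1.fun_const_smul (lam : ℂ)), Matrix.of_apply]
    exact dt_congr (Eventually.of_forall fun s => by rw [hB])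
  have e2 : Matrix.of (fun i j => dtbar (fun s => S.connDt e φ lam s i j) t) =
      wirt 1 (fun x => chern (onPlane (S.gram e)) x + (lam : ℂ)⁻¹ • onPlane φ x) t := by
    ext i j
    rw [wirt_apply (d2.fun_add (d3.fun_const_smul (lam : ℂ)⁻¹)), Matrix.of_apply]
    exact dtbar_congr (hev.mono fun s hs => by rw [hA s hs])
  rw [e1, e2, curvature_formula lam.coe_ne_zero hh hu' hφ, onPlane_coe, onPlane_coe]

theorem HolBundle.finrank_eq (B : HolBundle r) (t : ℂˣ) : Module.finrank ℂ (B.E t) = r := by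
  rw [((trivializationAt (Fin r → ℂ) B.E t).linearEquivAt (R := ℂ) t
    (B.mem_trivSet t)).finrank_eq]
  simp

theorem HolBundle.finiteDimensional (B : HolBundle r) (t : ℂˣ) : FiniteDimensional ℂ (B.E t) :=
  ((trivializationAt (Fin r → ℂ) B.E t).linearEquivAt (R := ℂ) t
    (B.mem_trivSet t)).symm.finiteDimensional

theorem Data.IsTTStar.gram_posDef {S : Data r} (hS : S.IsTTStar) {e : Fin r → ∀ t, S.E t} {t : ℂˣ}
    (he : LinearIndependent ℂ fun i => e i t) : (S.gram e t).PosDef := by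
  refine Matrix.PosDef.of_dotProduct_mulVec_pos ?_ fun x hx => ?_
  · ext i j
    exact (hS.g_herm t (e i t) (e j t)).symm
  · have h1 : star x ⬝ᵥ (S.gram e t *ᵥ x) = S.g t (∑ i, x i • e i t) (∑ i, x i • e i t) := by
      simp only [map_sum, LinearMap.sum_apply, map_smulₛₗ, LinearMap.smul_apply, dotProduct,
        mulVec, Data.gram, Matrix.of_apply, Pi.star_apply, smul_eq_mul, RingHom.id_apply,
        Finset.mul_sum]
      rw [Finset.sum_comm]
      refine Finset.sum_congr rfl fun i _ => Finset.sum_congr rfl fun j _ => ?_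
      rw [RCLike.star_def]
      ring
    have h2 : ∑ i, x i • e i t ≠ 0 := fun h =>
      hx (funext fun i => Fintype.linearIndependent_iff.1 he x h i)
    rw [h1, Complex.pos_iff]
    refine ⟨hS.g_pos t _ h2, ?_⟩
    have := congrArg Complex.im (hS.g_herm t (∑ i, x i • e i t) (∑ i, x i • e i t))
    simp only [Complex.conj_im] at this
    linarith

theorem Data.IsTTStar.gram_smooth {S : Data r} (hS : S.IsTTStar) {e : Fin r → ∀ t, S.E t}
    {U : Set ℂˣ} (hU : IsOpen U) (he : S.IsHolFrame U e) {t : ℂˣ} (ht : t ∈ U) :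
    ContDiffAt ℝ ∞ (onPlane (S.gram e)) t := by
  rw [contDiffAt_matrix_real]
  intro i j
  simp_rw [onPlane_apply]
  exact (hS.g_smooth U hU _ _ (he.contMDiffOn i) (he.contMDiffOn j)).contDiffAt hU ht

theorem Data.IsTTStar.holFunAt_η {S : Data r} (hS : S.IsTTStar) {s s' : ∀ t, S.E t} {t : ℂˣ}
    {U : Set ℂˣ} (hU : IsOpen U) (ht : t ∈ U) (hs : ∀ x ∈ U, S.HolAt s x)
    (hs' : ∀ x ∈ U, S.HolAt s' x) : HolFunAt (fun x => S.η x (s x) (s' x)) t :=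
  (hS.η_hol U hU s s' ((S.isHolSection_iff hU).2 hs) ((S.isHolSection_iff hU).2 hs')).contMDiffAt
    (hU.mem_nhds ht)

theorem Data.IsTTStar.holAt_Φ {S : Data r} (hS : S.IsTTStar) {s : ∀ t, S.E t} {t : ℂˣ}
    {U : Set ℂˣ} (hU : IsOpen U) (ht : t ∈ U) (hs : ∀ x ∈ U, S.HolAt s x) :
    S.HolAt (fun x => S.Φ x 1 (s x)) t :=
  (S.isHolSection_iff hU).1 (hS.Φ_hol U hU s ((S.isHolSection_iff hU).2 hs)) t ht

/-- The flatness equation `∂̄(h⁻¹∂h) = [φ, φ^†]` in a holomorphic frame. -/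
theorem Data.IsTTStar.hitchin {S : Data r} (hS : S.IsTTStar) {e : Fin r → ∀ t, S.E t}
    {U : Set ℂˣ} (hU : IsOpen U) (he : S.IsHolFrame U e) {φ : ℂˣ → Matrix (Fin r) (Fin r) ℂ}
    (hφ : ∀ t ∈ U, ∀ j, S.Φ t 1 (e j t) = ∑ i, φ t i j • e i t) {t : ℂˣ} (ht : t ∈ U)
    (hφ' : ContDiffAt ℂ ω (onPlane φ) t) :
    wirt 1 (chern (onPlane (S.gram e))) t =
      φ t * adj (S.gram e t) (φ t) - adj (S.gram e t) (φ t) * φ t := by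
  -- One value of the spectral parameter is enough, since the curvature computed in `curvature_eq`
  -- does not depend on it.
  have h1 := hS.flat U hU e he φ hφ 1 t ht
  rw [S.curvature_eq 1 (hS.gram_smooth hU he ht)
    (hS.gram_posDef (he.linearIndependent ht)).isUnit hφ'] at h1
  exact (sub_eq_zero.1 h1).symm

end TTStar
end

noncomputable section

namespace TTStar

open Filter Topology

variable {n : ℕ}

/-! ## Toda frames -/

/-- A global holomorphic frame in which the structure has Toda form; the index `i + j = L`
describes `η`, and `W` is the logarithm of the metric. -/
structure TodaFrame (S : Data (n + 1)) (c : ℂ) (L : Fin (n + 1)) (W : Fin (n + 1) → ℂˣ → ℝ)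
    (e : Fin (n + 1) → ∀ t, S.E t) : Prop where
  hol : ∀ i t, S.HolAt (e i) t
  η : ∀ t i j, S.η t (e i t) (e j t) = if i + j = L then 1 else 0
  Φ : ∀ t i, S.Φ t 1 (e i t) = c • e (i + 1) t
  g : ∀ t i j, S.g t (e i t) (e j t) = if i = j then (Real.exp (W i t) : ℂ) else 0

namespace TodaFrame

variable {S : Data (n + 1)} {c : ℂ} {L L' : Fin (n + 1)} {W W' : Fin (n + 1) → ℂˣ → ℝ}
  {e e' : Fin (n + 1) → ∀ t, S.E t}

/-- Pairing with the frame reads off coefficients. Thus `η` alone yields linear independence, the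
expansion of a vector, and later the holomorphy of coefficients. -/
theorem η_sum (h : TodaFrame S c L W e) (t : ℂˣ) (a : Fin (n + 1) → ℂ) (j : Fin (n + 1)) :
    S.η t (∑ i, a i • e i t) (e j t) = a (L - j) := by
  simp only [map_sum, LinearMap.sum_apply, map_smul, LinearMap.smul_apply, h.η, smul_eq_mul,
    mul_ite, mul_one, mul_zero, ← eq_sub_iff_add_eq]
  simp

theorem linearIndependent (h : TodaFrame S c L W e) (t : ℂˣ) :
    LinearIndependent ℂ fun i => e i t := by
  rw [Fintype.linearIndependent_iff]
  intro a ha i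
  have := h.η_sum t a (L - i)
  rw [ha, map_zero, LinearMap.zero_apply, sub_sub_cancel] at this
  exact this.symm

theorem span_eq_top (h : TodaFrame S c L W e) (t : ℂˣ) :
    ⊤ ≤ Submodule.span ℂ (Set.range fun i => e i t) := by
  have := S.finiteDimensional t
  refine ((h.linearIndependent t).span_eq_top_of_card_eq_finrank ?_).ge
  rw [S.finrank_eq, Fintype.card_fin]

theorem expand (h : TodaFrame S c L W e) (t : ℂˣ) (v : S.E t) :
    v = ∑ i, S.η t v (e (L - i) t) • e i t := by
  obtain ⟨a, ha⟩ := (Submodule.mem_span_range_iff_exists_fun ℂ).1 (h.span_eq_top t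
    (Submodule.mem_top (x := v)))
  conv_lhs => rw [← ha]
  refine Finset.sum_congr rfl fun i _ => ?_
  rw [← ha, h.η_sum, sub_sub_cancel]

theorem isHolFrame (h : TodaFrame S c L W e) :
    S.IsHolFrame Set.univ e where
  linearIndependent {t} _ := h.linearIndependent t
  generating {t} _ := h.span_eq_top t
  contMDiffOn i := fun t _ => (h.hol i t).contMDiffWithinAt

/-- The metric is determined by `η`: `κ e_i = exp(W_i) e_{L-i}`. -/
theorem g_eq (h : TodaFrame S c L W e) (t : ℂˣ) (i : Fin (n + 1)) (b : S.E t) :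
    S.g t (e i t) b = Real.exp (W i t) * S.η t (e (L - i) t) b := by
  rw [h.expand t b]
  simp only [map_sum, map_smul, h.g, h.η, smul_eq_mul, Finset.mul_sum]
  refine Finset.sum_congr rfl fun k _ => ?_
  have : (L - i + k = L) ↔ i = k := by
    rw [sub_add_eq_add_sub, sub_eq_iff_eq_add, add_right_inj, eq_comm]
  simp only [this]
  split_ifs <;> ring

/-- Here `κ e_i = exp(W_i) e_{L-i}`, so `κ²` multiplies `e_i` by `exp(W_i + W_{L-i})`, and `κ² =
Id`. -/
theorem antisymm (h : TodaFrame S c L W e) (hS : S.IsTTStar) (t : ℂˣ) (i : Fin (n + 1)) :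
    W i t + W (L - i) t = 0 := by
  obtain ⟨κ, hκ, hκ'⟩ := hS.κ_invol t
  have h1 : ∀ i, κ (e i t) = (Real.exp (W i t) : ℂ) • e (L - i) t := by
    intro i
    rw [h.expand t (κ (e i t))]
    simp only [← hκ, h.g]
    rw [Finset.sum_eq_single (L - i)]
    · simp
    · intro j _ hj
      rw [if_neg, zero_smul]
      rintro rfl
      exact hj (by rw [sub_sub_cancel])
    · simp
  have h2 := hκ' (e i t)
  rw [h1, map_smulₛₗ, h1, sub_sub_cancel, smul_smul, Complex.conj_ofReal, ← Complex.ofReal_mul,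
    ← Real.exp_add] at h2
  have h3 : (((Real.exp (W i t + W (L - i) t) : ℝ) : ℂ) - 1) • e i t = 0 := by
    rw [sub_smul, h2, one_smul, sub_self]
  rcases smul_eq_zero.1 h3 with h4 | h4
  · rw [sub_eq_zero] at h4
    exact Real.exp_eq_one_iff _ |>.1 (by exact_mod_cast h4)
  · exact absurd h4 ((h.linearIndependent t).ne_zero i)

/-- Sum the antisymmetry over the involution `i ↦ L - i`. This normalisation later removes a common
factor when two metrics are compared. -/
theorem sum_eq_zero (h : TodaFrame S c L W e) (hS : S.IsTTStar) (t : ℂˣ) : ∑ i, W i t = 0 := by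
  have h1 : ∑ i, W (L - i) t = ∑ i, W i t :=
    Fintype.sum_equiv (Equiv.subLeft L) _ _ fun i => rfl
  have h2 : ∑ i, (W i t + W (L - i) t) = 0 := Finset.sum_eq_zero fun i _ => h.antisymm hS t i
  rw [Finset.sum_add_distrib, h1] at h2
  linarith

theorem holFunAt_coeff (h : TodaFrame S c L W e) (hS : S.IsTTStar) {s : ∀ t, S.E t} {t : ℂˣ}
    {U : Set ℂˣ} (hU : IsOpen U) (ht : t ∈ U) (hs : ∀ x ∈ U, S.HolAt s x) (i : Fin (n + 1)) :
    HolFunAt (fun x => S.η x (s x) (e i x)) t :=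
  hS.holFunAt_η hU ht hs fun x _ => h.hol i x

/-- The coefficients of one Toda frame with respect to another form a circulant matrix. -/
theorem change (h : TodaFrame S c L W e) (h' : TodaFrame S c L' W' e') (hc : c ≠ 0) (t : ℂˣ)
    (j : Fin (n + 1)) :
    e' j t = ∑ k, S.η t (e' 0 t) (e (L - k) t) • e (j + k) t := by
  induction j using Fin.induction with
  | zero => simpa using h.expand t (e' 0 t)
  | succ m ih =>
    have h1 := h'.Φ t m.castSucc
    rw [ih, map_sum] at h1
    simp only [map_smul, h.Φ, smul_comm _ c, ← Finset.smul_sum] at h1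
    have h2 := smul_right_injective _ hc h1
    rw [← Fin.coeSucc_eq_succ, ← h2]
    refine Finset.sum_congr rfl fun k _ => ?_
    rw [add_right_comm]

theorem coeff_eq (h : TodaFrame S c L W e) (h' : TodaFrame S c L' W' e') (hc : c ≠ 0) (t : ℂˣ)
    (j k : Fin (n + 1)) :
    S.η t (e' j t) (e (L - (j + k)) t) = S.η t (e' 0 t) (e (L - k) t) := by
  conv_lhs => rw [h.change h' hc t j]
  have : ∑ k, S.η t (e' 0 t) (e (L - k) t) • e (j + k) t =
      ∑ i, S.η t (e' 0 t) (e (L - (i - j)) t) • e i t :=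
    Fintype.sum_equiv (Equiv.addLeft j) _ _ fun k => by simp
  rw [this, h.η_sum]
  congr 3
  abel

/-- A nonzero coefficient identifies the metrics up to a shift of indices. -/
theorem shift_eq_of_coeff_ne_zero (h : TodaFrame S c L W e) (h' : TodaFrame S c L' W' e')
    (hS : S.IsTTStar) (hc : c ≠ 0) (t : ℂˣ) (k : Fin (n + 1))
    (hk : S.η t (e' 0 t) (e (L - k) t) ≠ 0) (j : Fin (n + 1)) : W' j t = W (j + k) t := by
  set a : Fin (n + 1) → ℂ := fun k => S.η t (e' 0 t) (e (L - k) t) with ha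
  -- Compute `g(e_{i+k}, e'_i)` from the frame `e` and its conjugate from the frame `e'`. Both
  -- reduce to `η`, whose coefficients are constant along the circulant diagonals.
  have key : ∀ i, Real.exp (W (i + k) t) * ‖a k‖ = Real.exp (W' i t) * ‖a (L - L' - k)‖ := by
    intro i
    have h1 : S.g t (e (i + k) t) (e' i t) = Real.exp (W (i + k) t) * a k := by
      rw [h.g_eq, hS.η_symm, h.coeff_eq h' hc]
    have h2 : S.g t (e' i t) (e (i + k) t) = Real.exp (W' i t) * a (L - L' - k) := by
      rw [h'.g_eq]
      have := h.coeff_eq h' hc t (L' - i) (L - L' - k)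
      rw [show L - (L' - i + (L - L' - k)) = i + k by abel] at this
      rw [this]
    have h3 := congrArg norm (hS.g_herm t (e (i + k) t) (e' i t))
    rw [h1, h2] at h3
    simpa [Real.abs_exp] using h3
  have hk' : 0 < ‖a k‖ := norm_pos_iff.2 hk
  have hk2 : 0 < ‖a (L - L' - k)‖ := by
    have h1 := key 0
    have h2 : 0 < Real.exp (W (0 + k) t) * ‖a k‖ := by positivity
    rw [h1] at h2
    exact pos_of_mul_pos_right h2 (Real.exp_pos _).le
  have key2 : ∀ i, W (i + k) t - W' i t = Real.log ‖a (L - L' - k)‖ - Real.log ‖a k‖ := by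
    intro i
    have h1 := congrArg Real.log (key i)
    rw [Real.log_mul (Real.exp_pos _).ne' hk'.ne', Real.log_mul (Real.exp_pos _).ne' hk2.ne',
      Real.log_exp, Real.log_exp] at h1
    linarith
  -- The difference of the exponents does not depend on `i`. Since both families sum to zero, it
  -- vanishes.
  have hsum : ∑ i, (W (i + k) t - W' i t) = 0 := by
    have : ∑ i, W (i + k) t = ∑ i, W i t :=
      Fintype.sum_equiv (Equiv.addRight k) _ _ fun i => rfl
    rw [Finset.sum_sub_distrib, this, h.sum_eq_zero hS, h'.sum_eq_zero hS, sub_zero]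
  simp only [key2, Finset.sum_const, Finset.card_univ, Fintype.card_fin, nsmul_eq_mul] at hsum
  have h4 : Real.log ‖a (L - L' - k)‖ - Real.log ‖a k‖ = 0 :=
    (mul_eq_zero.1 hsum).resolve_left (by positivity)
  have := key2 j
  linarith

end TodaFrame

end TTStar
end

/-! ### Uniqueness of the metric in a Toda frame, and its radial symmetry. -/

noncomputable section

namespace TTStar

open Filter Topology

attribute [local instance] matNormedRing
attribute [local instance] matNormedAlgebra

variable {n : ℕ}

/-- A holomorphic function on `ℂ*` that does not vanish at one point vanishes on a set with
empty interior. -/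
theorem frequently_ne_zero_of_hol {f : ℂˣ → ℂ} (hf : ∀ t, HolFunAt f t) {t₀ : ℂˣ} (h₀ : f t₀ ≠ 0)
    (t : ℂˣ) : ∃ᶠ s in 𝓝 t, f s ≠ 0 := by
  intro h
  simp only [not_not] at h
  have han : AnalyticOnNhd ℂ (onPlane f) {0}ᶜ := fun z hz =>
    (holFunAt_iff.1 (hf (Units.mk0 z hz))).analyticAt
  have hpc : IsPreconnected ({0}ᶜ : Set ℂ) :=
    (isConnected_compl_singleton_of_one_lt_rank (by simp) 0).isPreconnected
  have h1 := han.eqOn_zero_of_preconnected_of_eventuallyEq_zero hpc (z₀ := (t : ℂ)) t.ne_zero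
    (onPlane_eventuallyEq (F := fun _ => 0) h)
  exact h₀ (by rw [← onPlane_coe f t₀]; exact h1 t₀.ne_zero)

theorem continuous_of_onPlane {X : Type*} [Zero X] [TopologicalSpace X] {f : ℂˣ → X}
    (hf : ∀ t : ℂˣ, ContinuousAt (onPlane f) t) : Continuous f := by
  refine continuous_iff_continuousAt.2 fun t => ?_
  have := (hf t).comp_of_eq Units.continuous_val.continuousAt rfl
  simpa only [Function.comp_def, onPlane_coe] using this

namespace TodaFrame

variable {S : Data (n + 1)} {c : ℂ} {L L' : Fin (n + 1)} {W W' : Fin (n + 1) → ℂˣ → ℝ}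
  {e e' : Fin (n + 1) → ∀ t, S.E t}

theorem smooth (h : TodaFrame S c L W e) (hS : S.IsTTStar) (i : Fin (n + 1)) (t : ℂˣ) :
    ContDiffAt ℝ ∞ (onPlane (W i)) t := by
  have hs : S.IsHolSection Set.univ (e i) := (S.isHolSection_iff isOpen_univ).2 fun t _ => h.hol i t
  have h1 := (hS.g_smooth Set.univ isOpen_univ _ _ hs hs).contDiffAt isOpen_univ (Set.mem_univ t)
  have h2 : ContDiffAt ℝ ∞
      (fun z => (onPlane (fun t => S.g t (e i t) (e i t)) z).re) t :=
    Complex.reCLM.contDiff.contDiffAt.comp _ h1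
  have h3 := h2.log (by rw [onPlane_coe, h.g, if_pos rfl, Complex.ofReal_re]; exact Real.exp_ne_zero _)
  refine h3.congr_of_eventuallyEq (onPlane_eventuallyEq (Eventually.of_forall fun s => ?_))
  rw [onPlane_coe, h.g, if_pos rfl, Complex.ofReal_re, Real.log_exp]

theorem continuous (h : TodaFrame S c L W e) (hS : S.IsTTStar) (i : Fin (n + 1)) :
    Continuous (W i) :=
  continuous_of_onPlane fun t => (h.smooth hS i t).continuousAt

/-- The metric in a Toda frame is unique up to a shift of indices. -/
theorem exists_shift (h : TodaFrame S c L W e) (h' : TodaFrame S c L' W' e') (hS : S.IsTTStar)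
    (hc : c ≠ 0) : ∃ k, ∀ j t, W' j t = W (j + k) t := by
  obtain ⟨k, hk⟩ : ∃ k, S.η 1 (e' 0 1) (e (L - k) 1) ≠ 0 := by
    by_contra! hcon
    refine (h'.linearIndependent 1).ne_zero 0 ?_
    change e' 0 1 = 0
    rw [h.expand 1 (e' 0 1)]
    simp [hcon]
  refine ⟨k, fun j t => ?_⟩
  -- The chosen coefficient is nonzero at `1`, hence on a dense set by the identity theorem;
  -- continuity of the metrics extends the equality to every `t`. So one `k` serves all points.
  have hf := frequently_ne_zero_of_hol (f := fun t => S.η t (e' 0 t) (e (L - k) t))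
    (fun t => h.holFunAt_coeff hS isOpen_univ (Set.mem_univ t) (fun x _ => h'.hol 0 x) _) hk t
  have hcl : IsClosed {s : ℂˣ | W' j s = W (j + k) s} :=
    isClosed_eq (h'.continuous hS j) (h.continuous hS (j + k))
  exact hcl.mem_of_frequently_of_tendsto
    (hf.mono fun s hs => h.shift_eq_of_coeff_ne_zero h' hS hc s k hs j) tendsto_id

/-- Transport of a Toda frame by the isomorphism of a rotation. -/
theorem rotate (h : TodaFrame S c L W e) {u : ℂˣ} (T : Data.Iso (S.rho u) S) :
    TodaFrame S c L (fun i t => W i (u * t))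
      (fun i t => T.map t (e i (u * t) : S.E (u * t))) where
  hol i t := T.holAt (HolBundle.HolAt.pull (B := S.toHolBundle) (h.hol i (u * t)))
  η t i j := (T.map_η t _ _).symm.trans (h.η (u * t) i j)
  Φ t i := by
    have h1 := T.map_Φ t 1 (e i (u * t))
    refine h1.symm.trans ((congrArg (T.map t) ?_).trans (map_smul (T.map t) c _))
    change ((u : ℂ)⁻¹ • (S.Φ (u * t)).comp (LinearMap.lsmul ℂ ℂ (u : ℂ))) 1 (e i (u * t)) =
      c • e (i + 1) (u * t)
    rw [← h.Φ]
    simp only [LinearMap.smul_apply, LinearMap.comp_apply, LinearMap.lsmul_apply, map_smul,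
      smul_smul, inv_mul_cancel₀ u.ne_zero, one_smul]
  g t i j := (T.map_g t _ _).symm.trans (h.g (u * t) i j)

/-- Comparing a Toda frame with its transport under `T_u` shows that rotation by `u` shifts the
indices by some `k`. Rotation by `u^{n+1}` then shifts by `(n+1)k = 0`, and every rotation is an
`(n+1)`-st power. -/
theorem radial (h : TodaFrame S c L W e) (hS : S.IsTTStar) (hc : c ≠ 0) (hρ : S.IsRhoFixed)
    (j : Fin (n + 1)) {s t : ℂˣ} (hst : ‖(s : ℂ)‖ = ‖(t : ℂ)‖) : W j s = W j t := by
  obtain ⟨T, -⟩ := hρ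
  have h1 : ∀ (u : Circle) (t : ℂˣ), W j (Circle.toUnits (u ^ (n + 1)) * t) = W j t := by
    intro u t
    obtain ⟨k, hk⟩ := h.exists_shift (h.rotate (T u)) hS hc
    have h2 : ∀ (m : ℕ) j t, W j (Circle.toUnits (u ^ m) * t) = W (j + m • k) t := by
      intro m
      induction m with
      | zero => simp
      | succ m ih =>
        intro j t
        rw [pow_succ, map_mul, mul_assoc, ih, hk]
        rw [succ_nsmul, add_assoc]
    have h3 : (n + 1) • k = 0 := by simpa using card_nsmul_eq_zero (x := k)
    rw [h2 (n + 1) j t, h3, add_zero]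
  have hv : ‖((s * t⁻¹ : ℂˣ) : ℂ)‖ = 1 := by
    simp [hst]
  set v : Circle := ⟨((s * t⁻¹ : ℂˣ) : ℂ), mem_sphere_zero_iff_norm.2 hv⟩ with hvdef
  obtain ⟨θ, hθ⟩ := Circle.exp_surjective v
  have hpow : (Circle.exp (θ / (n + 1))) ^ (n + 1) = v := by
    rw [← hθ, ← Circle.exp_nsmul]
    congr 1
    simp only [nsmul_eq_mul]
    push_cast
    field_simp
  have h3 := h1 (Circle.exp (θ / (n + 1))) t
  rw [hpow] at h3
  rw [← h3]
  congr 1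
  ext
  change (s : ℂ) = ((s * t⁻¹ : ℂˣ) : ℂ) * t
  simp

end TodaFrame

/-! ## The Toda equation -/

theorem wirt_cexp {ε : ℝ} {f : ℂ → ℂ} {z : ℂ} (hf : DifferentiableAt ℝ f z) :
    wirt ε (fun x => Complex.exp (f x)) z = Complex.exp (f z) * wirt ε f z := by
  have h : HasFDerivAt (fun x => Complex.exp (f x)) (Complex.exp (f z) • fderiv ℝ f z) z :=
    hf.hasFDerivAt.cexp
  simp only [wirt, h.fderiv, _root_.smul_apply, smul_eq_mul]
  ring

theorem contDiffAt_diagonal {N : ℕ} {v : Fin N → ℂ → ℂ} {z : ℂ}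
    (hv : ∀ i, ContDiffAt ℝ ∞ (v i) z) : ContDiffAt ℝ ∞ (fun x => diagonal fun i => v i x) z := by
  rw [contDiffAt_matrix_real]
  intro i j
  simp only [diagonal_apply]
  split_ifs
  · exact hv i
  · exact contDiffAt_const

theorem wirt_diagonal {N : ℕ} {ε : ℝ} {v : Fin N → ℂ → ℂ} {z : ℂ}
    (hv : ∀ i, ContDiffAt ℝ ∞ (v i) z) :
    wirt ε (fun x => diagonal fun i => v i x) z = diagonal fun i => wirt ε (v i) z := by
  ext i j
  rw [wirt_apply ((contDiffAt_diagonal hv).differentiableAt (by simp))]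
  simp only [diagonal_apply]
  split_ifs
  · rfl
  · exact wirt_const _ _ _

theorem chern_diagonal {N : ℕ} {v : Fin N → ℂ → ℂ} {z : ℂ} (hv : ∀ i, ContDiffAt ℝ ∞ (v i) z) :
    chern (fun x => diagonal fun i => Complex.exp (v i x)) z =
      diagonal fun i => wirt (-1) (v i) z := by
  have h1 : (diagonal fun i => Complex.exp (v i z))⁻¹ = diagonal fun i => Complex.exp (-v i z) := by
    refine Matrix.inv_eq_left_inv ?_
    rw [diagonal_mul_diagonal]
    simp [← Complex.exp_add]
  rw [chern, wirt_diagonal fun i => (hv i).cexp, h1, diagonal_mul_diagonal]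
  congr 1
  funext i
  rw [wirt_cexp ((hv i).differentiableAt (by simp)), ← mul_assoc, ← Complex.exp_add]
  simp

/-- The matrix of `e_j ↦ c e_{j+1}`. -/
def shiftMatrix (n : ℕ) (c : ℂ) : Matrix (Fin (n + 1)) (Fin (n + 1)) ℂ :=
  Matrix.of fun i j => if i = j + 1 then c else 0

theorem adj_diagonal {N : ℕ} (v : Fin N → ℂ) (M : Matrix (Fin N) (Fin N) ℂ) :
    adj (diagonal fun i => Complex.exp (v i)) M =
      Matrix.of fun i j => starRingEnd ℂ (M j i) * Complex.exp (v j - v i) := by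
  have h1 : (diagonal fun i => Complex.exp (v i))⁻¹ = diagonal fun i => Complex.exp (-v i) := by
    refine Matrix.inv_eq_left_inv ?_
    rw [diagonal_mul_diagonal]
    simp [← Complex.exp_add]
  ext i j
  rw [adj, h1, mul_diagonal, diagonal_mul, conjTranspose_apply, Matrix.of_apply, sub_eq_neg_add,
    Complex.exp_add, RCLike.star_def]
  ring

/-- For a diagonal metric the commutator of the cyclic shift with its adjoint is diagonal: it is the
nonlinear term of the Toda equation. -/
theorem shiftMatrix_commutator (c : ℂ) (v : Fin (n + 1) → ℂ) :
    shiftMatrix n c * adj (diagonal fun i => Complex.exp (v i)) (shiftMatrix n c) -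
      adj (diagonal fun i => Complex.exp (v i)) (shiftMatrix n c) * shiftMatrix n c =
    diagonal fun i => c * starRingEnd ℂ c *
      (Complex.exp (v i - v (i - 1)) - Complex.exp (v (i + 1) - v i)) := by
  rw [adj_diagonal]
  ext i j
  simp only [Matrix.sub_apply, Matrix.mul_apply, shiftMatrix, Matrix.of_apply, diagonal_apply, apply_ite
    (starRingEnd ℂ), map_zero, ite_mul, zero_mul, mul_ite, mul_zero]
  have h2 : ∀ k : Fin (n + 1), (j = k + 1) ↔ (k = j - 1) := fun k => by
    rw [eq_comm, eq_sub_iff_add_eq]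
  have e1 : ∀ f : Fin (n + 1) → ℂ, (∑ k, if j = k + 1 then if i = k + 1 then f k else 0 else 0) =
      if i = j then f (j - 1) else 0 := by
    intro f
    simp only [h2]
    rw [Finset.sum_ite_eq' Finset.univ (j - 1), if_pos (Finset.mem_univ _), sub_add_cancel]
  have e2 : ∀ f : Fin (n + 1) → ℂ, (∑ k, if k = j + 1 then if k = i + 1 then f k else 0 else 0) =
      if i = j then f (j + 1) else 0 := by
    intro f
    rw [Finset.sum_ite_eq' Finset.univ (j + 1), if_pos (Finset.mem_univ _)]
    simp only [add_left_inj, eq_comm]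
  rw [e1, e2]
  split_ifs with h
  · subst h; ring
  · ring

theorem shiftMatrix_hol (c : ℂ) (t : ℂˣ) :
    ContDiffAt ℂ ω (onPlane fun _ : ℂˣ => shiftMatrix n c) t :=
  contDiffAt_const.congr_of_eventuallyEq
    (onPlane_eventuallyEq (F := fun _ => shiftMatrix n c) (Eventually.of_forall fun _ => rfl))

theorem contDiffAt_onPlane_ofReal {f : ℂˣ → ℝ} {t : ℂˣ} (hf : ContDiffAt ℝ ∞ (onPlane f) t) :
    ContDiffAt ℝ ∞ (onPlane fun s => (f s : ℂ)) t := by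
  refine (Complex.ofRealCLM.contDiff.contDiffAt.comp _ hf).congr_of_eventuallyEq
    (onPlane_eventuallyEq (Eventually.of_forall fun s => ?_))
  simp [onPlane_coe]

/-- The Gram matrix is `diag(exp W_i)`, so its Chern connection is `diag(∂W_i)` and the flatness
equation becomes scalar on the diagonal. The factor `c c̄` comes from working in `t` instead of `τ =
ct`. -/
theorem TodaFrame.toda_eq {S : Data (n + 1)} {c : ℂ} {L : Fin (n + 1)}
    {W : Fin (n + 1) → ℂˣ → ℝ} {e : Fin (n + 1) → ∀ t, S.E t}
    (h : TodaFrame S c L W e) (hS : S.IsTTStar) (t : ℂˣ) (i : Fin (n + 1)) :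
    wirt 1 (wirt (-1) (onPlane fun s => (W i s : ℂ))) t =
      c * starRingEnd ℂ c *
        (Real.exp (W i t - W (i - 1) t) - Real.exp (W (i + 1) t - W i t) : ℝ) := by
  have h1 := hS.hitchin isOpen_univ h.isHolFrame (φ := fun _ => shiftMatrix n c) (by
    intro t _ j
    have := h.Φ t j
    refine this.trans ?_
    simp only [shiftMatrix, Matrix.of_apply, ite_smul, zero_smul, Finset.sum_ite_eq',
      Finset.mem_univ, if_true]
    ) (Set.mem_univ t) (shiftMatrix_hol c t)
  have hg : ∀ s : ℂˣ, S.gram e s =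
      diagonal fun i => Complex.exp (onPlane (fun s => (W i s : ℂ)) s) := by
    intro s
    ext i j
    rw [diagonal_apply, onPlane_coe, ← Complex.ofReal_exp]
    exact h.g s i j
  have hsm : ∀ (t : ℂˣ) i, ContDiffAt ℝ ∞ (onPlane fun s => (W i s : ℂ)) t := fun t i =>
    contDiffAt_onPlane_ofReal (h.smooth hS i t)
  have h2 : chern (onPlane (S.gram e)) =ᶠ[𝓝 (t : ℂ)]
      fun z => diagonal fun i => wirt (-1) (onPlane fun s => (W i s : ℂ)) z := by
    filter_upwards [eventually_ne_zero t] with z hz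
    have h3 := onPlane_eventuallyEq (t := Units.mk0 z hz)
      (F := fun z => diagonal fun i => Complex.exp (onPlane (fun s => (W i s : ℂ)) z))
      (Eventually.of_forall hg)
    rw [Units.val_mk0] at h3
    have h4 := chern_diagonal fun i => hsm (Units.mk0 z hz) i
    rw [Units.val_mk0] at h4
    rw [← h4]
    simp only [chern, h3.eq_of_nhds, wirt_congr h3]
  rw [wirt_congr h2, wirt_diagonal fun i => contDiffAt_wirt (hsm t i), hg,
    shiftMatrix_commutator] at h1
  have h4 := congrFun (congrFun h1 i) i
  rw [diagonal_apply_eq, diagonal_apply_eq] at h4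
  rw [h4]
  simp only [onPlane_coe]
  push_cast
  rfl

end TTStar
end

noncomputable section

namespace TTStar

open Filter Topology

variable {n : ℕ}

/-! ## Indices modulo `n + 1` -/

/-- Reduction modulo `n + 1`. -/
def idx (n : ℕ) (z : ℤ) : Fin (n + 1) :=
  ⟨(z % ((n : ℤ) + 1)).toNat, by
    have h1 := Int.emod_nonneg z (b := (n : ℤ) + 1) (by omega)
    have h2 := Int.emod_lt_of_pos z (b := (n : ℤ) + 1) (by omega)
    omega⟩

theorem idx_val (z : ℤ) : (((idx n z : Fin (n + 1)) : ℕ) : ℤ) = z % ((n : ℤ) + 1) := by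
  have h1 := Int.emod_nonneg z (b := (n : ℤ) + 1) (by omega)
  simp only [idx]
  omega

theorem idx_eq_iff {a b : ℤ} : idx n a = idx n b ↔ a ≡ b [ZMOD ((n : ℤ) + 1)] := by
  rw [Int.ModEq, ← idx_val, ← idx_val, Fin.ext_iff, Nat.cast_inj]

theorem idx_coe (i : Fin (n + 1)) : idx n ((i : ℕ) : ℤ) = i := by
  have h := idx_val (n := n) ((i : ℕ) : ℤ)
  rw [Int.emod_eq_of_lt (by omega) (by omega)] at h
  exact Fin.ext (by exact_mod_cast h)

theorem idx_add (a b : ℤ) : idx n (a + b) = idx n a + idx n b := by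
  refine Fin.ext ?_
  have h : (((idx n a + idx n b : Fin (n + 1)) : ℕ) : ℤ) = (a + b) % ((n : ℤ) + 1) := by
    rw [Fin.val_add]
    push_cast
    rw [idx_val, idx_val, ← Int.add_emod]
  rw [← idx_val] at h
  exact_mod_cast h.symm

theorem idx_zero : idx n 0 = 0 := idx_coe 0

theorem idx_sub (a b : ℤ) : idx n (a - b) = idx n a - idx n b := by
  rw [eq_sub_iff_add_eq, ← idx_add, sub_add_cancel]

theorem idx_self : idx n ((n : ℤ) + 1) = 0 := by
  rw [← idx_zero, idx_eq_iff, Int.ModEq]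
  simp

theorem idx_one : idx n 1 = 1 := by
  have h := idx_val (n := n) 1
  refine Fin.ext ?_
  -- In `Fin 1` the element `1` equals `0`, so `1 % (n + 1) = 1` fails for `n = 0`.
  rcases Nat.eq_zero_or_pos n with rfl | hn
  · omega
  · rw [Int.emod_eq_of_lt (by omega) (by omega)] at h
    rw [Fin.val_one', Nat.mod_eq_of_lt (by omega)]
    exact_mod_cast h

theorem idx_periodic {X : Type*} {w : ℤ → X} (hw : ∀ j, w (j + (n + 1)) = w j) (j : ℤ) :
    w ((idx n j : ℕ) : ℤ) = w j := by
  have h1 : ∀ (m : ℕ) j, w (j + (n + 1) * m) = w j := by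
    intro m
    induction m with
    | zero => simp
    | succ m ih =>
      intro j
      rw [← ih j, ← hw (j + (n + 1) * m)]
      congr 1; push_cast; ring
  rw [idx_val]
  rcases le_total 0 (j / ((n : ℤ) + 1)) with h | h
  · obtain ⟨m, hm⟩ := Int.eq_ofNat_of_zero_le h
    rw [← h1 m, ← hm, Int.emod_add_mul_ediv]
  · obtain ⟨m, hm⟩ := Int.eq_ofNat_of_zero_le (neg_nonneg.2 h)
    rw [← h1 m j, ← hm, mul_neg, ← sub_eq_add_neg, Int.emod_def]

theorem pow_fin_add {ζ : ℂ} (hζ : ζ ^ (n + 1) = 1) (i j : Fin (n + 1)) :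
    ζ ^ ((i + j : Fin (n + 1)) : ℕ) = ζ ^ (i : ℕ) * ζ ^ (j : ℕ) := by
  rw [Fin.val_add, ← pow_add, ← pow_eq_pow_mod _ hζ]


/-! ## Toda frames and solutions of the Toda equation -/

/-- Congruences modulo `n + 1` are traded for equalities in `Fin (n + 1)`, where `L` is the class of
`l - 1`. -/
theorem hasTodaFrame_iff {S : Data (n + 1)} {c : ℂˣ} {w : ℤ → ℂˣ → ℝ} :
    S.HasTodaFrame c w ↔
      ∃ L e, TodaFrame S c L (fun i t => w ((i : ℕ) : ℤ) (c * t)) e := by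
  constructor
  · rintro ⟨l, e, he, hη, hΦ, hg⟩
    refine ⟨idx n (l - 1), e, ⟨fun i t => he.contMDiffAt isOpen_univ (Set.mem_univ t) i,
      fun t i j => ?_, fun t i => ?_, fun t i j => ?_⟩⟩
    · rw [hη]
      simp only [← idx_eq_iff, idx_add, idx_coe]
    · rw [hΦ, mul_one]
    · rw [hg]
      split_ifs with h
      · rw [h]
      · rfl
  · rintro ⟨L, e, h⟩
    -- Adding one undoes the offset in `i + j ≡ l - 1`.
    refine ⟨(L : ℕ) + 1, e, h.isHolFrame, fun t i j => ?_, fun t X j => ?_, fun t i j => ?_⟩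
    · rw [h.η]
      simp only [← idx_eq_iff, idx_add, idx_coe, add_sub_cancel_right]
    · have h1 : S.Φ t X = X • S.Φ t 1 := by rw [← map_smul, smul_eq_mul, mul_one]
      rw [h1, LinearMap.smul_apply, h.Φ, smul_smul, mul_comm]
    · rw [h.g]
      split_ifs with h
      · rw [h]
      · rfl

theorem onPlane_mul_left {X : Type*} [Zero X] (f : ℂˣ → X) (a : ℂˣ) (z : ℂ) :
    onPlane (fun s => f (a * s)) z = onPlane f (a * z) := by
  by_cases hz : z = 0
  · simp [onPlane, hz]
  · have : (a : ℂ) * z ≠ 0 := mul_ne_zero a.ne_zero hz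
    rw [onPlane_of_ne _ hz, onPlane_of_ne _ this]
    congr 1
    ext
    simp

theorem contDiffAt_onPlane_mul_left {X : Type*} [NormedAddCommGroup X] [NormedSpace ℝ X]
    {f : ℂˣ → X} {a t : ℂˣ} (hf : ContDiffAt ℝ ∞ (onPlane f) ((a * t : ℂˣ) : ℂ)) :
    ContDiffAt ℝ ∞ (onPlane fun s => f (a * s)) t := by
  have h : onPlane (fun s => f (a * s)) = onPlane f ∘ fun z => (a : ℂ) * z :=
    funext fun z => onPlane_mul_left f a z
  rw [h]
  refine ContDiffAt.comp _ (by simpa using hf) (contDiffAt_const.mul contDiffAt_id)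

/-- The Laplacian under the substitution `s ↦ a s`. -/
theorem dt_dtbar_mul_left {f : ℂˣ → ℂ} (hf : ∀ t : ℂˣ, ContDiffAt ℝ ∞ (onPlane f) t) (a t : ℂˣ) :
    dt (dtbar fun s => f (a * s)) t =
      a * starRingEnd ℂ a * wirt 1 (wirt (-1) (onPlane f)) ((a * t : ℂˣ) : ℂ) := by
  have hd : ∀ z, HasDerivAt (fun z => (a : ℂ) * z) a z := fun z => by
    simpa using (hasDerivAt_id z).const_mul (a : ℂ)
  have h1 : ∀ᶠ s : ℂˣ in 𝓝 t, dtbar (fun s => f (a * s)) s =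
      starRingEnd ℂ a * wirt 1 (onPlane f) (a * s) := by
    refine Eventually.of_forall fun s => ?_
    rw [dtbar_eq]
    have h2 : onPlane (fun s => f (a * s)) = fun z => onPlane f (a * z) :=
      funext fun z => onPlane_mul_left f a z
    have h3 := hf (a * s)
    rw [Units.val_mul] at h3
    rw [h2, wirt_comp_hol (Or.inr rfl) (h3.differentiableAt (by simp)) (hd s),
      if_neg (by norm_num), smul_eq_mul]
  rw [dt_congr (F := fun z => starRingEnd ℂ a * wirt 1 (onPlane f) (a * z)) h1]
  have h3 := hf (a * t)
  rw [Units.val_mul] at h3 ⊢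
  have h4 : DifferentiableAt ℝ (wirt 1 (onPlane f)) (a * t) :=
    (contDiffAt_wirt h3).differentiableAt (by simp)
  have h5 := wirt_comp_hol (ε := -1) (ψ := fun z => (a : ℂ) * z) (Or.inl rfl) h4 (hd t)
  rw [if_pos rfl] at h5
  have h6 : DifferentiableAt ℝ (fun z : ℂ => wirt 1 (onPlane f) (a * z)) t :=
    h4.comp (t : ℂ) (by fun_prop)
  have h7 := wirt_const_smul (ε := -1) (starRingEnd ℂ a) h6
  simp only [smul_eq_mul] at h5 h7
  rw [h7, h5, wirt_comm h3]
  ring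

/-- The solution is `W` in the coordinate `τ = ct`, that is `w_j(τ) = W_j(c⁻¹ τ)`. The chain rule
contributes `|c|⁻²`, which cancels the factor `|c|²` in `toda_eq`. -/
theorem TodaFrame.exists_solution {S : Data (n + 1)} {c : ℂˣ} {L : Fin (n + 1)}
    {W : Fin (n + 1) → ℂˣ → ℝ} {e : Fin (n + 1) → ∀ t, S.E t}
    (h : TodaFrame S c L W e) (hS : S.IsTTStar) (hρ : S.IsRhoFixed) :
    ∃ w : RadialSolution n, S.HasTodaFrame c w.1 := by
  refine ⟨⟨fun j t => W (idx n j) (c⁻¹ * t), ⟨fun j => ?_, fun j t => ?_, fun j => ?_,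
    (L : ℕ) + 1, fun j t => ?_⟩, fun j s t hst => ?_⟩, ?_⟩
  · exact smoothOn_of_contDiffAt fun t _ => contDiffAt_onPlane_mul_left (h.smooth hS _ _)
  · have h1 := dt_dtbar_mul_left (fun t => contDiffAt_onPlane_ofReal (h.smooth hS (idx n j) t)) c⁻¹ t
    rw [h1, h.toda_eq hS, ← mul_assoc]
    have h2 : ((c⁻¹ : ℂˣ) : ℂ) * starRingEnd ℂ ((c⁻¹ : ℂˣ) : ℂ) * (c * starRingEnd ℂ (c : ℂ)) = 1 := by
      rw [mul_mul_mul_comm, ← map_mul]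
      simp
    rw [h2, one_mul, idx_add, idx_sub, idx_one]
  · rw [idx_add, idx_self, add_zero]
  · have := h.antisymm hS (c⁻¹ * t) (idx n j)
    rwa [show ((L : ℕ) : ℤ) + 1 - j - 1 = (L : ℕ) - j by ring, idx_sub, idx_coe]
  · refine h.radial hS c.ne_zero hρ _ ?_
    simp [hst]
  · rw [hasTodaFrame_iff]
    refine ⟨L, e, ?_⟩
    simpa only [idx_coe, inv_mul_cancel_left] using h

/-! ### Operations on Toda frames and the isomorphism they induce. -/

namespace TodaFrame

variable {S S' : Data (n + 1)} {c : ℂ} {L : Fin (n + 1)}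
  {W : Fin (n + 1) → ℂˣ → ℝ} {e : Fin (n + 1) → ∀ t, S.E t} {e' : Fin (n + 1) → ∀ t, S'.E t}

theorem shift (h : TodaFrame S c L W e) (s : Fin (n + 1)) :
    TodaFrame S c (L - s - s) (fun i => W (i + s)) (fun i => e (i + s)) where
  hol i t := h.hol _ t
  η t i j := by
    rw [h.η]
    congr 1
    rw [eq_iff_iff, eq_sub_iff_add_eq, eq_sub_iff_add_eq]
    constructor <;> intro h' <;> rw [← h'] <;> abel
  Φ t i := by rw [h.Φ, add_right_comm]
  g t i j := by rw [h.g]; simp only [add_left_inj]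

theorem map_iso (h : TodaFrame S c L W e) (T : Data.Iso S S') :
    TodaFrame S' c L W (fun i t => T.map t (e i t)) where
  hol i t := T.holAt (h.hol i t)
  η t i j := by rw [← T.map_η, h.η]
  Φ t i := by rw [← T.map_Φ, h.Φ, map_smul]
  g t i j := by rw [← T.map_g, h.g]

/-- Rescale to `μ ζ^{-j} e_j` with `μ² = ζ^L`. The powers of `ζ` turn `c` into `cζ`, the factor `μ`
restores `η` on the pairs with `i + j = L`, and all scalars have modulus one, so `g` is unchanged.
-/
theorem mul_root (h : TodaFrame S c L W e) {ζ : ℂ} (hζ : ζ ^ (n + 1) = 1) :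
    ∃ e', TodaFrame S (c * ζ) L W e' := by
  have hζ0 : ζ ≠ 0 := by rintro rfl; simp at hζ
  obtain ⟨μ, hμ⟩ := IsAlgClosed.exists_pow_nat_eq (ζ ^ (L : ℕ)) (n := 2) (by norm_num)
  have nζ : ‖ζ‖ = 1 := Complex.norm_eq_one_of_pow_eq_one hζ (by omega)
  have nμ : ‖μ‖ = 1 := by
    have := congrArg norm hμ
    rw [norm_pow, norm_pow, nζ, one_pow] at this
    exact (pow_eq_one_iff_of_nonneg (norm_nonneg _) (by norm_num)).1 this
  have hstar : ∀ x : ℂ, ‖x‖ = 1 → starRingEnd ℂ x * x = 1 := fun x hx => by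
    rw [← Complex.normSq_eq_conj_mul_self, Complex.normSq_eq_norm_sq, hx]; simp
  refine ⟨fun j t => (μ * (ζ ^ (j : ℕ))⁻¹) • e j t, ⟨fun i t => (h.hol i t).const_smul _,
    fun t i j => ?_, fun t i => ?_, fun t i j => ?_⟩⟩
  · simp only [map_smul, LinearMap.smul_apply, h.η, smul_eq_mul]
    split_ifs with hij
    · have h1 := pow_fin_add hζ i j
      rw [hij, ← hμ] at h1
      have : ζ ^ (i : ℕ) ≠ 0 := pow_ne_zero _ hζ0
      have : ζ ^ (j : ℕ) ≠ 0 := pow_ne_zero _ hζ0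
      field_simp
      rw [h1, mul_comm]
    · simp
  · have h1 := pow_fin_add hζ i 1
    rw [map_smul, h.Φ, smul_smul, smul_smul, h1]
    congr 1
    have : ζ ^ (i : ℕ) ≠ 0 := pow_ne_zero _ hζ0
    have h2 : ζ ^ (((1 : Fin (n + 1)) : ℕ)) = ζ := by
      rw [Fin.val_one', ← pow_eq_pow_mod _ hζ, pow_one]
    rw [h2]
    field_simp
  · simp only [map_smul, LinearMap.smul_apply, h.g, smul_eq_mul, map_smulₛₗ]
    split_ifs with hij
    · subst hij
      rw [← mul_assoc, mul_comm (μ * _) _, hstar, one_mul]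
      rw [norm_mul, norm_inv, norm_pow, nμ, nζ]; simp
    · simp

/-- The linear extension of a map between two frames. -/
def transfer (_ : TodaFrame S c L W e) (_ : TodaFrame S' c L W e') (t : ℂˣ) :
    S.E t →ₗ[ℂ] S'.E t where
  toFun v := ∑ i, S.η t v (e (L - i) t) • e' i t
  map_add' a b := by simp [add_smul, Finset.sum_add_distrib]
  map_smul' a b := by simp [Finset.smul_sum, smul_smul]

theorem transfer_sum (h : TodaFrame S c L W e) (h' : TodaFrame S' c L W e') (t : ℂˣ)
    (a : Fin (n + 1) → ℂ) : h.transfer h' t (∑ i, a i • e i t) = ∑ i, a i • e' i t := by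
  change ∑ j, S.η t (∑ i, a i • e i t) (e (L - j) t) • e' j t = _
  simp only [h.η_sum, sub_sub_cancel]

theorem exists_coeff (h : TodaFrame S c L W e) (t : ℂˣ) (v : S.E t) :
    ∃ a : Fin (n + 1) → ℂ, v = ∑ i, a i • e i t :=
  ⟨_, h.expand t v⟩

theorem transfer_transfer (h : TodaFrame S c L W e) (h' : TodaFrame S' c L W e') (t : ℂˣ)
    (v : S.E t) : h'.transfer h t (h.transfer h' t v) = v := by
  obtain ⟨a, rfl⟩ := h.exists_coeff t v
  rw [transfer_sum, transfer_sum]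

theorem transfer_hol (h : TodaFrame S c L W e) (h' : TodaFrame S' c L W e') (hS : S.IsTTStar)
    (U : Set ℂˣ) (hU : IsOpen U) (s : ∀ t, S.E t) (hs : ∀ t ∈ U, S.HolAt s t) (t : ℂˣ)
    (ht : t ∈ U) : S'.HolAt (fun x => h.transfer h' x (s x)) t :=
  HolBundle.HolAt.sum (I := Finset.univ)
    (s := fun i x => S.η x (s x) (e (L - i) x) • e' i x) fun i _ =>
    HolBundle.HolAt.smul (h.holFunAt_coeff hS hU ht hs (L - i)) (h'.hol i t)

/-- Two tt*-structures with the same Toda data are isomorphic. -/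
def iso (h : TodaFrame S c L W e) (h' : TodaFrame S' c L W e') (hS : S.IsTTStar)
    (hS' : S'.IsTTStar) : Data.Iso S S' :=
  Data.Iso.ofSections
    (fun t => LinearEquiv.ofLinearMap (h.transfer h' t) (h'.transfer h t)
      (LinearMap.ext fun v => h'.transfer_transfer h t v)
      (LinearMap.ext fun v => h.transfer_transfer h' t v))
    (h.transfer_hol h' hS) (h'.transfer_hol h hS')
    (fun t a b => by
      obtain ⟨a, rfl⟩ := h.exists_coeff t a
      obtain ⟨b, rfl⟩ := h.exists_coeff t b
      simp only [LinearEquiv.coe_ofLinearMap, transfer_sum]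
      simp only [map_sum, LinearMap.sum_apply, map_smul, LinearMap.smul_apply, h.η, h'.η])
    (fun t a b => by
      obtain ⟨a, rfl⟩ := h.exists_coeff t a
      obtain ⟨b, rfl⟩ := h.exists_coeff t b
      simp only [LinearEquiv.coe_ofLinearMap, transfer_sum]
      simp only [map_sum, LinearMap.sum_apply, map_smulₛₗ, LinearMap.smul_apply, h.g, h'.g])
    (fun t X a => by
      obtain ⟨a, rfl⟩ := h.exists_coeff t a
      have h1 : ∀ {S : Data (n + 1)}, S.Φ t X = X • S.Φ t 1 := fun {S} => by
        rw [← map_smul, smul_eq_mul, mul_one]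
      have h2 : ∀ i, h.transfer h' t (e i t) = e' i t := fun i => by
        have := h.transfer_sum h' t (Pi.single i 1)
        simpa [Pi.single_apply, ite_smul] using this
      simp only [LinearEquiv.coe_ofLinearMap, transfer_sum, h1, LinearMap.smul_apply]
      simp only [map_sum, map_smul, h.Φ, h'.Φ, h2])

end TodaFrame


/-! ## Square roots of shifts -/

/-- The inverse Fourier transform on `ℤ/(n+1)`. -/
def fourierInv (r : ZMod (n + 1) → ℂ) (x : ZMod (n + 1)) : ℂ :=
  ((n + 1 : ℕ) : ℂ)⁻¹ * ∑ p, r p * ZMod.stdAddChar (p * x)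

theorem sum_stdAddChar_mul (a : ZMod (n + 1)) :
    ∑ x : ZMod (n + 1), (ZMod.stdAddChar (x * a) : ℂ) = if a = 0 then ((n + 1 : ℕ) : ℂ) else 0 := by
  have := AddChar.sum_mulShift a (ZMod.isPrimitive_stdAddChar (n + 1))
  simpa [ZMod.card] using this

/-- The Fourier transform turns convolution into multiplication, and a character is the transform of
a point mass; hence the convolution of the two inverse transforms is the point mass at `-a`, tested
here against `F`. -/
theorem fourierInv_conv {r r' : ZMod (n + 1) → ℂ} {a : ZMod (n + 1)}
    (h : ∀ p, r p * r' p = ZMod.stdAddChar (p * a)) (F : ZMod (n + 1) → ℂ) :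
    ∑ x, ∑ y, fourierInv r x * fourierInv r' y * F (x + y) = F (-a) := by
  have hN : ((n + 1 : ℕ) : ℂ) ≠ 0 := by exact_mod_cast Nat.succ_ne_zero n
  have conv : ∀ z, ∑ x, fourierInv r x * fourierInv r' (z - x) = if z = -a then 1 else 0 := by
    intro z
    have h1 : ∀ x, fourierInv r x * fourierInv r' (z - x) = ((n + 1 : ℕ) : ℂ)⁻¹ ^ 2 *
        ∑ p, ∑ q, r p * r' q * ZMod.stdAddChar (q * z) * ZMod.stdAddChar (x * (p - q)) := by
      intro x
      rw [fourierInv, fourierInv, mul_mul_mul_comm, ← sq, Finset.sum_mul_sum]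
      congr 1
      refine Finset.sum_congr rfl fun p _ => Finset.sum_congr rfl fun q _ => ?_
      rw [mul_mul_mul_comm, ← AddChar.map_add_eq_mul, mul_assoc (r p * r' q),
        ← AddChar.map_add_eq_mul]
      congr 2
      ring
    simp only [h1, ← Finset.mul_sum]
    rw [Finset.sum_comm]
    have h2 : ∀ p, ∑ x, ∑ q, r p * r' q * ZMod.stdAddChar (q * z) *
        (ZMod.stdAddChar (x * (p - q)) : ℂ) =
          ZMod.stdAddChar (p * (a + z)) * ((n + 1 : ℕ) : ℂ) := by
      intro p
      rw [Finset.sum_comm]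
      simp only [← Finset.mul_sum, sum_stdAddChar_mul, sub_eq_zero, mul_ite, mul_zero]
      rw [Finset.sum_ite_eq, if_pos (Finset.mem_univ _), h, ← AddChar.map_add_eq_mul, mul_add]
    simp only [h2, ← Finset.sum_mul, sum_stdAddChar_mul]
    have h3 : a + z = 0 ↔ z = -a := 
      ⟨fun h => eq_neg_of_add_eq_zero_right h, fun h => by rw [h, add_neg_cancel]⟩
    simp only [h3]
    split_ifs
    · field_simp
    · simp
  have h1 : ∀ x, ∑ y, fourierInv r x * fourierInv r' y * F (x + y) =
      ∑ z, fourierInv r x * fourierInv r' (z - x) * F z := fun x =>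
    Fintype.sum_equiv (Equiv.addLeft x) _ _ fun y => by simp
  simp only [h1]
  rw [Finset.sum_comm]
  simp only [← Finset.sum_mul, conv, ite_mul, one_mul, zero_mul, Finset.sum_ite_eq',
    Finset.mem_univ, if_true]

/-- A unitary square root of the inverse of the generator in the group algebra of `ℤ/(n+1)`. -/
theorem exists_sqrt_shift (n : ℕ) : ∃ b : ZMod (n + 1) → ℂ,
    (∀ F : ZMod (n + 1) → ℂ, ∑ x, ∑ y, b x * b y * F (x + y) = F (-1)) ∧
    ∀ F : ZMod (n + 1) → ℂ, ∑ x, ∑ y, starRingEnd ℂ (b x) * b y * F (x - y) = F 0 := by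
  -- The square root is taken frequency by frequency. Character values have modulus one, so their
  -- square roots do too, which gives unitarity.
  have hr : ∀ p : ZMod (n + 1), ∃ r : ℂ, r * r = ZMod.stdAddChar (p * 1) ∧
      starRingEnd ℂ r * r = 1 := by
    intro p
    obtain ⟨r, hr⟩ := IsAlgClosed.exists_pow_nat_eq (ZMod.stdAddChar p : ℂ) (n := 2) (by norm_num)
    refine ⟨r, by rw [← sq, hr, mul_one], ?_⟩
    have h1 := congrArg norm hr
    rw [norm_pow, AddChar.norm_apply] at h1
    rw [← Complex.normSq_eq_conj_mul_self, Complex.normSq_eq_norm_sq, h1]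
    simp
  choose r hr1 hr2 using hr
  refine ⟨fourierInv r, fourierInv_conv hr1, fun F => ?_⟩
  have h1 := fourierInv_conv (r := fun p => starRingEnd ℂ (r p)) (r' := r) (a := 0)
    (fun p => by simp [hr2]) fun z => F (-z)
  rw [neg_zero, neg_zero] at h1
  rw [← h1]
  refine Fintype.sum_equiv (Equiv.neg _) _ _ fun x => Finset.sum_congr rfl fun y _ => ?_
  have h2 : starRingEnd ℂ (fourierInv r x) = fourierInv (fun p => starRingEnd ℂ (r p)) (-x) := by
    simp only [fourierInv, map_mul, map_sum, map_inv₀, map_natCast, mul_neg,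
      AddChar.map_neg_eq_conj]
  rw [h2, Equiv.neg_apply]
  congr 2
  abel

/-- With `d = L' - L`, apply to the frame the operator `∑ b_x (shift by x d)`, a unitary square root
of the shift by `-d`. It commutes with `Φ`, it preserves `g` because `W` is `d`-periodic, and it
enters `η` twice, moving the condition `i + j = L` to `i + j = L + d`. -/
theorem TodaFrame.change_pairing {S : Data (n + 1)} {c : ℂ} {L L' : Fin (n + 1)}
    {W : Fin (n + 1) → ℂˣ → ℝ} {e : Fin (n + 1) → ∀ t, S.E t} (h : TodaFrame S c L W e)
    (hW : ∀ t i, W (i + (L' - L)) t = W i t) : ∃ e', TodaFrame S c L' W e' := by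
  obtain ⟨b, hb1, hb2⟩ := exists_sqrt_shift n
  have hcard : zmultiplesHom (Fin (n + 1)) (L' - L) ((n + 1 : ℕ) : ℤ) = 0 := by
    have := card_nsmul_eq_zero (x := L' - L)
    rw [Fintype.card_fin] at this
    rw [zmultiplesHom_apply, natCast_zsmul, this]
  -- The square root lives on `ZMod (n + 1)` and is pushed forward by `1 ↦ L' - L`. This map need
  -- not be injective, and the identities for `b` hold against every test function, so they survive.
  set f : ZMod (n + 1) →+ Fin (n + 1) := ZMod.lift (n + 1)
    ⟨zmultiplesHom (Fin (n + 1)) (L' - L), hcard⟩ with hf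
  have f1 : f 1 = L' - L := by
    have := ZMod.lift_coe (n + 1) (A := Fin (n + 1))
      ⟨zmultiplesHom (Fin (n + 1)) (L' - L), hcard⟩ 1
    simpa using this
  have hWf : ∀ t i x, W (i + f x) t = W i t := by
    intro t i x
    obtain ⟨m, rfl⟩ := ZMod.natCast_zmod_surjective x
    induction m with
    | zero => simp
    | succ m ih =>
      push_cast
      rw [map_add, f1, ← add_assoc, hW, ih]
  refine ⟨fun j t => ∑ x, b x • e (j + f x) t, ⟨fun i t => HolBundle.HolAt.sum fun x _ =>
    (h.hol _ t).const_smul _, fun t i j => ?_, fun t i => ?_, fun t i j => ?_⟩⟩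
  · simp only [map_sum, LinearMap.sum_apply, map_smul, LinearMap.smul_apply, h.η, smul_eq_mul,
      Finset.mul_sum, ← mul_assoc]
    rw [Finset.sum_comm]
    refine Eq.trans ?_ ((hb1 fun z => if i + j + f z = L then 1 else 0).trans ?_)
    · refine Finset.sum_congr rfl fun x _ => Finset.sum_congr rfl fun y _ => ?_
      rw [map_add, mul_comm (b y)]
      congr 2
      rw [add_add_add_comm]
    · rw [map_neg, f1]
      congr 1
      rw [eq_iff_iff, ← sub_eq_add_neg, sub_eq_iff_eq_add, add_sub_cancel]
  · simp only [map_sum, map_smul, h.Φ, Finset.smul_sum]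
    refine Finset.sum_congr rfl fun x _ => ?_
    rw [smul_comm, add_right_comm]
  · simp only [map_sum, LinearMap.sum_apply, map_smulₛₗ, LinearMap.smul_apply, h.g, smul_eq_mul,
      RingHom.id_apply, hWf, Finset.mul_sum, ← mul_assoc]
    rw [Finset.sum_comm]
    refine Eq.trans ?_ ((hb2 fun z => if i - j + f z = 0 then (Real.exp (W i t) : ℂ) else 0).trans ?_)
    · refine Finset.sum_congr rfl fun x _ => Finset.sum_congr rfl fun y _ => ?_
      rw [map_sub, mul_comm (b y)]
      congr 2
      rw [eq_iff_iff, sub_add_sub_comm, sub_eq_zero]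
    · rw [map_zero, add_zero]
      simp only [sub_eq_zero]

end TTStar
end

noncomputable section

namespace TTStar

open Filter Topology

variable {n : ℕ}

/-! ## Uniqueness of the solution attached to a structure -/

/-- The primitive root of unity `e^{2πi/(n+1)}`. -/
def rootω (n : ℕ) : ℂ := Complex.exp (2 * Real.pi * Complex.I / (n + 1 : ℕ))

theorem rootω_primitive (n : ℕ) : IsPrimitiveRoot (rootω n) (n + 1) :=
  Complex.isPrimitiveRoot_exp _ n.succ_ne_zero

theorem rootω_pow (n : ℕ) : rootω n ^ (n + 1) = 1 := (rootω_primitive n).pow_eq_one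

theorem rootω_ne_zero (n : ℕ) : rootω n ≠ 0 := Complex.exp_ne_zero _

namespace TodaFrame

variable {S S' : Data (n + 1)} {c : ℂ} {L : Fin (n + 1)}
  {W : Fin (n + 1) → ℂˣ → ℝ} {e : Fin (n + 1) → ∀ t, S.E t}

theorem Φ_pow_apply (h : TodaFrame S c L W e) (t : ℂˣ) (m : ℕ) (i : Fin (n + 1)) :
    ((S.Φ t 1 : Module.End ℂ (S.E t)) ^ m) (e i t) = c ^ m • e (i + m • 1) t := by
  induction m with
  | zero => simp
  | succ m ih =>
    rw [pow_succ', Module.End.mul_apply, ih, map_smul, h.Φ, smul_smul, ← pow_succ, succ_nsmul,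
      add_assoc]

theorem Φ_pow (h : TodaFrame S c L W e) (t : ℂˣ) (v : S.E t) :
    ((S.Φ t 1 : Module.End ℂ (S.E t)) ^ (n + 1)) v = c ^ (n + 1) • v := by
  obtain ⟨a, rfl⟩ := h.exists_coeff t v
  have h3 : (n + 1) • (1 : Fin (n + 1)) = 0 := by
    simpa using card_nsmul_eq_zero (x := (1 : Fin (n + 1)))
  simp only [map_sum, map_smul, h.Φ_pow_apply, h3, add_zero, Finset.smul_sum]
  exact Finset.sum_congr rfl fun i _ => smul_comm _ _ _

theorem hasEigenvalue (h : TodaFrame S c L W e) (t : ℂˣ) {ζ : ℂ} (hζ : ζ ^ (n + 1) = 1) :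
    Module.End.HasEigenvalue (S.Φ t 1 : Module.End ℂ (S.E t)) (ζ * c) := by
  have hζ0 : ζ ≠ 0 := by rintro rfl; simp at hζ
  have hζ' : ζ⁻¹ ^ (n + 1) = 1 := by rw [inv_pow, hζ, inv_one]
  -- The eigenvectors of the cyclic shift are the discrete Fourier vectors `∑ ζ^{-k} e_k`.
  refine Module.End.hasEigenvalue_of_hasEigenvector
    (x := ∑ k : Fin (n + 1), ζ⁻¹ ^ (k : ℕ) • e k t) ⟨?_, fun h0 => ?_⟩
  · rw [Module.End.mem_eigenspace_iff, map_sum, Finset.smul_sum]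
    refine Fintype.sum_equiv (Equiv.addRight 1) _ _ fun k => ?_
    have h1 : ζ⁻¹ ^ ((1 : Fin (n + 1)) : ℕ) = ζ⁻¹ := by
      rw [Fin.val_one', ← pow_eq_pow_mod _ hζ', pow_one]
    rw [map_smul, h.Φ, Equiv.coe_addRight, smul_smul, smul_smul, pow_fin_add hζ', h1]
    congr 1
    field_simp
  · have := Fintype.linearIndependent_iff.1 (h.linearIndependent t) _ h0 0
    simp at this

end TodaFrame

/-! ### Adapted coordinates, and the comparison of structures through their solutions. -/

namespace Data

variable {S S' : Data (n + 1)} {c c' : ℂˣ}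

theorem HasTodaFrame.isAdapted {w : ℤ → ℂˣ → ℝ} (h : S.HasTodaFrame c w) : S.IsAdapted c := by
  obtain ⟨L, e, h⟩ := hasTodaFrame_iff.1 h
  intro t j
  refine h.hasEigenvalue t ?_
  change (rootω n ^ (j : ℕ)) ^ (n + 1) = 1
  rw [pow_right_comm, rootω_pow, one_pow]

theorem HasTodaFrame.Φ_pow {w : ℤ → ℂˣ → ℝ} (h : S.HasTodaFrame c w) (t : ℂˣ) (v : S.E t) :
    ((S.Φ t 1 : Module.End ℂ (S.E t)) ^ (n + 1)) v = (c : ℂ) ^ (n + 1) • v := by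
  obtain ⟨L, e, h⟩ := hasTodaFrame_iff.1 h
  exact h.Φ_pow t v

/-- If `Φ^{n+1}` is the scalar `a (dt)^{n+1}`, then an adapted coordinate `ct` has `c^{n+1} = a`. -/
theorem IsAdapted.pow_eq (h : S.IsAdapted c) {a : ℂ} (t : ℂˣ)
    (ha : ∀ v, ((S.Φ t 1 : Module.End ℂ (S.E t)) ^ (n + 1)) v = a • v) :
    (c : ℂ) ^ (n + 1) = a := by
  obtain ⟨v, hv⟩ := (h t 0).exists_hasEigenvector
  have h1 := hv.pow_apply (n + 1)
  rw [ha] at h1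
  have h2 := smul_left_injective ℂ hv.2 h1
  simpa using h2.symm

theorem HasTodaFrame.map_iso {w : ℤ → ℂˣ → ℝ} (h : S.HasTodaFrame c w) (T : Iso S S') :
    S'.HasTodaFrame c w := by
  obtain ⟨L, e, h⟩ := hasTodaFrame_iff.1 h
  exact hasTodaFrame_iff.2 ⟨L, _, h.map_iso T⟩

theorem HasTodaFrame.of_equiv {w w' : RadialSolution n} (h : S.HasTodaFrame c w.1) (hw : w ≈ w') :
    S.HasTodaFrame c w'.1 := by
  obtain ⟨s, hs⟩ := hw
  obtain ⟨L, e, h⟩ := hasTodaFrame_iff.1 h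
  refine hasTodaFrame_iff.2 ⟨_, _, (?_ : (fun (i : Fin (n + 1)) t => w.1
    (((i + idx n s : Fin (n + 1)) : ℕ) : ℤ) (c * t)) = _) ▸ h.shift (idx n s)⟩
  funext i t
  rw [hs, ← idx_periodic (n := n) w.2.1.periodic (_ + s), idx_add, idx_coe]

theorem HasTodaFrame.unique (hS : S.IsTTStar) {w w' : RadialSolution n}
    (h : S.HasTodaFrame c w.1) (h' : S.HasTodaFrame c w'.1) : w ≈ w' := by
  obtain ⟨L, e, h⟩ := hasTodaFrame_iff.1 h
  obtain ⟨L', e', h'⟩ := hasTodaFrame_iff.1 h'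
  obtain ⟨k, hk⟩ := h.exists_shift h' hS c.ne_zero
  refine ⟨(k : ℕ), fun j => funext fun t => ?_⟩
  have h1 := hk (idx n j) (c⁻¹ * t)
  simp only [mul_inv_cancel_left] at h1
  rw [← idx_periodic (n := n) w'.2.1.periodic j, h1,
    ← idx_periodic (n := n) w.2.1.periodic (j + _), idx_add, idx_coe]

/-- The quotient `c'/c` is a root of unity, which `mul_root` absorbs. Since `|c'| = |c|`, a radial
solution takes the same values at `c't` and `ct`. -/
theorem HasTodaFrame.of_pow_eq {w : RadialSolution n} (h : S.HasTodaFrame c w.1)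
    (hc : (c' : ℂ) ^ (n + 1) = (c : ℂ) ^ (n + 1)) : S.HasTodaFrame c' w.1 := by
  obtain ⟨L, e, h⟩ := hasTodaFrame_iff.1 h
  have hζ : ((c' : ℂ) / c) ^ (n + 1) = 1 := by
    rw [div_pow, hc, div_self (pow_ne_zero _ c.ne_zero)]
  obtain ⟨e', h'⟩ := h.mul_root hζ
  rw [mul_div_cancel₀ _ c.ne_zero] at h'
  have hn : ‖(c' : ℂ)‖ = ‖(c : ℂ)‖ := by
    have := congrArg norm hc
    rw [norm_pow, norm_pow] at this
    exact (pow_left_inj₀ (norm_nonneg _) (norm_nonneg _) n.succ_ne_zero).1 this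
  have hW : (fun (i : Fin (n + 1)) t => w.1 ((i : ℕ) : ℤ) (c' * t)) =
      fun (i : Fin (n + 1)) t => w.1 ((i : ℕ) : ℤ) (c * t) :=
    funext fun i => funext fun t => w.2.2 _ _ _ (by simp [hn])
  exact hasTodaFrame_iff.2 ⟨L, e', hW ▸ h'⟩

/-- The two frames may have different pairing indices `L` and `L'`. Antisymmetry for both gives
`W_{i+L'-L} = -W_{L-i} = W_i`, the periodicity under which `change_pairing` makes the indices equal.
-/
theorem HasTodaFrame.nonempty_iso (hS : S.IsTTStar) (hS' : S'.IsTTStar) {w : RadialSolution n}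
    (h : S.HasTodaFrame c w.1) (h' : S'.HasTodaFrame c w.1) : Nonempty (Iso S S') := by
  obtain ⟨L, e, h⟩ := hasTodaFrame_iff.1 h
  obtain ⟨L', e', h'⟩ := hasTodaFrame_iff.1 h'
  obtain ⟨e'', h''⟩ := h.change_pairing (L' := L') fun t i => by
    have h1 := h.antisymm hS t (L - i)
    have h2 := h'.antisymm hS' t (i + (L' - L))
    have e1 : L - (L - i) = i := by abel
    have e2 : L' - (i + (L' - L)) = L - i := by abel
    rw [e1] at h1
    rw [e2] at h2
    linarith
  exact ⟨h''.iso h' hS hS'⟩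

end Data

end TTStar
end

noncomputable section

namespace TTStar

open Filter Topology

variable {n : ℕ}

/-! ## The power `Φ^{n+1}` is constant -/

/-- An endomorphism conjugate to its multiple by a primitive root of unity has scalar power. -/
theorem exists_pow_eq_smul {V : Type*} [AddCommGroup V] [Module ℂ V] [FiniteDimensional ℂ V]
    (hV : Module.finrank ℂ V = n + 1) (φ : Module.End ℂ V) (A : V ≃ₗ[ℂ] V)
    (hA : ∀ v, A (φ v) = rootω n • φ (A v)) :
    ∃ a : ℂ, ∀ v, (φ ^ (n + 1)) v = a • v := by
  -- Conjugation by `A` turns `ωx - φ` into `ω(x - φ)`, and `ω^{n+1} = 1` in the determinant.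
  have h1 : ∀ x : ℂ, φ.charpoly.eval (rootω n * x) = φ.charpoly.eval x := by
    intro x
    rw [LinearMap.eval_charpoly, LinearMap.eval_charpoly]
    have h2 : (A : V →ₗ[ℂ] V) ∘ₗ (algebraMap ℂ (Module.End ℂ V) (rootω n * x) - φ) ∘ₗ
        (A.symm : V →ₗ[ℂ] V) = rootω n • (algebraMap ℂ (Module.End ℂ V) x - φ) := by
      ext v
      have := hA (A.symm v)
      simp only [LinearEquiv.apply_symm_apply] at this
      simp [Module.algebraMap_end_apply, this, smul_sub, smul_smul, mul_comm]
    rw [← LinearMap.det_conj (algebraMap ℂ (Module.End ℂ V) (rootω n * x) - φ) A, h2,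
      LinearMap.det_smul, hV, rootω_pow, one_mul]
  have h2 : φ.charpoly.comp (Polynomial.C (rootω n) * Polynomial.X) = φ.charpoly :=
    Polynomial.funext fun x => by simpa using h1 x
  -- The substitution `x ↦ ωx` multiplies the coefficient of degree `k` by `ω^k ≠ 1`. What remains
  -- is `x^{n+1}` plus a constant, and Cayley–Hamilton finishes.
  have h3 : ∀ k, 0 < k → k < n + 1 → φ.charpoly.coeff k = 0 := by
    intro k hk hk'
    have h4 := congrArg (fun p => Polynomial.coeff p k) h2
    simp only [Polynomial.comp_C_mul_X_coeff] at h4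
    have h5 : rootω n ^ k ≠ 1 := (rootω_primitive n).pow_ne_one_of_pos_of_lt hk.ne' hk'
    have h6 : φ.charpoly.coeff k * (rootω n ^ k - 1) = 0 := by rw [mul_sub, h4]; ring
    exact (mul_eq_zero.1 h6).resolve_right (sub_ne_zero.2 h5)
  have h4 := LinearMap.aeval_self_charpoly φ
  have h5 : φ.charpoly.natDegree = n + 1 := by rw [LinearMap.charpoly_natDegree, hV]
  have h6 : φ.charpoly.coeff (n + 1) = 1 := by
    rw [← h5]; exact φ.charpoly_monic
  rw [Polynomial.aeval_eq_sum_range, h5, Finset.sum_range_succ, h6, one_smul,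
    Finset.sum_eq_single_of_mem 0 (by simp) fun k hk hk0 => by
      rw [h3 k (by omega) (by simpa using hk), zero_smul]] at h4
  refine ⟨-φ.charpoly.coeff 0, fun v => ?_⟩
  rw [eq_neg_of_add_eq_zero_right h4]
  simp

/-- A holomorphic function on `ℂ*` that is invariant under rotations is constant. -/
theorem eq_of_rotation_invariant {f : ℂˣ → ℂ} (hf : ∀ t, HolFunAt f t)
    (h : ∀ (u : Circle) t, f (Circle.toUnits u * t) = f t) (s t : ℂˣ) : f s = f t := by
  -- Pulled back along `exp`, rotations become imaginary translations; an entire function invariant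
  -- under them has zero derivative.
  set F : ℂ → ℂ := fun z => onPlane f (Complex.exp z) with hF
  have hFe : ∀ z, F z = f (Units.mk0 _ (Complex.exp_ne_zero z)) := fun z =>
    onPlane_of_ne _ _
  have hd : Differentiable ℂ F := fun z => by
    have h1 := (holFunAt_iff.1 (hf (Units.mk0 _ (Complex.exp_ne_zero z)))).differentiableAt (by simp)
    exact DifferentiableAt.comp z h1 Complex.differentiable_exp.differentiableAt
  have hinv : ∀ (z : ℂ) (y : ℝ), F (z + y * Complex.I) = F z := by
    intro z y
    rw [hFe, hFe, ← h (Circle.exp y) (Units.mk0 _ (Complex.exp_ne_zero z))]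
    congr 1
    ext
    rw [Units.val_mul, Units.val_mk0, Units.val_mk0, Complex.exp_add, mul_comm]
    rfl
  have hderiv : ∀ z, deriv F z = 0 := by
    intro z
    have h1 : HasDerivAt (fun y : ℝ => F (z + y * Complex.I)) (deriv F z * Complex.I) 0 := by
      have h2 : HasDerivAt (fun y : ℝ => z + y * Complex.I) Complex.I 0 := by
        simpa using ((Complex.ofRealCLM.hasDerivAt (x := (0 : ℝ))).mul_const Complex.I).const_add z
      have h3 := (hd (z + (0 : ℝ) * Complex.I)).hasDerivAt
      have h4 := HasDerivAt.comp (h₂ := F) (0 : ℝ) h3 h2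
      rwa [Complex.ofReal_zero, zero_mul, add_zero] at h4
    simp only [hinv] at h1
    have h2 := h1.unique (hasDerivAt_const _ _)
    simpa using h2
  have hc := is_const_of_deriv_eq_zero hd hderiv
  have hl : ∀ s : ℂˣ, f s = F (Complex.log s) := fun s => by
    rw [hFe]
    congr 1
    ext
    rw [Units.val_mk0, Complex.exp_log s.ne_zero]
  rw [hl s, hl t, hc]

namespace Data

variable {S : Data (n + 1)}

theorem IsCyclicFixed.exists_map (h : S.IsCyclicFixed) : ∃ A : ∀ t, S.E t ≃ₗ[ℂ] S.E t,
    (∀ s t, S.HolAt s t → S.HolAt (fun x => A x (s x)) t) ∧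
    (∀ t a b, S.η t (A t a) (A t b) = S.η t a b) ∧
    (∀ t a b, S.g t (A t a) (A t b) = S.g t a b) ∧
    ∀ t a, A t (S.Φ t 1 a) = rootω n • S.Φ t 1 (A t a) := by
  obtain ⟨T⟩ := h
  exact ⟨T.map, fun s t hs => T.holAt hs, fun t a b => (T.map_η t a b).symm,
    fun t a b => (T.map_g t a b).symm, fun t a => T.map_Φ t 1 a⟩

/-- The factor `u⁻¹` in the `ρ`-action cancels the derivative `u` of the rotation, so on the
coordinate vector field the action only moves the point. -/
theorem rho_Φ_one (S : Data (n + 1)) (u t : ℂˣ) (a : S.E (u * t)) :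
    (S.rho u).Φ t 1 a = S.Φ (u * t) 1 a := by
  change ((u : ℂ)⁻¹ • (S.Φ (u * t)).comp (LinearMap.lsmul ℂ ℂ (u : ℂ))) 1 a = S.Φ (u * t) 1 a
  rw [← smul_eq_mul] at *
  simp only [LinearMap.smul_apply, LinearMap.comp_apply, LinearMap.lsmul_apply, map_smul,
      smul_smul, inv_mul_cancel₀ u.ne_zero, one_smul]

theorem IsTTStar.holAt_Φ_pow (hS : S.IsTTStar) {s : ∀ t, S.E t} {U : Set ℂˣ} (hU : IsOpen U)
    (hs : ∀ x ∈ U, S.HolAt s x) (m : ℕ) :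
    ∀ t ∈ U, S.HolAt (fun x => ((S.Φ x 1 : Module.End ℂ (S.E x)) ^ m) (s x)) t := by
  induction m with
  | zero => exact hs
  | succ m ih =>
    intro t ht
    simp only [pow_succ', Module.End.mul_apply]
    exact hS.holAt_Φ hU ht ih

theorem Iso.map_Φ_pow {S₁ S₂ : Data (n + 1)} (T : Iso S₁ S₂) (t : ℂˣ) (m : ℕ) (a : S₁.E t) :
    T.map t (((S₁.Φ t 1 : Module.End ℂ (S₁.E t)) ^ m) a) =
      ((S₂.Φ t 1 : Module.End ℂ (S₂.E t)) ^ m) (T.map t a) := by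
  induction m with
  | zero => simp
  | succ m ih => simp only [pow_succ', Module.End.mul_apply, T.map_Φ, ih]

/-- For fixed points, `Φ^{n+1}` is a constant multiple of `(dt)^{n+1}`. -/
theorem exists_Φ_pow_eq (hS : S.IsTTStar) (hc : S.IsCyclicFixed) (hρ : S.IsRhoFixed) :
    ∃ a : ℂ, ∀ t v, ((S.Φ t 1 : Module.End ℂ (S.E t)) ^ (n + 1)) v = a • v := by
  obtain ⟨A, -, -, -, hA⟩ := hc.exists_map
  have h1 : ∀ t, ∃ a : ℂ, ∀ v, ((S.Φ t 1 : Module.End ℂ (S.E t)) ^ (n + 1)) v = a • v := fun t =>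
    have := S.finiteDimensional t
    exists_pow_eq_smul (S.finrank_eq t) _ (A t) (hA t)
  choose a ha using h1
  have hne : ∀ t, ∃ v : S.E t, v ≠ 0 := fun t =>
    have : Nontrivial (S.E t) := Module.nontrivial_of_finrank_pos (R := ℂ)
      (by rw [S.finrank_eq]; omega)
    exists_ne 0
  have hrot : ∀ (u : Circle) t, a (Circle.toUnits u * t) = a t := by
    intro u t
    obtain ⟨T, -⟩ := hρ
    obtain ⟨v, hv⟩ := hne (Circle.toUnits u * t)
    have h2 := (T u).map_Φ_pow t (n + 1) v
    rw [ha t] at h2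
    have h3 : ∀ m, (((S.rho (Circle.toUnits u)).Φ t 1 :
        Module.End ℂ ((S.rho (Circle.toUnits u)).E t)) ^ m) v =
        ((S.Φ (Circle.toUnits u * t) 1 : Module.End ℂ (S.E (Circle.toUnits u * t))) ^ m) v := by
      intro m
      induction m with
      | zero => rfl
      | succ m ih =>
        rw [pow_succ', pow_succ', Module.End.mul_apply]
        refine (Module.End.mul_apply (R := ℂ) (M := (S.rho (Circle.toUnits u)).E t) _ _ _).trans ?_
        rw [ih]
        exact S.rho_Φ_one _ _ _
    rw [h3, ha] at h2
    have h4 : a (Circle.toUnits u * t) • (T u).map t v = a t • (T u).map t v :=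
      ((T u).map t).map_smul _ _ |>.symm.trans h2
    have h5 : (T u).map t v ≠ 0 := fun h0 => hv (((T u).map t).map_eq_zero_iff.1 h0)
    exact smul_left_injective ℂ h5 h4
  -- Locally `a` is the first coordinate of `Φ^{n+1}` applied to the first vector of a holomorphic
  -- frame.
  have hhol : ∀ t, HolFunAt a t := by
    intro t
    have hU := S.isOpen_trivSet t
    have hfr := S.isHolFrame_trivFrame t
    have h2 := hS.holAt_Φ_pow hU (fun x hx => hfr.holAt hU hx 0) (n + 1) t (S.mem_trivSet t)
    have h3 := S.holFunAt_trivCoord t (S.mem_trivSet t) h2 0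
    refine ContMDiffAt.congr_of_eventuallyEq h3 ?_
    filter_upwards [hU.mem_nhds (S.mem_trivSet t)] with x hx
    rw [ha]
    have h4 := S.sum_trivCoord t hx (S.trivFrame t 0 x)
    have h5 := S.trivCoord_map t hx {0} (fun _ => a x) fun _ : Fin 1 => S.trivFrame t 0 x
    simp only [Finset.sum_singleton] at h5
    have h7 : S.trivCoord t x (S.trivFrame t 0 x) 0 = 1 := by
      have h8 := Fintype.linearIndependent_iff.1 (hfr.linearIndependent hx)
        (fun i => S.trivCoord t x (S.trivFrame t 0 x) i - Pi.single (M := fun _ => ℂ) 0 1 i) (by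
          simp only [sub_smul, Finset.sum_sub_distrib, ← h4]
          simp [Pi.single_apply, ite_smul]) 0
      simpa [sub_eq_zero] using h8
    rw [h5, Pi.smul_apply, h7, smul_eq_mul, mul_one]
  exact ⟨a 1, fun t v => by rw [ha, eq_of_rotation_invariant hhol hrot t 1]⟩

end Data

end TTStar
end

noncomputable section

namespace TTStar

open Filter Topology

/-! ## A differential inequality without global solutions -/

/-- If `f'' > 0`, the second derivative test makes the point a local minimum as well, so `f` is
locally constant and `f'' = 0`. -/
theorem second_deriv_nonpos_of_isLocalMax {f f' : ℝ → ℝ} {f'' a : ℝ} (h : IsLocalMax f a)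
    (hf : ∀ᶠ x in 𝓝 a, HasDerivAt f (f' x) x) (hf' : HasDerivAt f' f'' a) : f'' ≤ 0 := by
  by_contra! hpos
  have h0 : deriv f =ᶠ[𝓝 a] f' := hf.mono fun x hx => hx.deriv
  have h1 : deriv (deriv f) a = f'' := by rw [h0.deriv_eq, hf'.deriv]
  have h2 : IsLocalMin f a := isLocalMin_of_deriv_deriv_pos (by rwa [h1]) h.deriv_eq_zero
    hf.self_of_nhds.continuousAt
  have h3 : f =ᶠ[𝓝 a] fun _ => f a := by
    filter_upwards [h, h2] with x hx hx' using le_antisymm hx hx'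
  have h4 : deriv (deriv f) a = 0 := by
    rw [h3.deriv.deriv_eq]; simp
  linarith

/-- There is no function on the whole line with `v'' ≥ C e^v`, `C > 0`. -/
theorem not_second_deriv_ge_exp {v v' v'' : ℝ → ℝ} {C : ℝ} (hC : 0 < C)
    (hv : ∀ x, HasDerivAt v (v' x) x) (hv' : ∀ x, HasDerivAt v' (v'' x) x)
    (h : ∀ x, C * Real.exp (v x) ≤ v'' x) : False := by
  -- Maximise `(R² - s²)² e^v` on `[-R, R]`. At an interior maximum the second derivative of its
  -- logarithm is nonpositive, which with `v'' ≥ C e^v` bounds the maximum by `8R²/C`, while the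
  -- value at `0` is `R⁴ e^{v(0)}`.
  have key : ∀ R : ℝ, 0 < R → R ^ 4 * Real.exp (v 0) ≤ 8 * R ^ 2 / C := by
    intro R hR
    set H : ℝ → ℝ := fun s => (R ^ 2 - s ^ 2) ^ 2 * Real.exp (v s) with hH
    have hc : Continuous v := continuous_iff_continuousAt.2 fun x => (hv x).continuousAt
    have hHc : Continuous H := by fun_prop
    obtain ⟨m, hm, hmax⟩ := isCompact_Icc.exists_isMaxOn (s := Set.Icc (-R) R)
      ⟨0, by constructor <;> linarith⟩ hHc.continuousOn
    have h0 : H 0 ≤ H m := hmax (show (0 : ℝ) ∈ Set.Icc (-R) R by constructor <;> linarith)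
    have h0' : H 0 = R ^ 4 * Real.exp (v 0) := by simp only [hH]; ring
    have hpos : 0 < H 0 := by rw [h0']; positivity
    have hq : 0 < R ^ 2 - m ^ 2 := by
      rcases lt_or_ge 0 (R ^ 2 - m ^ 2) with hq | hq
      · exact hq
      · have h1 : m ^ 2 ≤ R ^ 2 := sq_le_sq' hm.1 hm.2
        have h2 : R ^ 2 - m ^ 2 = 0 := by linarith
        have h3 : H m = 0 := by simp only [hH, h2]; ring
        linarith
    have hev : ∀ᶠ s in 𝓝 m, 0 < R ^ 2 - s ^ 2 :=
      (by fun_prop : ContinuousAt (fun s : ℝ => R ^ 2 - s ^ 2) m).eventually_const_lt hq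
    set G : ℝ → ℝ := fun s => 2 * Real.log (R ^ 2 - s ^ 2) + v s with hG
    have hGmax : IsLocalMax G m := by
      have : ∀ s, 0 < R ^ 2 - s ^ 2 → G s = Real.log (H s) := by
        intro s hs
        simp only [hG, hH]
        rw [Real.log_mul (by positivity) (Real.exp_ne_zero _), Real.log_pow, Real.log_exp]
        norm_num
      filter_upwards [hev] with s hs
      rw [this s hs, this m hq]
      refine Real.log_le_log (by simp only [hH]; positivity) (hmax ?_)
      exact abs_le.1 (abs_le_of_sq_le_sq (by linarith) hR.le)
    have hG' : ∀ᶠ s in 𝓝 m, HasDerivAt G (2 * (-(2 * s) / (R ^ 2 - s ^ 2)) + v' s) s := by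
      filter_upwards [hev] with s hs
      have h1 : HasDerivAt (fun s : ℝ => R ^ 2 - s ^ 2) (-(2 * s)) s := by
        simpa using (hasDerivAt_pow 2 s).const_sub (R ^ 2)
      exact ((h1.log hs.ne').const_mul 2).add (hv s)
    have hG'' : HasDerivAt (fun s => 2 * (-(2 * s) / (R ^ 2 - s ^ 2)) + v' s)
        (2 * ((-(2 * 1) * (R ^ 2 - m ^ 2) - -(2 * m) * -(2 * m)) / (R ^ 2 - m ^ 2) ^ 2) + v'' m)
        m := by
      have h1 : HasDerivAt (fun s : ℝ => R ^ 2 - s ^ 2) (-(2 * m)) m := by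
        simpa using (hasDerivAt_pow 2 m).const_sub (R ^ 2)
      have h2 : HasDerivAt (fun s : ℝ => -(2 * s)) (-(2 * 1)) m :=
        ((hasDerivAt_id m).const_mul 2).neg
      exact ((h2.div h1 hq.ne').const_mul 2).add (hv' m)
    have h1 := second_deriv_nonpos_of_isLocalMax hGmax hG' hG''
    have h2 := h m
    have h3 : C * Real.exp (v m) * (R ^ 2 - m ^ 2) ^ 2 ≤ 8 * R ^ 2 := by
      have h4 : C * Real.exp (v m) ≤ 4 * (R ^ 2 + m ^ 2) / (R ^ 2 - m ^ 2) ^ 2 := by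
        have : 2 * ((-(2 * 1) * (R ^ 2 - m ^ 2) - -(2 * m) * -(2 * m)) / (R ^ 2 - m ^ 2) ^ 2) =
          -(4 * (R ^ 2 + m ^ 2) / (R ^ 2 - m ^ 2) ^ 2) := by ring
        linarith
      rw [le_div_iff₀ (by positivity)] at h4
      linarith
    rw [← h0', le_div_iff₀ hC]
    calc H 0 * C ≤ H m * C := by gcongr
      _ = C * Real.exp (v m) * (R ^ 2 - m ^ 2) ^ 2 := by simp only [hH]; ring
      _ ≤ 8 * R ^ 2 := h3
  have hE := Real.exp_pos (v 0)
  set E := Real.exp (v 0)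
  -- The bound says `R² ≤ 8 / (C E)`; taking `R² = 9 / (C E)` violates it.
  have h1 := key (Real.sqrt (9 / (C * E))) (by positivity)
  rw [show Real.sqrt (9 / (C * E)) ^ 4 = (Real.sqrt (9 / (C * E)) ^ 2) ^ 2 by ring,
    Real.sq_sqrt (by positivity), le_div_iff₀ hC] at h1
  have h2 : (9 / (C * E)) ^ 2 * E * C = 9 * (9 / (C * E)) := by field_simp; try ring
  rw [h2] at h1
  have : 0 < 9 / (C * E) := by positivity
  linarith

end TTStar
end

noncomputable section

namespace TTStar

open Filter Topology

/-! ## Commutators of nilpotent matrices -/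

section Frobenius

open ComplexOrder MatrixOrder

variable {N : ℕ}

theorem exists_conjTranspose_mul_self {h : Matrix (Fin N) (Fin N) ℂ} (hh : h.PosDef) :
    ∃ Q : Matrix (Fin N) (Fin N) ℂ, IsUnit Q ∧ h = Qᴴ * Q := by
  obtain ⟨Q, hQ⟩ := CStarAlgebra.nonneg_iff_eq_star_mul_self.mp hh.posSemidef.nonneg
  refine ⟨Q, ?_, hQ⟩
  have h1 := (Matrix.isUnit_iff_isUnit_det _).1 hh.isUnit
  rw [hQ, det_mul] at h1
  exact (Matrix.isUnit_iff_isUnit_det _).2 (isUnit_of_mul_isUnit_right h1)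

/-- The squared Frobenius norm. -/
def frob (X : Matrix (Fin N) (Fin N) ℂ) : ℝ := ∑ i, ∑ j, ‖X i j‖ ^ 2

theorem frob_nonneg (X : Matrix (Fin N) (Fin N) ℂ) : 0 ≤ frob X := by
  unfold frob; positivity

theorem trace_mul_conjTranspose (X Y : Matrix (Fin N) (Fin N) ℂ) :
    (X * Yᴴ).trace = ∑ i, ∑ j, X i j * starRingEnd ℂ (Y i j) := by
  simp [Matrix.trace, Matrix.mul_apply]

theorem trace_mul_conjTranspose_self (X : Matrix (Fin N) (Fin N) ℂ) :
    (X * Xᴴ).trace = frob X := by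
  rw [trace_mul_conjTranspose, frob]
  push_cast
  refine Finset.sum_congr rfl fun i _ => Finset.sum_congr rfl fun j _ => ?_
  rw [Complex.mul_conj, Complex.normSq_eq_norm_sq]
  push_cast
  rfl

theorem frob_eq_zero {X : Matrix (Fin N) (Fin N) ℂ} : frob X = 0 ↔ X = 0 := by
  constructor
  · intro h
    have h1 := trace_mul_conjTranspose_self X
    rw [h, Complex.ofReal_zero, Matrix.trace_mul_conjTranspose_self_eq_zero_iff] at h1
    exact h1
  · rintro rfl
    simp [frob]

theorem frob_smul (c : ℂ) (X : Matrix (Fin N) (Fin N) ℂ) : frob (c • X) = ‖c‖ ^ 2 * frob X := by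
  simp [frob, mul_pow, Finset.mul_sum]

theorem continuous_frob : Continuous (frob : Matrix (Fin N) (Fin N) ℂ → ℝ) := by
  unfold frob
  exact continuous_finsetSum _ fun i _ => continuous_finsetSum _ fun j _ =>
    ((continuous_id.matrix_elem i j).norm.pow 2)

theorem norm_trace_mul_conjTranspose_sq_le (X Y : Matrix (Fin N) (Fin N) ℂ) :
    ‖(X * Yᴴ).trace‖ ^ 2 ≤ frob X * frob Y := by
  rw [trace_mul_conjTranspose]
  simp only [frob, ← Finset.sum_product']
  refine le_trans ?_ (Finset.sum_mul_sq_le_sq_mul_sq _ (fun p : Fin N × Fin N => ‖X p.1 p.2‖)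
    fun p => ‖Y p.1 p.2‖)
  refine pow_le_pow_left₀ (norm_nonneg _) ((norm_sum_le _ _).trans_eq ?_) 2
  simp

theorem eq_zero_of_isHermitian_of_pow_eq_zero {B : Matrix (Fin N) (Fin N) ℂ} (hB : B.IsHermitian)
    (m : ℕ) (hm : B ^ m = 0) : B = 0 := by
  induction m using Nat.strong_induction_on with
  | _ m ih =>
    match m with
    | 0 => rw [← mul_one B, ← pow_zero B, hm, mul_zero]
    | 1 => rwa [pow_one] at hm
    | m + 2 =>
      -- The exponent is half of `m + 2` rounded up: for Hermitian `B` the matrix `(B^k)ᴴ B^k =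
      -- B^{2k}` vanishes as soon as `2k ≥ m + 2`.
      refine ih ((m + 3) / 2) (by omega) ?_
      rw [← Matrix.conjTranspose_mul_self_eq_zero, conjTranspose_pow, hB.eq, ← pow_add]
      exact pow_eq_zero_of_le (by omega) hm

/-- By normality `(Xᴴ X)^m = (Xᴴ)^m X^m = 0`, and a Hermitian nilpotent matrix is zero. -/
theorem eq_zero_of_normal_of_pow_eq_zero {X : Matrix (Fin N) (Fin N) ℂ}
    (hX : X * Xᴴ = Xᴴ * X) (m : ℕ) (hm : X ^ m = 0) : X = 0 := by
  rw [← Matrix.conjTranspose_mul_self_eq_zero]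
  refine eq_zero_of_isHermitian_of_pow_eq_zero (isHermitian_conjTranspose_mul_self X) m ?_
  have : Commute Xᴴ X := hX.symm
  rw [this.mul_pow, hm, mul_zero]

/-- The commutator `[X, Xᴴ]` of a nilpotent matrix is bounded below. -/
theorem exists_commutator_bound (N m : ℕ) : ∃ κ : ℝ, 0 < κ ∧
    ∀ X : Matrix (Fin N) (Fin N) ℂ, X ^ m = 0 →
      κ * frob X ^ 2 ≤ frob (X * Xᴴ - Xᴴ * X) := by
  -- Both sides are homogeneous of degree four, so it suffices to bound the commutator on the
  -- compact set of nilpotents of unit norm, where it vanishes nowhere.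
  set K : Set (Matrix (Fin N) (Fin N) ℂ) := {X | X ^ m = 0 ∧ frob X = 1} with hK
  have hKc : IsCompact K := by
    have h1 : IsCompact (Set.pi Set.univ fun _ : Fin N => Set.pi Set.univ fun _ : Fin N =>
        Metric.closedBall (0 : ℂ) 1) :=
      isCompact_univ_pi fun _ => isCompact_univ_pi fun _ => isCompact_closedBall _ _
    refine h1.of_isClosed_subset ?_ ?_
    · exact (isClosed_eq (continuous_id.pow m) continuous_const).inter
        (isClosed_eq continuous_frob continuous_const)
    · rintro X ⟨-, hX⟩ i - j -
      rw [mem_closedBall_zero_iff]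
      have h2 : ‖X i j‖ ^ 2 ≤ frob X :=
        (Finset.single_le_sum (f := fun j => ‖X i j‖ ^ 2) (fun _ _ => by positivity)
          (Finset.mem_univ j)).trans (Finset.single_le_sum (f := fun i => ∑ j, ‖X i j‖ ^ 2)
          (fun _ _ => by positivity) (Finset.mem_univ i))
      rw [hX] at h2
      exact (sq_le_one_iff₀ (norm_nonneg _)).1 h2
  have hcont : Continuous fun X : Matrix (Fin N) (Fin N) ℂ => frob (X * Xᴴ - Xᴴ * X) :=
    continuous_frob.comp (by fun_prop)
  have hscale : ∀ X : Matrix (Fin N) (Fin N) ℂ, X ^ m = 0 → X ≠ 0 →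
      ∃ Y ∈ K, frob (X * Xᴴ - Xᴴ * X) = frob X ^ 2 * frob (Y * Yᴴ - Yᴴ * Y) := by
    intro X hX hX0
    have hp : 0 < frob X := lt_of_le_of_ne (frob_nonneg X) (fun h => hX0 (frob_eq_zero.1 h.symm))
    set c : ℂ := ((Real.sqrt (frob X) : ℝ) : ℂ) with hc
    have hn : ‖c‖ ^ 2 = frob X := by
      rw [hc, Complex.norm_real, Real.norm_eq_abs, sq_abs, Real.sq_sqrt hp.le]
    have hc0 : c ≠ 0 := by
      rw [← norm_ne_zero_iff]
      intro h0
      rw [h0] at hn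
      norm_num at hn
      linarith
    refine ⟨c⁻¹ • X, ⟨by rw [smul_pow, hX, smul_zero], ?_⟩, ?_⟩
    · rw [frob_smul, norm_inv, inv_pow, hn, inv_mul_cancel₀ hp.ne']
    · have e : X = c • (c⁻¹ • X) := by rw [smul_smul, mul_inv_cancel₀ hc0, one_smul]
      generalize c⁻¹ • X = Y at e
      rw [← hn, e]
      simp only [conjTranspose_smul, smul_mul_smul_comm]
      rw [mul_comm (star c) c, ← smul_sub, frob_smul]
      simp only [norm_mul, norm_star]
      ring
  -- If `K` is empty, the only admissible `X` is `0` and any positive constant works.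
  rcases K.eq_empty_or_nonempty with hE | hne
  · refine ⟨1, one_pos, fun X hX => ?_⟩
    by_cases hX0 : X = 0
    · subst hX0; simp [frob]
    · obtain ⟨Y, hY, -⟩ := hscale X hX hX0
      rw [hE] at hY
      exact hY.elim
  · obtain ⟨Y, hY, hmin⟩ := hKc.exists_isMinOn hne hcont.continuousOn
    refine ⟨frob (Y * Yᴴ - Yᴴ * Y), lt_of_le_of_ne (frob_nonneg _) fun h0 => ?_, fun X hX => ?_⟩
    · have h1 := sub_eq_zero.1 (frob_eq_zero.1 h0.symm)
      have h2 := eq_zero_of_normal_of_pow_eq_zero h1 m hY.1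
      have h3 := hY.2
      rw [frob_eq_zero.2 h2] at h3
      exact zero_ne_one h3
    · by_cases hX0 : X = 0
      · subst hX0; simp [frob]
      · obtain ⟨Z, hZ, h1⟩ := hscale X hX hX0
        rw [h1, mul_comm]
        exact mul_le_mul_of_nonneg_left (hmin hZ) (by positivity)

end Frobenius

/-! ## The Bochner inequality for `tr(φ φ^†)` -/

section Bochner

open ComplexOrder

variable {N : ℕ}

attribute [local instance] matNormedRing
attribute [local instance] matNormedAlgebra

/-- The trace as a continuous linear map. -/
def traceCLM : Matrix (Fin N) (Fin N) ℂ →L[ℂ] ℂ :=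
  LinearMap.toContinuousLinearMap (Matrix.traceLinearMap (Fin N) ℂ ℂ)

/-- `∂̄(φ^†) = (∂φ + [h⁻¹∂h, φ])^†` for holomorphic `φ`. -/
theorem wirt_one_adj {h φ : ℂ → Matrix (Fin N) (Fin N) ℂ} {z : ℂ}
    (hh : ContDiffAt ℝ ∞ h z) (hu : IsUnit (h z)) (hherm : ∀ᶠ x in 𝓝 z, (h x).IsHermitian)
    (hφ : ContDiffAt ℂ ω φ z) :
    wirt 1 (fun x => adj (h x) (φ x)) z =
      adj (h z) (wirt (-1) φ z + (chern h z * φ z - φ z * chern h z)) := by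
  have hφ' := ContDiffAt.toReal hφ
  have d0 := hh.differentiableAt (n := ∞) (by simp)
  have d1 := (contDiffAt_inv hh hu).differentiableAt (n := ∞) (by simp)
  have d2 := (contDiffAt_conjTranspose hφ').differentiableAt (n := ∞) (by simp)
  have h1 : (wirt (-1) h z)ᴴ = wirt 1 h z := by
    have h2 := wirt_conjTranspose (ε := 1) d0
    rw [← h2]
    exact wirt_congr (hherm.mono fun x hx => hx.eq)
  have hz : (h z)ᴴ = h z := hherm.self_of_nhds.eq
  have hi := Matrix.nonsing_inv_mul (h z) ((Matrix.isUnit_iff_isUnit_det _).1 hu)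
  simp only [adj]
  rw [wirt_mul (f := fun x => (h x)⁻¹ * (φ x)ᴴ) (d1.mul d2) d0, wirt_mul d1 d2, wirt_inv hh hu,
    wirt_conjTranspose (hφ'.differentiableAt (by simp))]
  simp only [chern, conjTranspose_add, conjTranspose_sub, conjTranspose_mul,
    conjTranspose_nonsing_inv, hz, h1]
  generalize wirt 1 h z = H
  generalize (φ z)ᴴ = P
  generalize (wirt (-1) φ z)ᴴ = P'
  have e : (h z)⁻¹ * (P' + (P * (H * (h z)⁻¹) - H * (h z)⁻¹ * P)) * h z =
    (h z)⁻¹ * P' * h z + ((h z)⁻¹ * P * H * ((h z)⁻¹ * h z) - (h z)⁻¹ * H * (h z)⁻¹ * P * h z) := by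
    noncomm_ring
  rw [e, hi]
  noncomm_ring

/-- For `h = Qᴴ Q`, conjugation by `Q` passes to an orthonormal basis, where the `h`-adjoint is the
conjugate transpose. -/
theorem trace_mul_adj (Q X Y : Matrix (Fin N) (Fin N) ℂ) :
    adj (Qᴴ * Q) Y = Q⁻¹ * (Q * Y * Q⁻¹)ᴴ * Q ∧
    (X * adj (Qᴴ * Q) Y).trace = (Q * X * Q⁻¹ * (Q * Y * Q⁻¹)ᴴ).trace := by
  have h1 : adj (Qᴴ * Q) Y = Q⁻¹ * (Q * Y * Q⁻¹)ᴴ * Q := by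
    rw [adj, Matrix.mul_inv_rev, conjTranspose_mul, conjTranspose_mul, conjTranspose_nonsing_inv]
    noncomm_ring
  refine ⟨h1, ?_⟩
  rw [h1]
  generalize (Q * Y * Q⁻¹)ᴴ = Z
  rw [show X * (Q⁻¹ * Z * Q) = X * Q⁻¹ * Z * Q by noncomm_ring, Matrix.trace_mul_comm]
  congr 1
  noncomm_ring

/-- The data of the Bochner inequality. -/
theorem bochner {h φ : ℂ → Matrix (Fin N) (Fin N) ℂ} {z : ℂ}
    (hh : ∀ᶠ x in 𝓝 z, ContDiffAt ℝ ∞ h x) (hp : ∀ᶠ x in 𝓝 z, (h x).PosDef)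
    (hφ : ∀ᶠ x in 𝓝 z, ContDiffAt ℂ ω φ x)
    (hflat : wirt 1 (chern h) z = φ z * adj (h z) (φ z) - adj (h z) (φ z) * φ z)
    {κ : ℝ} {m : ℕ} (hκ : ∀ X : Matrix (Fin N) (Fin N) ℂ, X ^ m = 0 →
      κ * frob X ^ 2 ≤ frob (X * Xᴴ - Xᴴ * X)) (hm : φ z ^ m = 0) :
    ‖wirt (-1) (fun x => (φ x * adj (h x) (φ x)).trace) z‖ ^ 2 +
      κ * (φ z * adj (h z) (φ z)).trace.re ^ 3 ≤ (φ z * adj (h z) (φ z)).trace.re *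
        (wirt 1 (wirt (-1) fun x => (φ x * adj (h x) (φ x)).trace) z).re := by
  -- Since `∂φ^† = [φ^†, h⁻¹∂h]`, the derivative of the trace only sees the covariant derivative `∂φ
  -- + [h⁻¹∂h, φ]`.
  have hw1 : ∀ᶠ x in 𝓝 z, wirt (-1) (fun x => (φ x * adj (h x) (φ x)).trace) x =
      ((wirt (-1) φ x + (chern h x * φ x - φ x * chern h x)) * adj (h x) (φ x)).trace := by
    filter_upwards [hh, hp, hφ] with x hx hpx hφx
    have hφ' := ContDiffAt.toReal hφx
    have d1 := hφ'.differentiableAt (n := ∞) (by simp)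
    have d2 := (contDiffAt_adj hx hpx.isUnit hφ').differentiableAt (n := ∞) (by simp)
    have h1 := wirt_clm (ε := -1) traceCLM (d1.mul d2)
    refine h1.trans ?_
    have h2 := wirt_mul (ε := -1) d1 d2
    refine (congrArg trace h2).trans ?_
    rw [wirt_adj hx hpx.isUnit hφx]
    generalize adj (h x) (φ x) = B
    generalize chern h x = A
    simp only [mul_sub, add_mul, sub_mul, trace_add, trace_sub]
    rw [← mul_assoc, ← mul_assoc, Matrix.trace_mul_cycle (φ x) B A, mul_assoc A]
  have hz := hh.self_of_nhds
  have hpz := hp.self_of_nhds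
  have hφz := hφ.self_of_nhds
  have hφ' := ContDiffAt.toReal hφz
  have d1 := hφ'.differentiableAt (n := ∞) (by simp)
  have d2 := (contDiffAt_adj hz hpz.isUnit hφ').differentiableAt (n := ∞) (by simp)
  have d3 := (contDiffAt_wirt (ε := -1) hφ').differentiableAt (n := ∞) (by simp)
  have d4 := (contDiffAt_chern hz hpz.isUnit).differentiableAt (n := ∞) (by simp)
  -- As `∂̄φ = 0`, the operator `∂̄` falls only on the connection matrix, leaving a commutator of
  -- its curvature with `φ`.
  have hD : wirt 1 (fun x => wirt (-1) φ x + (chern h x * φ x - φ x * chern h x)) z =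
      wirt 1 (chern h) z * φ z - φ z * wirt 1 (chern h) z := by
    rw [wirt_add (f := wirt (-1) φ) (g := fun x => chern h x * φ x - φ x * chern h x) d3
        ((d4.mul d1).sub (d1.mul d4)), wirt_sub (f := fun x => chern h x * φ x)
        (g := fun x => φ x * chern h x) (d4.mul d1) (d1.mul d4), wirt_mul d4 d1,
      wirt_mul d1 d4, wirt_one_hol hφz, wirt_comm hφ']
    have h1 : wirt (-1) (wirt 1 φ) z = 0 := by
      have h2 : wirt 1 φ =ᶠ[𝓝 z] fun _ => 0 := hφ.mono fun x hx => wirt_one_hol hx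
      rw [wirt_congr h2, wirt_const]
    rw [h1]
    noncomm_ring
  have hw2 : wirt 1 (wirt (-1) fun x => (φ x * adj (h x) (φ x)).trace) z =
      ((wirt 1 (chern h) z * φ z - φ z * wirt 1 (chern h) z) * adj (h z) (φ z)).trace +
      ((wirt (-1) φ z + (chern h z * φ z - φ z * chern h z)) *
        adj (h z) (wirt (-1) φ z + (chern h z * φ z - φ z * chern h z))).trace := by
    rw [wirt_congr hw1]
    have d5 : DifferentiableAt ℝ
      (fun x => wirt (-1) φ x + (chern h x * φ x - φ x * chern h x)) z :=
      d3.add ((d4.mul d1).sub (d1.mul d4))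
    have h1 := wirt_clm (ε := 1) traceCLM (d5.mul d2)
    refine h1.trans ?_
    refine (congrArg trace (wirt_mul (ε := 1) d5 d2)).trans ?_
    rw [hD, wirt_one_adj hz hpz.isUnit (hp.mono fun x hx => hx.isHermitian) hφz, trace_add]
  rw [hw2, hw1.self_of_nhds, hflat]
  generalize wirt (-1) φ z + (chern h z * φ z - φ z * chern h z) = X
  generalize φ z = Y at hm
  obtain ⟨Q, hQ, hhQ⟩ := exists_conjTranspose_mul_self hpz
  rw [hhQ]
  have hQ' := (Matrix.isUnit_iff_isUnit_det _).1 hQ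
  have hi := Matrix.nonsing_inv_mul Q hQ'
  have hi' := Matrix.mul_nonsing_inv Q hQ'
  -- With the flatness equation inserted, the curvature term is the squared norm of `[φ, φ^†]` in an
  -- orthonormal basis.
  have hC : (((Y * adj (Qᴴ * Q) Y - adj (Qᴴ * Q) Y * Y) * Y - Y * (Y * adj (Qᴴ * Q) Y -
      adj (Qᴴ * Q) Y * Y)) * adj (Qᴴ * Q) Y).trace =
      frob (Q * Y * Q⁻¹ * (Q * Y * Q⁻¹)ᴴ - (Q * Y * Q⁻¹)ᴴ * (Q * Y * Q⁻¹)) := by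
    rw [← trace_mul_conjTranspose_self]
    have h1 : Y = Q⁻¹ * (Q * Y * Q⁻¹) * Q := by
      rw [show Q⁻¹ * (Q * Y * Q⁻¹) * Q = (Q⁻¹ * Q) * Y * (Q⁻¹ * Q) by noncomm_ring, hi]; simp
    rw [(trace_mul_adj Q X Y).1]
    generalize Q * Y * Q⁻¹ = Z at h1
    subst h1
    have h2 : ∀ U V : Matrix (Fin N) (Fin N) ℂ, (Q⁻¹ * U * Q) * (Q⁻¹ * V * Q) =
        Q⁻¹ * (U * V) * Q := fun U V => by
      rw [show (Q⁻¹ * U * Q) * (Q⁻¹ * V * Q) = Q⁻¹ * U * (Q * Q⁻¹) * V * Q by noncomm_ring, hi']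
      noncomm_ring
    simp only [h2, ← mul_sub, ← sub_mul]
    rw [Matrix.trace_mul_cycle, hi', one_mul]
    simp only [conjTranspose_sub, conjTranspose_mul, conjTranspose_conjTranspose]
    generalize Zᴴ = W
    have h3 : ((Z * W - W * Z) * Z - Z * (Z * W - W * Z)) * W =
      (Z * W - W * Z) * (Z * W) - Z * ((Z * W - W * Z) * W) := by noncomm_ring
    rw [h3, trace_sub, Matrix.trace_mul_comm Z, mul_assoc, ← trace_sub, ← mul_sub]
  have hm' : (Q * Y * Q⁻¹) ^ m = 0 := by
    have h2 : ∀ k, (Q * Y * Q⁻¹) ^ k = Q * Y ^ k * Q⁻¹ := by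
      intro k
      induction k with
      | zero => rw [pow_zero, pow_zero, mul_one, hi']
      | succ k ih =>
        rw [pow_succ, ih, show Q * Y ^ k * Q⁻¹ * (Q * Y * Q⁻¹) = Q * Y ^ k * (Q⁻¹ * Q) * Y * Q⁻¹
          by noncomm_ring, hi, pow_succ]
        noncomm_ring
    rw [h2, hm, mul_zero, zero_mul]
  rw [hC, (trace_mul_adj Q X Y).2, (trace_mul_adj Q Y Y).2, (trace_mul_adj Q X X).2,
    trace_mul_conjTranspose_self, trace_mul_conjTranspose_self]
  -- Cauchy–Schwarz compares the squared first derivative with the norm of the covariant derivative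
  -- times that of `φ`; the commutator bound supplies the cubic term.
  have h1 := norm_trace_mul_conjTranspose_sq_le (Q * X * Q⁻¹) (Q * Y * Q⁻¹)
  have h2 := hκ _ hm'
  have h3 := frob_nonneg (Q * Y * Q⁻¹)
  rw [← Complex.ofReal_add, Complex.ofReal_re, Complex.ofReal_re, mul_add]
  have h4 := mul_le_mul_of_nonneg_left h2 h3
  nlinarith [h1, h4]

end Bochner

end TTStar
end

noncomputable section

namespace TTStar

open Filter Topology ComplexOrder

variable {r n : ℕ}

attribute [local instance] matNormedRing
attribute [local instance] matNormedAlgebra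

/-! ## The norm of the Higgs field -/

theorem eventually_of_mem_units {p : ℂ → Prop} {U : Set ℂˣ} (hU : IsOpen U) {t : ℂˣ} (ht : t ∈ U)
    (h : ∀ s ∈ U, p (s : ℂ)) : ∀ᶠ z in 𝓝 (t : ℂ), p z := by
  filter_upwards [(Units.isOpenEmbedding_val.isOpenMap U hU).mem_nhds
    (Set.mem_image_of_mem _ ht)] with z hz
  obtain ⟨s, hs, rfl⟩ := hz
  exact h s hs

theorem trace_adj_conj {h h' M M' P : Matrix (Fin r) (Fin r) ℂ} (hP : IsUnit P)
    (hh : h' = Pᴴ * h * P) (hM : M * P = P * M') :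
    (M' * adj h' M').trace = (M * adj h M).trace := by
  have hP' := (Matrix.isUnit_iff_isUnit_det _).1 hP
  have i1 := Matrix.nonsing_inv_mul P hP'
  have i2 := Matrix.mul_nonsing_inv P hP'
  have i3 : (P⁻¹)ᴴ * Pᴴ = 1 := by rw [← conjTranspose_mul, i2, conjTranspose_one]
  have hM' : M = P * M' * P⁻¹ := by rw [← hM, mul_assoc, i2, mul_one]
  subst hM'
  rw [hh, adj, adj, Matrix.mul_inv_rev, Matrix.mul_inv_rev]
  simp only [conjTranspose_mul, ← conjTranspose_nonsing_inv]
  have e1 : P * M' * P⁻¹ * (h⁻¹ * ((P⁻¹)ᴴ * (M'ᴴ * Pᴴ)) * h) =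
    P * (M' * P⁻¹ * h⁻¹ * (P⁻¹)ᴴ * M'ᴴ * Pᴴ * h) := by noncomm_ring
  rw [e1, Matrix.trace_mul_comm P]
  congr 1
  noncomm_ring

namespace Data

variable {S : Data r}

theorem gram_change (S : Data r) {e e' : Fin r → ∀ t, S.E t} {t : ℂˣ}
    {P : Matrix (Fin r) (Fin r) ℂ} (hP : ∀ j, e' j t = ∑ i, P i j • e i t) :
    S.gram e' t = Pᴴ * S.gram e t * P := by
  ext i j
  simp only [gram, Matrix.of_apply, hP, map_sum, LinearMap.sum_apply, map_smulₛₗ,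
    LinearMap.smul_apply, smul_eq_mul, RingHom.id_apply, Matrix.mul_apply, conjTranspose_apply,
    Finset.sum_mul, Finset.mul_sum]
  refine Finset.sum_congr rfl fun k _ => Finset.sum_congr rfl fun l _ => ?_
  rw [RCLike.star_def]
  ring

theorem matrix_change (S : Data r) {e e' : Fin r → ∀ t, S.E t} {t : ℂˣ}
    (he : LinearIndependent ℂ fun i => e i t) {M M' P : Matrix (Fin r) (Fin r) ℂ}
    (hM : ∀ j, S.Φ t 1 (e j t) = ∑ i, M i j • e i t)
    (hM' : ∀ j, S.Φ t 1 (e' j t) = ∑ i, M' i j • e' i t)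
    (hP : ∀ j, e' j t = ∑ i, P i j • e i t) : M * P = P * M' := by
  ext k j
  have h1 := hM' j
  simp only [hP, map_sum, map_smul, hM, Finset.smul_sum, smul_smul] at h1
  rw [Finset.sum_comm, Finset.sum_comm (f := fun x i => (M' x j * P i x) • e i t)] at h1
  simp only [← Finset.sum_smul] at h1
  have h2 := Fintype.linearIndependent_iff.1 he (fun k => ∑ x, P x j * M k x - ∑ x, M' x j * P k x)
    (by simp only [sub_smul, Finset.sum_sub_distrib, h1, sub_self]) k
  rw [Matrix.mul_apply, Matrix.mul_apply]
  simpa only [sub_eq_zero, mul_comm] using h2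

theorem exists_change (S : Data r) {e : Fin r → ∀ t, S.E t} {t : ℂˣ}
    (he : LinearIndependent ℂ fun i => e i t) (v : Fin r → S.E t) :
    ∃ P : Matrix (Fin r) (Fin r) ℂ, ∀ j, v j = ∑ i, P i j • e i t := by
  have := S.finiteDimensional t
  have hs := he.span_eq_top_of_card_eq_finrank' (by rw [S.finrank_eq, Fintype.card_fin])
  have h1 : ∀ j, ∃ a : Fin r → ℂ, ∑ i, a i • e i t = v j := fun j =>
    (Submodule.mem_span_range_iff_exists_fun ℂ).1 (by rw [hs]; trivial)
  choose a ha using h1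
  exact ⟨Matrix.of fun i j => a j i, fun j => (ha j).symm⟩

/-- `tr(φ φ^†)` does not depend on the basis. -/
theorem IsTTStar.trace_adj_eq (hS : S.IsTTStar) {e e' : Fin r → ∀ t, S.E t} {t : ℂˣ}
    (he : LinearIndependent ℂ fun i => e i t) (he' : LinearIndependent ℂ fun i => e' i t)
    {M M' : Matrix (Fin r) (Fin r) ℂ}
    (hM : ∀ j, S.Φ t 1 (e j t) = ∑ i, M i j • e i t)
    (hM' : ∀ j, S.Φ t 1 (e' j t) = ∑ i, M' i j • e' i t) :
    (M' * adj (S.gram e' t) M').trace = (M * adj (S.gram e t) M).trace := by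
  obtain ⟨P, hP⟩ := S.exists_change he fun j => e' j t
  have h1 := S.gram_change hP
  refine trace_adj_conj ?_ h1 (S.matrix_change he hM hM' hP)
  have h2 := (Matrix.isUnit_iff_isUnit_det _).1 (hS.gram_posDef he').isUnit
  rw [h1, det_mul] at h2
  exact (Matrix.isUnit_iff_isUnit_det _).2 (isUnit_of_mul_isUnit_right h2)

/-- The matrix of `Φ` in the frame of a local trivialization. -/
def trivΦ (S : Data r) (x t : ℂˣ) : Matrix (Fin r) (Fin r) ℂ :=
  Matrix.of fun i j => S.trivCoord x t (S.Φ t 1 (S.trivFrame x j t)) i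

theorem trivΦ_spec (S : Data r) (x : ℂˣ) {t : ℂˣ} (ht : t ∈ S.trivSet x) (j : Fin r) :
    S.Φ t 1 (S.trivFrame x j t) = ∑ i, S.trivΦ x t i j • S.trivFrame x i t :=
  S.sum_trivCoord x ht _

theorem IsTTStar.trivΦ_hol (hS : S.IsTTStar) (x : ℂˣ) {t : ℂˣ} (ht : t ∈ S.trivSet x) :
    ContDiffAt ℂ ω (onPlane (S.trivΦ x)) t := by
  rw [contDiffAt_matrix]
  intro i j
  simp_rw [onPlane_apply]
  refine holFunAt_iff.1 (S.holFunAt_trivCoord x ht ?_ i)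
  exact hS.holAt_Φ (S.isOpen_trivSet x) ht fun y hy =>
    (S.isHolFrame_trivFrame x).holAt (S.isOpen_trivSet x) hy j

/-- `tr(φ φ^†)`, the squared norm of `Φ`. -/
def normΦ (S : Data r) (t : ℂˣ) : ℂ :=
  (S.trivΦ t t * adj (S.gram (S.trivFrame t) t) (S.trivΦ t t)).trace

theorem IsTTStar.normΦ_eq (hS : S.IsTTStar) {e : Fin r → ∀ t, S.E t} {t : ℂˣ}
    (he : LinearIndependent ℂ fun i => e i t) {M : Matrix (Fin r) (Fin r) ℂ}
    (hM : ∀ j, S.Φ t 1 (e j t) = ∑ i, M i j • e i t) :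
    S.normΦ t = (M * adj (S.gram e t) M).trace :=
  hS.trace_adj_eq he ((S.isHolFrame_trivFrame t).linearIndependent (S.mem_trivSet t)) hM
    (S.trivΦ_spec t (S.mem_trivSet t))

theorem IsTTStar.onPlane_normΦ (hS : S.IsTTStar) (t : ℂˣ) :
    onPlane S.normΦ =ᶠ[𝓝 (t : ℂ)] fun z => (onPlane (S.trivΦ t) z *
      adj (onPlane (S.gram (S.trivFrame t)) z) (onPlane (S.trivΦ t) z)).trace := by
  refine eventually_of_mem_units (S.isOpen_trivSet t) (S.mem_trivSet t) fun s hs => ?_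
  simp only [onPlane_coe]
  exact hS.normΦ_eq ((S.isHolFrame_trivFrame t).linearIndependent hs) (S.trivΦ_spec t hs)

theorem IsTTStar.gram_smooth_triv (hS : S.IsTTStar) (x : ℂˣ) {t : ℂˣ} (ht : t ∈ S.trivSet x) :
    ContDiffAt ℝ ∞ (onPlane (S.gram (S.trivFrame x))) t :=
  hS.gram_smooth (S.isOpen_trivSet x) (S.isHolFrame_trivFrame x) ht

theorem IsTTStar.normΦ_smooth (hS : S.IsTTStar) (t : ℂˣ) :
    ContDiffAt ℝ ∞ (onPlane S.normΦ) t := by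
  refine ContDiffAt.congr_of_eventuallyEq ?_ (hS.onPlane_normΦ t)
  have h1 := ContDiffAt.toReal (hS.trivΦ_hol t (S.mem_trivSet t))
  have h2 := hS.gram_smooth_triv t (S.mem_trivSet t)
  have h3 : IsUnit (onPlane (S.gram (S.trivFrame t)) t) := by
    rw [onPlane_coe]
    exact (hS.gram_posDef
      ((S.isHolFrame_trivFrame t).linearIndependent (S.mem_trivSet t))).isUnit
  exact (traceCLM.contDiff.restrict_scalars ℝ).contDiffAt.comp (t : ℂ)
    (h1.mul (contDiffAt_adj h2 h3 h1))

theorem IsTTStar.normΦ_pos (hS : S.IsTTStar) {t : ℂˣ} (ht : S.Φ t ≠ 0) :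
    ∃ a : ℝ, 0 < a ∧ S.normΦ t = a := by
  have he := (S.isHolFrame_trivFrame t).linearIndependent (S.mem_trivSet t)
  obtain ⟨Q, hQ, hQ'⟩ := exists_conjTranspose_mul_self (hS.gram_posDef he)
  have hd := (Matrix.isUnit_iff_isUnit_det _).1 hQ
  refine ⟨frob (Q * S.trivΦ t t * Q⁻¹), lt_of_le_of_ne (frob_nonneg _) fun h0 => ht ?_, ?_⟩
  · have h1 := frob_eq_zero.1 h0.symm
    have h2 : S.trivΦ t t = 0 := by
      have h3 : Q⁻¹ * (Q * S.trivΦ t t * Q⁻¹) * Q = 0 := by rw [h1]; simp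
      rwa [show Q⁻¹ * (Q * S.trivΦ t t * Q⁻¹) * Q = (Q⁻¹ * Q) * S.trivΦ t t * (Q⁻¹ * Q) by
        noncomm_ring, Matrix.nonsing_inv_mul Q hd, one_mul, mul_one] at h3
    have h3 : S.Φ t 1 = 0 := by
      ext v
      rw [S.sum_trivCoord t (S.mem_trivSet t) v]
      simp [S.trivΦ_spec t (S.mem_trivSet t), h2]
    ext
    simp [h3]
  · rw [normΦ, hQ', (trace_mul_adj Q _ _).2, trace_mul_conjTranspose_self]

theorem IsTTStar.normΦ_bochner (hS : S.IsTTStar) {m : ℕ} {t : ℂˣ}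
    (hΦ : ∀ v, ((S.Φ t 1 : Module.End ℂ (S.E t)) ^ m) v = 0) {κ : ℝ}
    (hκ : ∀ X : Matrix (Fin r) (Fin r) ℂ, X ^ m = 0 →
      κ * frob X ^ 2 ≤ frob (X * Xᴴ - Xᴴ * X)) :
    ‖wirt (-1) (onPlane S.normΦ) t‖ ^ 2 + κ * (S.normΦ t).re ^ 3 ≤
      (S.normΦ t).re * (wirt 1 (wirt (-1) (onPlane S.normΦ)) t).re := by
  have hU := S.isOpen_trivSet t
  have ht := S.mem_trivSet t
  have hfr := S.isHolFrame_trivFrame t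
  have hm : ∀ k, ∀ j, ((S.Φ t 1 : Module.End ℂ (S.E t)) ^ k) (S.trivFrame t j t) =
      ∑ i, (S.trivΦ t t ^ k) i j • S.trivFrame t i t := by
    intro k
    induction k with
    | zero => intro j; simp [Matrix.one_apply, ite_smul]
    | succ k ih =>
      intro j
      rw [pow_succ, Module.End.mul_apply, S.trivΦ_spec t ht, map_sum]
      simp only [map_smul, ih, Finset.smul_sum, smul_smul]
      rw [Finset.sum_comm]
      simp only [← Finset.sum_smul, pow_succ, Matrix.mul_apply, mul_comm]
  have hm0 : S.trivΦ t t ^ m = 0 := by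
    ext i j
    have h1 := hm m j
    rw [hΦ] at h1
    exact Fintype.linearIndependent_iff.1 (hfr.linearIndependent ht) _ h1.symm i
  have h1 := bochner (h := onPlane (S.gram (S.trivFrame t))) (φ := onPlane (S.trivΦ t)) (z := t)
    (eventually_of_mem_units hU ht fun s hs => hS.gram_smooth_triv t hs)
    (eventually_of_mem_units hU ht fun s hs => by
      rw [onPlane_coe]; exact hS.gram_posDef (hfr.linearIndependent hs))
    (eventually_of_mem_units hU ht fun s hs => hS.trivΦ_hol t hs)
    (by
      rw [onPlane_coe, onPlane_coe]
      exact hS.hitchin hU hfr (fun s hs => S.trivΦ_spec t hs) ht (hS.trivΦ_hol t ht))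
    hκ (by rw [onPlane_coe]; exact hm0)
  have h2 := hS.onPlane_normΦ t
  rw [wirt_congr h2, wirt_congr (wirt_eventuallyEq h2)]
  have h3 := h2.self_of_nhds
  rw [onPlane_coe] at h3
  rw [h3]
  exact h1

/-- The map `T` carries a basis of `E_{ut}` to a basis of `E_t` with the same Gram matrix and the
same matrix of `Φ`, and the norm does not depend on the basis. -/
theorem IsTTStar.normΦ_rho {S : Data (n + 1)} (hS : S.IsTTStar) {u : ℂˣ}
    (T : Data.Iso (S.rho u) S) (t : ℂˣ) : S.normΦ (u * t) = S.normΦ t := by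
  have ht := S.mem_trivSet (u * t)
  have he := (S.isHolFrame_trivFrame (u * t)).linearIndependent ht
  set e : Fin (n + 1) → ∀ t, S.E t := S.trivFrame (u * t) with hedef
  set e' : Fin (n + 1) → ∀ x, S.E x := fun i x => T.map x (e i (u * x) : S.E (u * x)) with he'
  have h1 : S.gram e' t = S.gram e (u * t) := by
    ext i j
    exact (T.map_g t _ _).symm
  have h2 : LinearIndependent ℂ fun i => e' i t :=
    LinearIndependent.map' (M := (S.rho u).E t) (v := fun i => e i (u * t)) he
      ((T.map t : (S.rho u).E t →ₗ[ℂ] S.E t)) (LinearEquiv.ker _)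
  have h3 : ∀ j, S.Φ t 1 (e' j t) = ∑ i, S.trivΦ (u * t) (u * t) i j • e' i t := by
    intro j
    have h4 := T.map_Φ t 1 (e j (u * t))
    refine h4.symm.trans ((congrArg (T.map t) ((S.rho_Φ_one u t (e j (u * t))).trans
      (S.trivΦ_spec (u * t) ht j))).trans ?_)
    refine (map_sum (T.map t) _ _).trans ?_
    exact Finset.sum_congr rfl fun i _ => map_smul (T.map t) _ _
  rw [hS.normΦ_eq h2 h3, h1]
  rfl

end Data

theorem wirt_ofReal_re {ε : ℝ} {g : ℝ → ℝ} {z : ℂ} (hg : DifferentiableAt ℝ g z.re) :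
    wirt ε (fun z : ℂ => ((g z.re : ℝ) : ℂ)) z = ((deriv g z.re / 2 : ℝ) : ℂ) := by
  have h1 : HasFDerivAt (fun z : ℂ => ((g z.re : ℝ) : ℂ))
      (Complex.ofRealCLM.comp ((ContinuousLinearMap.toSpanSingleton ℝ (deriv g z.re)).comp
        Complex.reCLM)) z :=
    Complex.ofRealCLM.hasFDerivAt.comp z
      (HasFDerivAt.comp z (g := g) hg.hasDerivAt.hasFDerivAt Complex.reCLM.hasFDerivAt)
  simp only [wirt, h1.fderiv]
  simp
  ring

/-- A fixed point with nowhere vanishing `Φ` is not nilpotent. -/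
theorem Data.IsTTStar.not_nilpotent {S : Data (n + 1)} (hS : S.IsTTStar) (hne : S.NonVanishing)
    (hρ : S.IsRhoFixed)
    (hΦ : ∀ t v, ((S.Φ t 1 : Module.End ℂ (S.E t)) ^ (n + 1)) v = 0) : False := by
  obtain ⟨κ, hκ, hκ'⟩ := exists_commutator_bound (n + 1) (n + 1)
  set E : ℂ → ℂˣ := fun z => Units.mk0 _ (Complex.exp_ne_zero z) with hE
  have hEv : ∀ z, ((E z : ℂˣ) : ℂ) = Complex.exp z := fun z => rfl
  -- In the coordinate `z = log t` the norm depends only on `s = Re z`, so the Bochner inequality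
  -- becomes an ordinary differential inequality.
  set g : ℝ → ℝ := fun s => (S.normΦ (E s)).re with hg
  have hpos : ∀ t, S.normΦ t = ((S.normΦ t).re : ℂ) ∧ 0 < (S.normΦ t).re := fun t => by
    obtain ⟨a, ha, ha'⟩ := hS.normΦ_pos (hne t)
    rw [ha']
    exact ⟨rfl, ha⟩
  have hG : (fun z => onPlane S.normΦ (Complex.exp z)) = fun z : ℂ => ((g z.re : ℝ) : ℂ) := by
    funext z
    obtain ⟨T, -⟩ := hρ
    have h1 : E z = Circle.toUnits (Circle.exp z.im) * E z.re := by
      ext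
      rw [Units.val_mul, hEv, hEv]
      conv_lhs => rw [← Complex.re_add_im z, Complex.exp_add, mul_comm]
      rfl
    rw [← hEv, onPlane_coe, h1, hS.normΦ_rho (T _), hg]
    exact (hpos _).1
  have hGs : ContDiff ℝ ∞ fun z => onPlane S.normΦ (Complex.exp z) :=
    contDiff_iff_contDiffAt.2 fun z => ContDiffAt.comp z (hS.normΦ_smooth (E z))
      (Complex.contDiff_exp (𝕜 := ℝ)).contDiffAt
  have hgs : ContDiff ℝ ∞ g := by
    have h1 : g = fun s : ℝ => Complex.reCLM (onPlane S.normΦ (Complex.exp (Complex.ofRealCLM s))) := by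
      funext s
      have := congrFun hG s
      simp only [Complex.ofReal_re] at this
      rw [Complex.ofRealCLM_apply, this, Complex.reCLM_apply, Complex.ofReal_re]
    rw [h1]
    exact Complex.reCLM.contDiff.comp (hGs.comp Complex.ofRealCLM.contDiff)
  have hgd : ∀ s, DifferentiableAt ℝ g s := fun s => hgs.contDiffAt.differentiableAt (by simp)
  have hgd' : ∀ s, DifferentiableAt ℝ (deriv g) s := fun s =>
    ((contDiff_infty_iff_deriv.1 hgs).2.contDiffAt).differentiableAt (by simp)
  have hw1 : ∀ z : ℂ, Complex.exp z * wirt (-1) (onPlane S.normΦ) (Complex.exp z) =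
      ((deriv g z.re / 2 : ℝ) : ℂ) := by
    intro z
    have h1 := wirt_comp_hol (ε := -1) (f := onPlane S.normΦ) (Or.inl rfl)
      ((hS.normΦ_smooth (E z)).differentiableAt (by simp)) (Complex.hasDerivAt_exp z)
    rw [if_pos rfl, smul_eq_mul] at h1
    rw [← h1, hG, wirt_ofReal_re (hgd _)]
  have hw2 : ∀ z : ℂ, Complex.exp z * (starRingEnd ℂ (Complex.exp z) *
      wirt 1 (wirt (-1) (onPlane S.normΦ)) (Complex.exp z)) =
      ((deriv (deriv g) z.re / 4 : ℝ) : ℂ) := by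
    intro z
    have d1 : DifferentiableAt ℝ (wirt (-1) (onPlane S.normΦ)) (Complex.exp z) :=
      (contDiffAt_wirt (hS.normΦ_smooth (E z))).differentiableAt (by simp)
    have h1 := wirt_comp_hol (ε := 1) (Or.inr rfl) d1 (Complex.hasDerivAt_exp z)
    rw [if_neg (by norm_num), smul_eq_mul] at h1
    have d2 : DifferentiableAt ℝ (fun x => wirt (-1) (onPlane S.normΦ) (Complex.exp x)) z :=
      DifferentiableAt.comp (g := wirt (-1) (onPlane S.normΦ)) z d1 ((Complex.differentiable_exp (𝕜 := ℂ)).restrictScalars ℝ).differentiableAt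
    have h2 := wirt_mul (ε := 1) (f := Complex.exp)
      ((Complex.differentiable_exp (𝕜 := ℂ)).restrictScalars ℝ).differentiableAt d2
    rw [wirt_one_of_differentiableAt Complex.differentiable_exp.differentiableAt, zero_mul,
      zero_add, h1] at h2
    rw [← h2]
    simp only [hw1]
    rw [wirt_ofReal_re (g := fun s => deriv g s / 2) ((hgd' _).div_const 2)]
    congr 1
    rw [deriv_div_const]
    ring
  -- On functions of `s` one has `∂_z = ½ d/ds` and `∂_z ∂̄_z = ¼ d²/ds²`, hence the factor `4`; the
  -- factor `e^{2s} = |dt/dz|²` comes from the change of coordinate.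
  have key : ∀ s, (deriv g s) ^ 2 + 4 * κ * Real.exp s ^ 2 * g s ^ 3 ≤ g s * deriv (deriv g) s := by
    intro s
    have h1 := hS.normΦ_bochner (hΦ (E s)) hκ'
    have h2 := congrArg (fun x => ‖x‖ ^ 2) (hw1 s)
    have h3 := congrArg Complex.re (hw2 s)
    have hs : Complex.exp s = ((Real.exp s : ℝ) : ℂ) := (Complex.ofReal_exp s).symm
    rw [hEv, hs] at h1
    rw [hs] at h3
    simp only [hs, norm_mul, Complex.norm_real, Real.norm_eq_abs, mul_pow, sq_abs,
      Complex.ofReal_re] at h2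
    rw [Complex.conj_ofReal, Complex.re_ofReal_mul, Complex.re_ofReal_mul, Complex.ofReal_re,
      Complex.ofReal_re] at h3
    have h4 := mul_le_mul_of_nonneg_left h1 (sq_nonneg (Real.exp s))
    change Real.exp s ^ 2 * (_ + κ * g s ^ 3) ≤ Real.exp s ^ 2 * (g s * _) at h4
    linear_combination 4 * h4 - 4 * h2 + 4 * g s * h3
  -- The linear term `2s` does not change the second derivative and absorbs `e^{2s}`, so that `v'' ≥
  -- 4κ e^{2s} g = 4κ e^v`.
  refine not_second_deriv_ge_exp (v := fun s => Real.log (g s) + 2 * s)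
    (v' := fun s => deriv g s / g s + 2 * 1)
    (v'' := fun s => (deriv (deriv g) s * g s - deriv g s * deriv g s) / g s ^ 2)
    (C := 4 * κ) (by positivity) (fun s => ?_) (fun s => ?_) fun s => ?_
  · exact ((hgd s).hasDerivAt.log (hpos _).2.ne').add ((hasDerivAt_id s).const_mul 2)
  · exact ((hgd' s).hasDerivAt.div (hgd s).hasDerivAt (hpos _).2.ne').add_const _
  · have hgp : 0 < g s := (hpos _).2
    rw [le_div_iff₀ (by positivity), Real.exp_add, Real.exp_log hgp, two_mul s, Real.exp_add]
    nlinarith [key s]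

end TTStar
end

noncomputable section

namespace TTStar

open Filter Topology

variable {n : ℕ}

/-! ## Cyclic symmetry -/

/-- `A` is a cyclic symmetry of the tt*-structure `S`, for which `Φ^{n+1} = c^{n+1} ≠ 0`. -/
structure CyclicSymmetry (S : Data (n + 1)) (c : ℂ) (A : ∀ t, S.E t →ₗ[ℂ] S.E t) : Prop where
  isTTStar : S.IsTTStar
  ne_zero : c ≠ 0
  hol : ∀ s t, S.HolAt s t → S.HolAt (fun x => A x (s x)) t
  η : ∀ t a b, S.η t (A t a) (A t b) = S.η t a b
  g : ∀ t a b, S.g t (A t a) (A t b) = S.g t a b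
  Φ : ∀ t a, S.Φ t 1 (A t a) = (rootω n)⁻¹ • A t (S.Φ t 1 a)
  pow : ∀ t v, ((S.Φ t 1 : Module.End ℂ (S.E t)) ^ (n + 1)) v = c ^ (n + 1) • v

/-- Eigenvectors of `Φ` for the eigenvalue `c`, of unit length with respect to `η`. -/
def Data.IsUnitEigen (S : Data (n + 1)) (c : ℂ) (t : ℂˣ) (v : S.E t) : Prop :=
  S.Φ t 1 v = c • v ∧ S.η t v v = 1

namespace CyclicSymmetry

variable {S : Data (n + 1)} {c : ℂ} {A : ∀ t, S.E t →ₗ[ℂ] S.E t}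

/-- The iterates of a cyclic symmetry. -/
def iter (A : ∀ t, S.E t →ₗ[ℂ] S.E t) (j : ℕ) (t : ℂˣ) (v : S.E t) : S.E t :=
  ((A t : Module.End ℂ (S.E t)) ^ j) v

theorem iter_zero (t : ℂˣ) (v : S.E t) : iter A 0 t v = v := rfl

theorem iter_succ (j : ℕ) (t : ℂˣ) (v : S.E t) : iter A (j + 1) t v = A t (iter A j t v) := by
  rw [iter, pow_succ']; rfl

theorem injective (h : CyclicSymmetry S c A) (t : ℂˣ) {v : S.E t} (hv : A t v = 0) : v = 0 := by
  refine h.isTTStar.η_nondeg t v fun b => ?_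
  rw [← h.η, hv, map_zero, LinearMap.zero_apply]

theorem iter_ne_zero (h : CyclicSymmetry S c A) (t : ℂˣ) {v : S.E t} (hv : v ≠ 0) (j : ℕ) :
    iter A j t v ≠ 0 := by
  induction j with
  | zero => exact hv
  | succ j ih => rw [iter_succ]; exact fun h0 => ih (h.injective t h0)

theorem iter_η (h : CyclicSymmetry S c A) (t : ℂˣ) (v w : S.E t) (j : ℕ) :
    S.η t (iter A j t v) (iter A j t w) = S.η t v w := by
  induction j with
  | zero => rfl
  | succ j ih => rw [iter_succ, iter_succ, h.η, ih]

theorem iter_hol (h : CyclicSymmetry S c A) {s : ∀ t, S.E t} {t : ℂˣ} (hs : S.HolAt s t) (j : ℕ) :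
    S.HolAt (fun x => iter A j x (s x)) t := by
  induction j with
  | zero => exact hs
  | succ j ih =>
    simp only [iter_succ]
    exact h.hol (fun x => iter A j x (s x)) t ih

theorem Φ_iter (h : CyclicSymmetry S c A) (t : ℂˣ) {v : S.E t} {μ : ℂ} (hv : S.Φ t 1 v = μ • v)
    (j : ℕ) : S.Φ t 1 (iter A j t v) = ((rootω n)⁻¹ ^ j * μ) • iter A j t v := by
  induction j with
  | zero => rw [iter_zero, hv, pow_zero, one_mul]
  | succ j ih => rw [iter_succ, h.Φ, ih, map_smul, smul_smul, pow_succ', mul_assoc]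

/-- Eigenvectors of an `η`-self-adjoint operator for different eigenvalues are `η`-orthogonal. -/
theorem η_eq_zero (h : CyclicSymmetry S c A) (t : ℂˣ) {v w : S.E t} {μ ν : ℂ}
    (hv : S.Φ t 1 v = μ • v) (hw : S.Φ t 1 w = ν • w) (hμ : μ ≠ ν) : S.η t v w = 0 := by
  have h1 := h.isTTStar.Φ_selfAdj t 1 v w
  rw [hv, hw, map_smul, map_smul, LinearMap.smul_apply, smul_eq_mul, smul_eq_mul] at h1
  have h2 : (μ - ν) * S.η t v w = 0 := by rw [sub_mul, h1, sub_self]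
  exact (mul_eq_zero.1 h2).resolve_left (sub_ne_zero.2 hμ)

theorem rootω_inv_pow_inj {i j : ℕ} (hi : i < n + 1) (hj : j < n + 1)
    (h : (rootω n)⁻¹ ^ i = (rootω n)⁻¹ ^ j) : i = j := by
  have : IsPrimitiveRoot (rootω n)⁻¹ (n + 1) := (rootω_primitive n).inv
  exact this.pow_inj hi hj h

theorem η_iter (h : CyclicSymmetry S c A) (t : ℂˣ) {v w : S.E t} (hv : S.Φ t 1 v = c • v)
    (hw : S.Φ t 1 w = c • w) {i j : ℕ} (hi : i < n + 1) (hj : j < n + 1) :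
    S.η t (iter A i t v) (iter A j t w) = if i = j then S.η t v w else 0 := by
  split_ifs with hij
  · rw [hij, h.iter_η]
  · refine h.η_eq_zero t (h.Φ_iter t hv i) (h.Φ_iter t hw j) fun h0 => hij ?_
    exact rootω_inv_pow_inj hi hj (mul_right_cancel₀ h.ne_zero h0)

/-- Every eigenvalue is `ω^j c` for some `j`, because its `(n+1)`-st power is `c^{n+1}`. Applying
`A` multiplies the eigenvalue by `ω⁻¹`, so `A^j` brings it to `c`. -/
theorem exists_eigenvector (h : CyclicSymmetry S c A) (t : ℂˣ) :
    ∃ v : S.E t, v ≠ 0 ∧ S.Φ t 1 v = c • v := by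
  have := S.finiteDimensional t
  have : Nontrivial (S.E t) := Module.nontrivial_of_finrank_pos (R := ℂ)
    (by rw [S.finrank_eq]; omega)
  obtain ⟨μ, hμ⟩ := Module.End.exists_eigenvalue (S.Φ t 1 : Module.End ℂ (S.E t))
  obtain ⟨v, hv⟩ := hμ.exists_hasEigenvector
  have h1 := hv.pow_apply (n + 1)
  rw [h.pow] at h1
  have h2 := smul_left_injective ℂ hv.2 h1
  have h3 : (μ / c) ^ (n + 1) = 1 := by
    rw [div_pow, ← h2, div_self (pow_ne_zero _ h.ne_zero)]
  obtain ⟨j, -, hj⟩ := (rootω_primitive n).eq_pow_of_pow_eq_one h3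
  refine ⟨iter A j t v, h.iter_ne_zero t hv.2 j, ?_⟩
  rw [h.Φ_iter t hv.apply_eq_smul, inv_pow, hj]
  congr 1
  have : μ ≠ 0 := by
    rintro rfl
    simp at h3
  have := h.ne_zero
  field_simp

theorem span_iter (h : CyclicSymmetry S c A) (t : ℂˣ) {v : S.E t} (hv0 : v ≠ 0)
    (hv : S.Φ t 1 v = c • v) :
    Submodule.span ℂ (Set.range fun j : Fin (n + 1) => iter A j t v) = ⊤ := by
  have := S.finiteDimensional t
  have h1 : LinearIndependent ℂ fun j : Fin (n + 1) => iter A j t v := by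
    refine Module.End.eigenvectors_linearIndependent' (S.Φ t 1 : Module.End ℂ (S.E t))
      (fun j : Fin (n + 1) => (rootω n)⁻¹ ^ (j : ℕ) * c) (fun i j hij => ?_) _ fun j =>
      ⟨Module.End.mem_eigenspace_iff.2 (h.Φ_iter t hv j), h.iter_ne_zero t hv0 j⟩
    exact Fin.ext (rootω_inv_pow_inj i.2 j.2 (mul_right_cancel₀ h.ne_zero hij))
  exact h1.span_eq_top_of_card_eq_finrank' (by rw [S.finrank_eq, Fintype.card_fin])

/-- The vectors `A^j v` span the fibre, and `w` is orthogonal to those with `j ≠ 0` because the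
eigenvalues differ. It follows that the `c`-eigenspace is a line on which `η` does not vanish. -/
theorem eq_zero_of_η (h : CyclicSymmetry S c A) (t : ℂˣ) {v w : S.E t} (hv0 : v ≠ 0)
    (hv : S.Φ t 1 v = c • v) (hw : S.Φ t 1 w = c • w) (hwv : S.η t w v = 0) : w = 0 := by
  refine h.isTTStar.η_nondeg t w fun b => ?_
  have hb : b ∈ Submodule.span ℂ (Set.range fun j : Fin (n + 1) => iter A j t v) := by
    rw [h.span_iter t hv0 hv]; trivial
  induction hb using Submodule.span_induction with
  | mem x hx =>
    obtain ⟨j, rfl⟩ := hx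
    have h1 := h.η_iter t hw hv (i := 0) (j := j) (by omega) j.2
    rw [iter_zero, hwv] at h1
    simpa using h1
  | zero => rw [map_zero]
  | add x y _ _ hx hy => rw [map_add, hx, hy, add_zero]
  | smul a x _ hx => rw [map_smul, hx, smul_zero]

theorem exists_isUnitEigen (h : CyclicSymmetry S c A) (t : ℂˣ) :
    ∃ v : S.E t, S.IsUnitEigen c t v := by
  obtain ⟨v, hv0, hv⟩ := h.exists_eigenvector t
  have h1 : S.η t v v ≠ 0 := fun h0 => hv0 (h.eq_zero_of_η t hv0 hv hv h0)
  obtain ⟨a, ha⟩ := IsAlgClosed.exists_pow_nat_eq (S.η t v v) (n := 2) (by norm_num)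
  have ha0 : a ≠ 0 := by rintro rfl; apply h1; rw [← ha]; simp
  refine ⟨a⁻¹ • v, by rw [map_smul, hv, smul_comm], ?_⟩
  rw [map_smul, map_smul, LinearMap.smul_apply, ← ha, smul_eq_mul, smul_eq_mul]
  field_simp

theorem eq_smul (h : CyclicSymmetry S c A) (t : ℂˣ) {v w : S.E t} (hv : S.IsUnitEigen c t v)
    (hw : S.Φ t 1 w = c • w) : w = S.η t w v • v := by
  have hv0 : v ≠ 0 := by
    rintro rfl
    simpa using hv.2
  refine sub_eq_zero.1 (h.eq_zero_of_η t hv0 hv.1 ?_ ?_)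
  · rw [map_sub, map_smul, hw, hv.1, smul_sub, smul_comm]
  · rw [map_sub, map_smul, LinearMap.sub_apply, LinearMap.smul_apply, hv.2, smul_eq_mul, mul_one,
      sub_self]

theorem η_eq_or (h : CyclicSymmetry S c A) (t : ℂˣ) {v w : S.E t} (hv : S.IsUnitEigen c t v)
    (hw : S.IsUnitEigen c t w) : S.η t w v = 1 ∨ S.η t w v = -1 := by
  have h1 := hw.2
  rw [h.eq_smul t hv hw.1] at h1
  simp only [map_smul, LinearMap.smul_apply, hv.2, smul_eq_mul, mul_one] at h1
  exact mul_self_eq_one_iff.1 h1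

theorem neg_isUnitEigen {t : ℂˣ} {v : S.E t} (hv : S.IsUnitEigen c t v) :
    S.IsUnitEigen c t (-v) :=
  ⟨by rw [map_neg, hv.1, smul_neg], by simp [hv.2]⟩

/-- Unit eigenvectors extend locally to holomorphic sections. -/
theorem exists_local_section (h : CyclicSymmetry S c A) (x : ℂˣ) :
    ∃ U : Set ℂˣ, IsOpen U ∧ x ∈ U ∧ ∃ σ : ∀ t, S.E t,
      ∀ t ∈ U, S.HolAt σ t ∧ S.IsUnitEigen c t (σ t) := by
  obtain ⟨v, hv⟩ := h.exists_isUnitEigen x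
  have hc := h.ne_zero
  have hN : ((n + 1 : ℕ) : ℂ) ≠ 0 := by exact_mod_cast n.succ_ne_zero
  set s : ∀ t, S.E t := fun t => ∑ i, S.trivCoord x x v i • S.trivFrame x i t with hs
  have hsx : s x = v := (S.sum_trivCoord x (S.mem_trivSet x) v).symm
  have hshol : ∀ t ∈ S.trivSet x, S.HolAt s t := fun t ht =>
    HolBundle.HolAt.sum fun i _ => HolBundle.HolAt.const_smul _
      ((S.isHolFrame_trivFrame x).holAt (S.isOpen_trivSet x) ht i)
  -- The average of `c^{-k} Φ^k` projects onto the `c`-eigenspace because `Φ^{n+1} = c^{n+1}`. Being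
  -- a polynomial in `Φ`, it preserves holomorphy, and it fixes `v`.
  set σ : ∀ t, S.E t := fun t => ((n + 1 : ℕ) : ℂ)⁻¹ • ∑ k ∈ Finset.range (n + 1),
    (c⁻¹) ^ k • ((S.Φ t 1 : Module.End ℂ (S.E t)) ^ k) (s t) with hσ
  have hσhol : ∀ t ∈ S.trivSet x, S.HolAt σ t := fun t ht =>
    HolBundle.HolAt.const_smul _ (HolBundle.HolAt.sum fun k _ => HolBundle.HolAt.const_smul _
      (h.isTTStar.holAt_Φ_pow (S.isOpen_trivSet x) hshol k t ht))
  have hσx : σ x = v := by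
    have h1 : ∀ k, ((S.Φ x 1 : Module.End ℂ (S.E x)) ^ k) v = c ^ k • v := by
      intro k
      induction k with
      | zero => simp
      | succ k ih => rw [pow_succ', Module.End.mul_apply, ih, map_smul, hv.1, smul_smul, pow_succ]
    simp only [hσ, hsx, h1, smul_smul, ← mul_pow, inv_mul_cancel₀ hc, one_pow, one_smul,
      Finset.sum_const, Finset.card_range]
    rw [← Nat.cast_smul_eq_nsmul ℂ, smul_smul, inv_mul_cancel₀ hN, one_smul]
  have hσΦ : ∀ t, S.Φ t 1 (σ t) = c • σ t := by
    intro t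
    simp only [hσ, map_smul, map_sum]
    rw [smul_comm c]
    congr 1
    have h1 := Finset.sum_range_succ' (fun k => (c⁻¹) ^ k •
      ((S.Φ t 1 : Module.End ℂ (S.E t)) ^ k) (s t)) (n + 1)
    rw [Finset.sum_range_succ] at h1
    rw [h.pow, smul_smul, ← mul_pow, inv_mul_cancel₀ hc, one_pow, one_smul, pow_zero, one_smul,
      pow_zero, Module.End.one_apply] at h1
    rw [add_right_cancel h1, Finset.smul_sum]
    refine Finset.sum_congr rfl fun k _ => ?_
    rw [smul_smul, pow_succ' (c⁻¹), ← mul_assoc, mul_inv_cancel₀ hc, one_mul, pow_succ',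
      Module.End.mul_apply]
  clear_value σ
  set f : ℂˣ → ℂ := fun t => S.η t (σ t) (σ t) with hf
  have hfhol : ∀ t ∈ S.trivSet x, HolFunAt f t := fun t ht =>
    h.isTTStar.holFunAt_η (S.isOpen_trivSet x) ht hσhol hσhol
  have hfx : f x = 1 := by simp only [hf, hσx, hv.2]
  -- Since `f x = 1`, near `x` the values of `f` avoid the branch cut, and `exp(-log f / 2)`
  -- normalises the section holomorphically.
  have hU : ∀ᶠ t in 𝓝 x, t ∈ S.trivSet x ∧ f t ∈ Complex.slitPlane :=
    ((S.isOpen_trivSet x).eventually_mem (S.mem_trivSet x)).and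
      ((hfhol x (S.mem_trivSet x)).continuousAt.eventually_mem
        (Complex.isOpen_slitPlane.mem_nhds (by rw [hfx]; exact Complex.one_mem_slitPlane)))
  obtain ⟨U, hU1, hU2, hU3⟩ := eventually_nhds_iff.1 hU
  refine ⟨U, hU2, hU3, fun t => Complex.exp (-(Complex.log (f t) / 2)) • σ t, fun t ht => ?_⟩
  obtain ⟨h1, h2⟩ := hU1 t ht
  refine ⟨HolBundle.HolAt.smul ?_ (hσhol t h1), ?_, ?_⟩
  · have h3 : ContDiffAt ℂ ω (fun w : ℂ => Complex.exp (-(Complex.log w / 2))) (f t) :=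
      (((Complex.contDiffAt_log h2).div_const 2).neg).cexp
    exact ContMDiffAt.comp (g := fun w : ℂ => Complex.exp (-(Complex.log w / 2))) t
      (contMDiffAt_iff_contDiffAt.2 h3) (hfhol t h1)
  · rw [map_smul, hσΦ, smul_comm]
  · simp only [map_smul, LinearMap.smul_apply, smul_eq_mul]
    change _ * (_ * f t) = 1
    rw [← mul_assoc, ← Complex.exp_add]
    conv_lhs => rw [← Complex.exp_log (Complex.slitPlane_ne_zero h2)]
    rw [Complex.log_exp (Complex.neg_pi_lt_log_im _) (Complex.log_im_le_pi _), ← Complex.exp_add]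
    ring_nf
    exact Complex.exp_zero

end CyclicSymmetry

end TTStar
end

noncomputable section

namespace TTStar

open Filter Topology

variable {n : ℕ}

/-! ## Global unit eigensections -/

/-- The exponential map `ℂ → ℂ*`. -/
def expUnits : C(ℂ, ℂˣ) where
  toFun z := Units.mk0 _ (Complex.exp_ne_zero z)
  continuous_toFun := Units.isOpenEmbedding_val.isInducing.continuous_iff.2 Complex.continuous_exp

theorem expUnits_val (z : ℂ) : ((expUnits z : ℂˣ) : ℂ) = Complex.exp z := rfl

/-- The space of unit eigenvectors, a double cover of `ℂ*`. -/
abbrev UnitSpace (S : Data (n + 1)) (c : ℂ) : Type :=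
  {p : TotalSpace (Fin (n + 1) → ℂ) S.E // S.IsUnitEigen c p.1 p.2}

/-- The projection of the double cover of unit eigenvectors. -/
def unitProj (S : Data (n + 1)) (c : ℂ) (p : UnitSpace S c) : ℂˣ := p.1.1

theorem continuous_unitProj (S : Data (n + 1)) (c : ℂ) : Continuous (unitProj S c) :=
  (FiberBundle.continuous_proj (Fin (n + 1) → ℂ) S.E).comp continuous_subtype_val

theorem Data.IsTTStar.continuousAt_η {S : Data (n + 1)} (hS : S.IsTTStar) {U : Set ℂˣ}
    (hU : IsOpen U) {σ : ∀ t, S.E t} (hσ : ∀ t ∈ U, S.HolAt σ t)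
    {p : TotalSpace (Fin (n + 1) → ℂ) S.E} (hp : p.1 ∈ U) :
    ContinuousAt (fun q : TotalSpace (Fin (n + 1) → ℂ) S.E => S.η q.1 q.2 (σ q.1)) p := by
  have hproj : ContinuousAt (fun q : TotalSpace (Fin (n + 1) → ℂ) S.E => q.1) p :=
    (FiberBundle.continuous_proj (Fin (n + 1) → ℂ) S.E).continuousAt
  have h1 : ∀ i, ContinuousAt (fun q : TotalSpace (Fin (n + 1) → ℂ) S.E =>
      S.trivCoord p.1 q.1 q.2 i) p := by
    intro i
    have h2 : ContinuousAt (fun q : TotalSpace (Fin (n + 1) → ℂ) S.E =>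
        (trivializationAt (Fin (n + 1) → ℂ) S.E p.1 q).2) p :=
      continuous_snd.continuousAt.comp
        ((trivializationAt (Fin (n + 1) → ℂ) S.E p.1).continuousAt
          (by rw [Trivialization.mem_source]; exact S.mem_trivSet p.1))
    exact (continuous_apply i).continuousAt.comp h2
  have h2 : ∀ i, ContinuousAt (fun q : TotalSpace (Fin (n + 1) → ℂ) S.E =>
      S.η q.1 (S.trivFrame p.1 i q.1) (σ q.1)) p := by
    intro i
    have h3 := (hS.holFunAt_η (hU.inter (S.isOpen_trivSet p.1)) ⟨hp, S.mem_trivSet p.1⟩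
      (fun x hx => (S.isHolFrame_trivFrame p.1).holAt (S.isOpen_trivSet p.1) hx.2 i)
      (fun x hx => hσ x hx.1)).continuousAt
    exact ContinuousAt.comp (f := fun q : TotalSpace (Fin (n + 1) → ℂ) S.E => q.1) h3 hproj
  have h3 : ContinuousAt (fun q : TotalSpace (Fin (n + 1) → ℂ) S.E =>
      ∑ i, S.trivCoord p.1 q.1 q.2 i * S.η q.1 (S.trivFrame p.1 i q.1) (σ q.1)) p :=
    tendsto_finsetSum _ fun i _ => (h1 i).mul (h2 i)
  refine h3.congr ?_
  filter_upwards [hproj.eventually_mem ((S.isOpen_trivSet p.1).mem_nhds (S.mem_trivSet p.1))]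
    with q hq
  conv_rhs => rw [S.sum_trivCoord p.1 hq q.2]
  simp only [map_sum, LinearMap.sum_apply, map_smul, LinearMap.smul_apply, smul_eq_mul]

namespace CyclicSymmetry

variable {S : Data (n + 1)} {c : ℂ} {A : ∀ t, S.E t →ₗ[ℂ] S.E t}

theorem smul_isUnitEigen {t : ℂˣ} {v : S.E t} (hv : S.IsUnitEigen c t v) {a : ℂ}
    (ha : a ∈ ({1, -1} : Set ℂ)) : S.IsUnitEigen c t (a • v) := by
  rcases ha with rfl | rfl
  · rwa [one_smul]
  · rw [neg_one_smul]; exact neg_isUnitEigen hv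

/-- Over the domain of a local unit eigensection `σ` the unit eigenvectors are exactly `±σ`, and the
sign `η(v, σ)` is the continuous sheet coordinate. -/
theorem isCoveringMap (h : CyclicSymmetry S c A) : IsCoveringMap (unitProj S c) := by
  intro x
  refine IsEvenlyCovered.to_isEvenlyCovered_preimage (I := ({1, -1} : Set ℂ)) ⟨inferInstance, ?_⟩
  obtain ⟨U, hU, hx, σ, hσ⟩ := h.exists_local_section x
  refine ⟨U, hx, hU, hU.preimage (continuous_unitProj S c), ?_⟩
  refine ⟨⟨⟨fun p => (⟨p.1.1.1, p.2⟩, ⟨S.η p.1.1.1 p.1.1.2 (σ p.1.1.1),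
      h.η_eq_or _ (hσ _ p.2).2 p.1.2⟩),
    fun q => ⟨⟨⟨q.1.1, (q.2 : ℂ) • σ q.1.1⟩, smul_isUnitEigen (hσ _ q.1.2).2 q.2.2⟩, q.1.2⟩,
    ?_, ?_⟩, ?_, ?_⟩, fun p => rfl⟩
  · rintro ⟨⟨⟨t, v⟩, hv⟩, ht⟩
    have := h.eq_smul t (hσ t ht).2 hv.1
    refine Subtype.ext (Subtype.ext ?_)
    change (⟨t, S.η t v (σ t) • σ t⟩ : TotalSpace (Fin (n + 1) → ℂ) S.E) = ⟨t, v⟩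
    rw [← this]
  · rintro ⟨⟨t, ht⟩, ⟨a, ha⟩⟩
    refine Prod.ext rfl (Subtype.ext ?_)
    change S.η t (a • σ t) (σ t) = a
    rw [map_smul, LinearMap.smul_apply, (hσ t ht).2.2, smul_eq_mul, mul_one]
  · refine Continuous.prodMk (Continuous.subtype_mk
      ((continuous_unitProj S c).comp continuous_subtype_val) _) (Continuous.subtype_mk ?_ _)
    rw [continuous_iff_continuousAt]
    intro p
    have h1 := h.isTTStar.continuousAt_η hU (fun t ht => (hσ t ht).1) (p := p.1.1) p.2
    exact ContinuousAt.comp (f := fun p : unitProj S c ⁻¹' U => p.1.1) h1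
      (continuous_subtype_val.comp continuous_subtype_val).continuousAt
  · refine Continuous.subtype_mk (Continuous.subtype_mk ?_ _) _
    rw [continuous_prod_of_discrete_right]
    intro a
    have h1 : ContinuousOn (fun t => (⟨t, (a : ℂ) • σ t⟩ : TotalSpace (Fin (n + 1) → ℂ) S.E)) U :=
      fun t ht => (HolBundle.HolAt.const_smul (a : ℂ) (hσ t ht).1).continuousAt.continuousWithinAt
    exact continuousOn_iff_continuous_domRestrict.1 h1

/-- A continuous section of unit eigenvectors is holomorphic. -/
theorem holAt_of_continuous (h : CyclicSymmetry S c A) {s : ∀ t, S.E t}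
    (hs : ∀ t, S.IsUnitEigen c t (s t)) {x : ℂˣ}
    (hc : ContinuousAt (fun t => (⟨t, s t⟩ : TotalSpace (Fin (n + 1) → ℂ) S.E)) x) :
    S.HolAt s x := by
  obtain ⟨U, hU, hx, σ, hσ⟩ := h.exists_local_section x
  have h1 : ContinuousAt (fun t => S.η t (s t) (σ t)) x :=
    ContinuousAt.comp (f := fun t => (⟨t, s t⟩ : TotalSpace (Fin (n + 1) → ℂ) S.E))
      (h.isTTStar.continuousAt_η hU (fun t ht => (hσ t ht).1) (p := ⟨x, s x⟩) hx) hc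
  have h2 : ∀ᶠ t in 𝓝 x, t ∈ U := hU.eventually_mem hx
  -- The sign relative to `σ` is continuous with values `±1`, so it is constant near `x`.
  have h3 : ∀ᶠ t in 𝓝 x, S.η t (s t) (σ t) = S.η x (s x) (σ x) := by
    have h4 := Metric.continuousAt_iff'.1 h1 1 one_pos
    filter_upwards [h4, h2] with t ht htU
    have h5 := h.η_eq_or t (hσ t htU).2 (hs t)
    have h6 := h.η_eq_or x (hσ x hx).2 (hs x)
    rcases h5 with h5 | h5 <;> rcases h6 with h6 | h6 <;> rw [h5, h6] at ht ⊢ <;>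
      · rw [dist_eq_norm] at ht
        norm_num at ht
  refine (HolBundle.HolAt.const_smul (S.η x (s x) (σ x)) (hσ x hx).1).congr ?_
  filter_upwards [h2, h3] with t ht ht3
  rw [← ht3]
  exact h.eq_smul t (hσ t ht).2 (hs t).1

theorem cast_isUnitEigen {x y : ℂˣ} (hxy : x = y) {a : S.E x} (ha : S.IsUnitEigen c x a) :
    S.IsUnitEigen c y (cast (congrArg S.E hxy) a) := by
  subst hxy; exact ha

theorem isUnitEigen_map_rho {u t : ℂˣ} (T : Data.Iso (S.rho u) S) {a : S.E (u * t)}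
    (ha : S.IsUnitEigen c (u * t) a) : S.IsUnitEigen c t (T.map t a) := by
  refine ⟨?_, (T.map_η t a a).symm.trans ha.2⟩
  have h1 := T.map_Φ t 1 a
  refine h1.symm.trans ((congrArg (T.map t) ((S.rho_Φ_one u t a).trans ha.1)).trans ?_)
  exact map_smul (T.map t) c a

/-- The negation on the double cover. -/
def unitNeg (p : UnitSpace S c) : UnitSpace S c :=
  ⟨⟨p.1.1, -p.1.2⟩, neg_isUnitEigen p.2⟩

theorem continuous_unitNeg : Continuous (unitNeg : UnitSpace S c → UnitSpace S c) := by
  have h1 := (contMDiff_totalMap (B := S.toHolBundle) (B' := S.toHolBundle)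
    (fun t => -LinearMap.id) fun U _ s hs t ht =>
    ((hs t ht).const_smul (-1)).congr (Eventually.of_forall fun x => by simp)).continuous
  exact Continuous.subtype_mk (h1.comp continuous_subtype_val) _

/-- The eigenline of `Φ` has no monodromy, because of the action of the rotations. -/
theorem exists_global_section (h : CyclicSymmetry S c A) (hρ : S.IsRhoFixed) :
    ∃ s : ∀ t, S.E t, (∀ t, S.HolAt s t) ∧ ∀ t, S.IsUnitEigen c t (s t) := by
  have hcov := h.isCoveringMap
  obtain ⟨v, hv⟩ := h.exists_isUnitEigen (expUnits 0)
  -- Unit eigenvectors are lifted along `exp`; the lift descends to `ℂ*` exactly when it is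
  -- `2πi`-periodic.
  obtain ⟨s, ⟨-, hs⟩, -⟩ := hcov.existsUnique_continuousMap_lifts expUnits 0
    (⟨⟨expUnits 0, v⟩, hv⟩ : UnitSpace S c) rfl
  have hs' : ∀ z, (s z).1.1 = expUnits z := fun z => congrFun hs z
  have hper1 : s (-(2 * Real.pi * Complex.I)) = s 0 := by
    obtain ⟨T, hT⟩ := hρ
    set x := (s 0).1.1 with hx
    set a := (s 0).1.2 with ha
    -- The transported vectors `T_u(a)` lie over `u⁻¹ x`. As a function on the circle this is a
    -- loop, so it gives a closed lift of the path that `s` follows along `-iθ`.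
    set δ : Circle → UnitSpace S c := fun u => ⟨⟨(Circle.toUnits u)⁻¹ * x,
      (T u).map ((Circle.toUnits u)⁻¹ * x)
        (cast (congrArg S.E (mul_inv_cancel_left (Circle.toUnits u) x).symm) a)⟩,
        isUnitEigen_map_rho _ (cast_isUnitEigen
          (mul_inv_cancel_left (Circle.toUnits u) x).symm (s 0).2)⟩ with hδ
    have hδc : Continuous δ := continuous_induced_rng.2 (hT x a)
    set γ : ℝ → UnitSpace S c := fun θ => δ (Circle.exp θ) with hγ
    have hγc : Continuous γ := hδc.comp Circle.exp.continuous
    set g : ℝ → UnitSpace S c := fun θ => s (-(θ * Complex.I)) with hg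
    have hgc : Continuous g := s.continuous.comp (by fun_prop)
    have hx1 : x = 1 := by
      rw [hx, hs']
      ext
      rw [expUnits_val, Complex.exp_zero, Units.val_one]
    have hproj : ∀ θ, (γ θ).1.1 = (g θ).1.1 := by
      intro θ
      rw [hg, hs']
      ext
      change (((Circle.toUnits (Circle.exp θ))⁻¹ * x : ℂˣ) : ℂ) = _
      rw [hx1, mul_one, expUnits_val, Complex.exp_neg, Units.val_inv_eq_inv_val]
      rfl
    have hγper : γ (2 * Real.pi) = γ 0 := by
      simp only [hγ, Circle.exp_two_pi, Circle.exp_zero]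
    -- `T_1` need not be the identity, but it maps the unit eigenvector `a` to `±a`. By uniqueness
    -- of lifts `γ` is `g` or its negative throughout, so `g` closes up because `γ` does.
    have hcases : γ 0 = g 0 ∨ γ 0 = unitNeg (g 0) := by
      have h1 : ∀ p q : UnitSpace S c, p.1.1 = q.1.1 → p = q ∨ p = unitNeg q := by
        rintro ⟨⟨t, v⟩, hv⟩ ⟨⟨t', w⟩, hw⟩ htt
        obtain rfl : t = t' := htt
        have h2 : v = S.η t v w • w := h.eq_smul t hw hv.1
        rcases (h.η_eq_or t hw hv : S.η t v w = 1 ∨ S.η t v w = -1) with h3 | h3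
        · left
          refine Subtype.ext ?_
          change (⟨t, v⟩ : TotalSpace (Fin (n + 1) → ℂ) S.E) = ⟨t, w⟩
          rw [h3, one_smul] at h2
          rw [h2]
        · right
          refine Subtype.ext ?_
          change (⟨t, v⟩ : TotalSpace (Fin (n + 1) → ℂ) S.E) = ⟨t, -w⟩
          rw [h3, neg_one_smul] at h2
          rw [h2]
      exact h1 _ _ (hproj 0)
    have hgper : g (2 * Real.pi) = g 0 := by
      rcases hcases with h0 | h0
      · have h1 : γ = g := hcov.eq_of_comp_eq hγc hgc (funext hproj) 0 h0
        rw [← h1, hγper]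
      · have h1 : γ = unitNeg ∘ g := hcov.eq_of_comp_eq hγc (continuous_unitNeg.comp hgc)
          (funext hproj) 0 h0
        have h2 : ∀ p : UnitSpace S c, unitNeg (unitNeg p) = p := by
          rintro ⟨⟨t, v⟩, hv⟩
          refine Subtype.ext ?_
          change (⟨t, - -v⟩ : TotalSpace (Fin (n + 1) → ℂ) S.E) = ⟨t, v⟩
          rw [neg_neg]
        rw [← h2 (g (2 * Real.pi)), ← h2 (g 0)]
        have h3 := congrFun h1
        simp only [Function.comp_apply] at h3
        rw [← h3, ← h3, hγper]
    simpa [hg] using hgper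
  -- Two lifts of the same map that agree at one point agree everywhere.
  have hperiod : ∀ z, s (z + 2 * Real.pi * Complex.I) = s z := by
    have h1 : (fun z => s (z + 2 * Real.pi * Complex.I)) = s := by
      refine hcov.eq_of_comp_eq (s.continuous.comp (by fun_prop)) s.continuous ?_
        (-(2 * Real.pi * Complex.I)) ?_
      · funext z
        refine (hs' _).trans (Eq.trans ?_ (hs' _).symm)
        ext
        rw [expUnits_val, expUnits_val, Complex.exp_periodic]
      · rw [neg_add_cancel, hper1]
    exact fun z => congrFun h1 z
  have hexp : ∀ z z', Complex.exp z = Complex.exp z' → s z = s z' := by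
    intro z z' hz
    obtain ⟨m, hm⟩ := Complex.exp_eq_exp_iff_exists_int.1 hz
    rw [hm]
    exact Function.Periodic.int_mul hperiod m z'
  have hlog : ∀ t : ℂˣ, (s (Complex.log t)).1.1 = t := fun t => by
    rw [hs']
    ext
    rw [expUnits_val, Complex.exp_log t.ne_zero]
  set s₀ : ∀ t, S.E t := fun t => cast (congrArg S.E (hlog t)) (s (Complex.log t)).1.2 with hs₀
  have hs₀e : ∀ t, S.IsUnitEigen c t (s₀ t) := fun t =>
    cast_isUnitEigen (hlog t) (s (Complex.log t)).2
  have hmk : ∀ t, (⟨t, s₀ t⟩ : TotalSpace (Fin (n + 1) → ℂ) S.E) = (s (Complex.log t)).1 := by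
    have h1 : ∀ (p : TotalSpace (Fin (n + 1) → ℂ) S.E) (t : ℂˣ) (hp : p.1 = t),
        (⟨t, cast (congrArg S.E hp) p.2⟩ : TotalSpace (Fin (n + 1) → ℂ) S.E) = p := by
      rintro ⟨x, a⟩ t rfl
      rfl
    exact fun t => h1 _ t (hlog t)
  refine ⟨s₀, fun t => h.holAt_of_continuous hs₀e ?_, hs₀e⟩
  -- The branch cut of `log` is avoided near `t` by replacing `log x` with `log t + log (x / t)`;
  -- periodicity of `s` makes this harmless.
  have h1 : (fun t => (⟨t, s₀ t⟩ : TotalSpace (Fin (n + 1) → ℂ) S.E)) =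
      fun x : ℂˣ => (s (Complex.log t + Complex.log (x / t))).1 := by
    funext x
    rw [hmk]
    congr 1
    refine hexp _ _ ?_
    rw [Complex.exp_add, Complex.exp_log x.ne_zero, Complex.exp_log t.ne_zero,
      Complex.exp_log (div_ne_zero x.ne_zero t.ne_zero), mul_div_cancel₀ _ t.ne_zero]
  rw [h1]
  refine continuous_subtype_val.continuousAt.comp (s.continuous.continuousAt.comp ?_)
  refine continuousAt_const.add (ContinuousAt.clog ?_ ?_)
  · exact (Units.continuous_val.continuousAt).div_const _
  · rw [div_self t.ne_zero]; exact Complex.one_mem_slitPlane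

end CyclicSymmetry

end TTStar
end

noncomputable section

namespace TTStar

open Filter Topology

variable {n : ℕ}

/-! ## Existence of Toda frames -/

theorem sum_range_root_pow {ζ : ℂ} (hζ : ζ ^ (n + 1) = 1) :
    ∑ j ∈ Finset.range (n + 1), ζ ^ j = if ζ = 1 then ((n + 1 : ℕ) : ℂ) else 0 := by
  split_ifs with h
  · simp [h]
  · rw [geom_sum_eq h, hζ, sub_self, zero_div]

namespace CyclicSymmetry

variable {S : Data (n + 1)} {c : ℂ} {A : ∀ t, S.E t →ₗ[ℂ] S.E t}

theorem iter_isUnitEigen (h : CyclicSymmetry S c A) {t : ℂˣ} {v : S.E t}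
    (hv : S.IsUnitEigen c t v) : S.IsUnitEigen c t (iter A (n + 1) t v) := by
  refine ⟨?_, by rw [h.iter_η, hv.2]⟩
  rw [h.Φ_iter t hv.1, inv_pow, rootω_pow, inv_one, one_mul]

/-- The full cycle acts on a global unit eigensection by a constant sign. -/
theorem exists_sign (h : CyclicSymmetry S c A) {s : ∀ t, S.E t} (hs : ∀ t, S.HolAt s t)
    (hs' : ∀ t, S.IsUnitEigen c t (s t)) :
    ∃ δ : ℂ, δ ^ 2 = 1 ∧ ∀ t, iter A (n + 1) t (s t) = δ • s t := by
  set f : ℂˣ → ℂ := fun t => S.η t (iter A (n + 1) t (s t)) (s t) with hf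
  have hf1 : ∀ t, f t = 1 ∨ f t = -1 := fun t =>
    h.η_eq_or t (hs' t) (h.iter_isUnitEigen (hs' t))
  have hfc : Continuous f := continuous_iff_continuousAt.2 fun t =>
    (h.isTTStar.holFunAt_η isOpen_univ (Set.mem_univ t) (fun x _ => h.iter_hol (hs x) (n + 1))
      (fun x _ => hs x)).continuousAt
  have hconst : ∀ t, f t = f 1 := by
    have h1 := (isPreconnected_univ (α := ℂ)).eq_or_eq_neg_of_sq_eq (f := f ∘ expUnits)
      (g := fun _ => 1) (hfc.comp expUnits.continuous).continuousOn continuousOn_const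
      (fun z _ => by rcases hf1 (expUnits z) with h | h <;> simp [h]) (fun _ => one_ne_zero)
    have h2 : ∀ t : ℂˣ, expUnits (Complex.log t) = t := fun t => by
      ext
      rw [expUnits_val, Complex.exp_log t.ne_zero]
    intro t
    rw [← h2 t, ← h2 1]
    rcases h1 with h1 | h1 <;>
      exact (h1 (Set.mem_univ (Complex.log t))).trans
        (h1 (Set.mem_univ (Complex.log (1 : ℂˣ)))).symm
  refine ⟨f 1, by rcases hf1 1 with h | h <;> simp [h], fun t => ?_⟩
  rw [← hconst t]
  exact h.eq_smul t (hs' t) (h.iter_isUnitEigen (hs' t)).1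

/-- The frame is the discrete Fourier transform `e_k = ν ∑_j β_k^{-j} A^j s`, where the `β_k = α
ω^k` are the `(n+1)`-st roots of the sign `δ` of `A^{n+1}` on `s`. -/
theorem exists_todaFrame (h : CyclicSymmetry S c A) (hρ : S.IsRhoFixed) :
    ∃ L W e, TodaFrame S c L W e := by
  obtain ⟨s, hs, hs'⟩ := h.exists_global_section hρ
  obtain ⟨δ, hδ, hδ'⟩ := h.exists_sign hs hs'
  have hδ0 : δ ≠ 0 := by rintro rfl; simp at hδ
  have hN : ((n + 1 : ℕ) : ℂ) ≠ 0 := by exact_mod_cast n.succ_ne_zero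
  have hω := rootω_ne_zero n
  obtain ⟨α, hα⟩ := IsAlgClosed.exists_pow_nat_eq δ n.succ_pos
  have hα0 : α ≠ 0 := by
    rintro rfl
    apply hδ0
    rw [← hα]; simp
  -- `ν² = 1/(n+1)` compensates the sum of `n + 1` equal terms in `η`.
  obtain ⟨ν, hν⟩ := IsAlgClosed.exists_pow_nat_eq ((n + 1 : ℕ) : ℂ)⁻¹ (n := 2) (by norm_num)
  -- Because `δ² = 1`, the number `α²` is a power `ω^m`. Then `β_i β_k = ω^{m+i+k}`, so the pairing
  -- index has to be `L = -m`.
  obtain ⟨m, hm, hm'⟩ := (rootω_primitive n).eq_pow_of_pow_eq_one (ξ := α ^ 2)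
    (by rw [pow_right_comm, hα, hδ])
  set β : Fin (n + 1) → ℂ := fun k => α * rootω n ^ (k : ℕ) with hβ
  have hβ0 : ∀ k, β k ≠ 0 := fun k => mul_ne_zero hα0 (pow_ne_zero _ hω)
  have hβN : ∀ k, β k ^ (n + 1) = δ := fun k => by
    rw [hβ, mul_pow, hα, pow_right_comm, rootω_pow, one_pow, mul_one]
  have hβn : ∀ k, ‖β k‖ = 1 := by
    intro k
    refine Complex.norm_eq_one_of_pow_eq_one (n := (n + 1) * 2) ?_ (by omega)
    rw [pow_mul, hβN, hδ]
  have hβadd : ∀ k, β (k + 1) = β k * rootω n := by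
    intro k
    simp only [hβ]
    rw [pow_fin_add (rootω_pow n), Fin.val_one', ← pow_eq_pow_mod _ (rootω_pow n), pow_one,
      mul_assoc]
  have hβinj : ∀ i j, β i = β j → i = j := fun i j hij =>
    Fin.ext ((rootω_primitive n).pow_inj i.2 j.2 (mul_left_cancel₀ hα0 hij))
  set L : Fin (n + 1) := -⟨m, hm⟩ with hL
  have hβL : ∀ i k, β i * β k = 1 ↔ i + k = L := by
    intro i k
    have h1 : β i * β k = rootω n ^ ((i + k + ⟨m, hm⟩ : Fin (n + 1)) : ℕ) := by
      rw [pow_fin_add (rootω_pow n), pow_fin_add (rootω_pow n), hm']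
      simp only [hβ]
      ring
    rw [h1, hL, eq_neg_iff_add_eq_zero]
    constructor
    · intro h2
      refine Fin.ext ((rootω_primitive n).pow_inj (Fin.is_lt _) (Fin.is_lt _) ?_)
      rw [h2, Fin.val_zero, pow_zero]
    · intro h2
      rw [h2, Fin.val_zero, pow_zero]
  set e : Fin (n + 1) → ∀ t, S.E t := fun k t => ∑ j ∈ Finset.range (n + 1),
    (ν * (β k)⁻¹ ^ j) • iter A j t (s t) with he
  -- The vectors `A^j s` are `η`-orthonormal, so the pairing is a geometric sum of the root of unity
  -- `(β_i β_k)⁻¹`, which vanishes unless this root is `1`.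
  have hη : ∀ t i k, S.η t (e i t) (e k t) = if i + k = L then 1 else 0 := by
    intro t i k
    simp only [he, map_sum, LinearMap.sum_apply, map_smul, LinearMap.smul_apply, smul_eq_mul]
    have h1 : ∀ x ∈ Finset.range (n + 1), ∀ y ∈ Finset.range (n + 1),
        ν * (β k)⁻¹ ^ x * (ν * (β i)⁻¹ ^ y * S.η t (iter A y t (s t)) (iter A x t (s t))) =
        if x = y then ν ^ 2 * ((β i * β k)⁻¹) ^ x else 0 := by
      intro x hx y hy
      rw [h.η_iter t (hs' t).1 (hs' t).1 (Finset.mem_range.1 hy) (Finset.mem_range.1 hx),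
        (hs' t).2]
      by_cases hxy : y = x
      · subst hxy
        rw [if_pos rfl, if_pos rfl, mul_inv, mul_pow]
        ring
      · rw [if_neg hxy, if_neg (Ne.symm hxy), mul_zero, mul_zero]
    have h2 : ((β i * β k)⁻¹) ^ (n + 1) = 1 := by
      rw [inv_pow, mul_pow, hβN, hβN, ← sq, hδ, inv_one]
    simp only [Finset.mul_sum]
    rw [Finset.sum_congr rfl fun x hx => Finset.sum_congr rfl fun y hy => h1 x hx y hy]
    rw [Finset.sum_congr rfl fun x hx => by rw [Finset.sum_ite_eq, if_pos hx], ← Finset.mul_sum,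
      sum_range_root_pow h2, hν]
    simp only [inv_eq_one, hβL]
    split_ifs
    · exact inv_mul_cancel₀ hN
    · exact mul_zero _
  -- `Φ` multiplies `A^j s` by `ω^{-j} c`, and `ω^{-j}` turns `β_k^{-j}` into `β_{k+1}^{-j}`.
  have hΦ : ∀ t k, S.Φ t 1 (e k t) = c • e (k + 1) t := by
    intro t k
    simp only [he, map_sum, map_smul, h.Φ_iter t (hs' t).1, Finset.smul_sum, smul_smul, hβadd,
      mul_inv, mul_pow]
    refine Finset.sum_congr rfl fun j _ => ?_
    congr 1
    ring
  -- Applying `A` shifts the sum by one place; the term leaving at the end equals the one entering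
  -- at the start because `β_k^{n+1} = δ`.
  have hA : ∀ t k, A t (e k t) = β k • e k t := by
    intro t k
    simp only [he, map_sum, map_smul, ← iter_succ, Finset.smul_sum, smul_smul]
    have h1 := Finset.sum_range_succ' (fun j => (β k * (ν * (β k)⁻¹ ^ j)) • iter A j t (s t))
      (n + 1)
    rw [Finset.sum_range_succ, hδ', iter_zero] at h1
    have h2 : (β k * (ν * (β k)⁻¹ ^ (n + 1))) • δ • s t = (β k * (ν * (β k)⁻¹ ^ 0)) • s t := by
      rw [smul_smul, inv_pow, hβN, pow_zero, mul_one, ← mul_assoc, mul_assoc (β k * ν),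
        inv_mul_cancel₀ hδ0, mul_one]
    rw [h2] at h1
    rw [add_right_cancel h1]
    refine Finset.sum_congr rfl fun j _ => ?_
    congr 1
    rw [pow_succ]
    have := hβ0 k
    field_simp
  -- `A` is `g`-unitary, and the `e_k` are eigenvectors for distinct eigenvalues of modulus one.
  have hg0 : ∀ t i k, i ≠ k → S.g t (e i t) (e k t) = 0 := by
    intro t i k hik
    have h1 := h.g t (e i t) (e k t)
    rw [hA, hA] at h1
    simp only [map_smulₛₗ, LinearMap.smul_apply, smul_eq_mul, RingHom.id_apply] at h1
    have h2 : starRingEnd ℂ (β i) = (β i)⁻¹ := by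
      rw [Complex.inv_def, Complex.normSq_eq_norm_sq, hβn]
      simp
    rw [h2] at h1
    have h3 : β k / β i - 1 ≠ 0 := by
      rw [sub_ne_zero, Ne, div_eq_one_iff_eq (hβ0 i)]
      exact fun h0 => hik (hβinj _ _ h0).symm
    have h4 : (β k / β i - 1) * S.g t (e i t) (e k t) = 0 := by
      rw [sub_mul, one_mul, sub_eq_zero]
      nth_rewrite 2 [← h1]
      rw [div_eq_mul_inv]
      ring
    exact (mul_eq_zero.1 h4).resolve_left h3
  refine ⟨L, fun i t => Real.log (S.g t (e i t) (e i t)).re, e, ⟨fun i t => ?_, hη, hΦ,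
    fun t i k => ?_⟩⟩
  · exact HolBundle.HolAt.sum (s := fun j t => (ν * (β i)⁻¹ ^ j) • iter A j t (s t)) fun j _ =>
      (h.iter_hol (hs t) j).const_smul _
  · split_ifs with hik
    · subst hik
      have h1 : e i t ≠ 0 := by
        intro h0
        have h2 := hη t i (L - i)
        rw [h0, map_zero, LinearMap.zero_apply, if_pos (add_sub_cancel _ _)] at h2
        exact zero_ne_one h2
      rw [Real.exp_log (h.isTTStar.g_pos t _ h1)]
      have h2 := h.isTTStar.g_herm t (e i t) (e i t)
      exact (Complex.conj_eq_iff_re.1 h2.symm).symm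
    · exact hg0 t i k hik

end CyclicSymmetry

/-! ### From fixed points to radial solutions of the Toda equation. -/

namespace Data

variable {S : Data (n + 1)}

/-- A fixed point is nilpotent or has a Toda frame. -/
theorem exists_solution_of_pow (hS : S.IsTTStar) (hc : S.IsCyclicFixed) (hρ : S.IsRhoFixed)
    {c : ℂˣ} (hpow : ∀ t v, ((S.Φ t 1 : Module.End ℂ (S.E t)) ^ (n + 1)) v =
      (c : ℂ) ^ (n + 1) • v) : ∃ w : RadialSolution n, S.HasTodaFrame c w.1 := by
  obtain ⟨A, hA1, hA2, hA3, hA4⟩ := hc.exists_map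
  have h : CyclicSymmetry S c fun t => (A t : S.E t →ₗ[ℂ] S.E t) :=
    ⟨hS, c.ne_zero, hA1, hA2, hA3, fun t a => by
      rw [LinearEquiv.coe_coe, hA4, smul_smul, inv_mul_cancel₀ (rootω_ne_zero n), one_smul], hpow⟩
  obtain ⟨L, W, e, he⟩ := h.exists_todaFrame hρ
  exact he.exists_solution hS hρ

/-- Every fixed point with nowhere vanishing `Φ` has a Toda frame. -/
theorem exists_hasTodaFrame (hS : S.IsTTStar) (hne : S.NonVanishing) (hc : S.IsCyclicFixed)
    (hρ : S.IsRhoFixed) : ∃ (c : ℂˣ) (w : RadialSolution n), S.HasTodaFrame c w.1 := by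
  obtain ⟨a, ha⟩ := exists_Φ_pow_eq hS hc hρ
  have ha0 : a ≠ 0 := by
    rintro rfl
    exact hS.not_nilpotent hne hρ fun t v => by rw [ha, zero_smul]
  obtain ⟨c, hc'⟩ := IsAlgClosed.exists_pow_nat_eq a n.succ_pos
  have hc0 : c ≠ 0 := by
    rintro rfl
    apply ha0
    rw [← hc']; simp
  exact ⟨Units.mk0 c hc0, exists_solution_of_pow hS hc hρ fun t v => by
    rw [ha, Units.val_mk0, hc']⟩

end Data

end TTStar
end

noncomputable section

namespace TTStar

open Filter Topology ComplexOrder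

variable {n : ℕ}

attribute [local instance] matNormedRing
attribute [local instance] matNormedAlgebra

/-! ## Change of holomorphic frames -/

/-- Under a holomorphic change of frame the Chern connection becomes `P⁻¹ (H⁻¹∂H) P + P⁻¹∂P`, and
`∂̄` annihilates the last term. The flatness of the model can therefore be checked in one frame. -/
theorem wirt_chern_gauge {N : ℕ} {h H P : ℂ → Matrix (Fin N) (Fin N) ℂ} {z : ℂ}
    (hH : ∀ᶠ x in 𝓝 z, ContDiffAt ℝ ∞ H x) (hHu : ∀ᶠ x in 𝓝 z, IsUnit (H x))
    (hP : ∀ᶠ x in 𝓝 z, ContDiffAt ℂ ω P x) (hPu : ∀ᶠ x in 𝓝 z, IsUnit (P x))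
    (hh : h =ᶠ[𝓝 z] fun x => (P x)ᴴ * H x * P x) :
    wirt 1 (chern h) z = (P z)⁻¹ * wirt 1 (chern H) z * P z := by
  have h1 : chern h =ᶠ[𝓝 z] fun x => (P x)⁻¹ * chern H x * P x + (P x)⁻¹ * wirt (-1) P x := by
    filter_upwards [hH, hHu, hP, hPu, hh.eventuallyEq_nhds] with x h1 h2 h3 h4 h5
    have dP := (ContDiffAt.toReal h3).differentiableAt (n := ∞) (by simp)
    have dH := h1.differentiableAt (n := ∞) (by simp)
    have dC := (contDiffAt_conjTranspose (ContDiffAt.toReal h3)).differentiableAt (n := ∞) (by simp)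
    have i1 := Matrix.nonsing_inv_mul _ ((Matrix.isUnit_iff_isUnit_det _).1 h2)
    have i2 := Matrix.nonsing_inv_mul _ ((Matrix.isUnit_iff_isUnit_det _).1 h4)
    have i3 : ((P x)ᴴ)⁻¹ * (P x)ᴴ = 1 := by
      rw [← conjTranspose_nonsing_inv, ← conjTranspose_mul,
        Matrix.mul_nonsing_inv _ ((Matrix.isUnit_iff_isUnit_det _).1 h4), conjTranspose_one]
    rw [chern, wirt_congr h5, h5.self_of_nhds,
      wirt_mul (f := fun x => (P x)ᴴ * H x) (dC.mul dH) dP, wirt_mul dC dH,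
      wirt_conjTranspose dP, neg_neg, wirt_one_hol h3, conjTranspose_zero, zero_mul, zero_add,
      Matrix.mul_inv_rev, Matrix.mul_inv_rev, chern]
    generalize wirt (-1) H x = H'
    generalize wirt (-1) P x = P'
    have e : (P x)⁻¹ * ((H x)⁻¹ * ((P x)ᴴ)⁻¹) * ((P x)ᴴ * H' * P x + (P x)ᴴ * H x * P') =
      (P x)⁻¹ * (H x)⁻¹ * (((P x)ᴴ)⁻¹ * (P x)ᴴ) * H' * P x +
      (P x)⁻¹ * ((H x)⁻¹ * (((P x)ᴴ)⁻¹ * (P x)ᴴ) * H x) * P' := by noncomm_ring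
    rw [e, i3, mul_one, mul_one, i1]
    noncomm_ring
  have hz := hP.self_of_nhds
  have hz' := ContDiffAt.toReal hz
  have uz := hPu.self_of_nhds
  have dP := hz'.differentiableAt (n := ∞) (by simp)
  have dI := (contDiffAt_inv hz' uz).differentiableAt (n := ∞) (by simp)
  have dC := (contDiffAt_chern hH.self_of_nhds hHu.self_of_nhds).differentiableAt (n := ∞) (by simp)
  have dW := (contDiffAt_wirt (ε := -1) hz').differentiableAt (n := ∞) (by simp)
  have w0 : wirt 1 (wirt (-1) P) z = 0 := by
    have h2 : wirt 1 P =ᶠ[𝓝 z] fun _ => 0 := hP.mono fun x hx => wirt_one_hol hx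
    rw [wirt_comm hz', wirt_congr h2, wirt_const]
  rw [wirt_congr h1, wirt_add (f := fun x => (P x)⁻¹ * chern H x * P x)
      (g := fun x => (P x)⁻¹ * wirt (-1) P x) ((dI.mul dC).mul dP) (dI.mul dW),
    wirt_mul (f := fun x => (P x)⁻¹ * chern H x) (dI.mul dC) dP, wirt_mul dI dC, wirt_mul dI dW,
    wirt_inv hz' uz, wirt_one_hol hz, w0]
  simp

theorem adj_gauge {N : ℕ} {H M P : Matrix (Fin N) (Fin N) ℂ} (hP : IsUnit P) :
    adj (Pᴴ * H * P) (P⁻¹ * M * P) = P⁻¹ * adj H M * P := by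
  have i2 := Matrix.mul_nonsing_inv _ ((Matrix.isUnit_iff_isUnit_det _).1 hP)
  have i3 : (Pᴴ)⁻¹ * Pᴴ = 1 := by
    rw [← conjTranspose_nonsing_inv, ← conjTranspose_mul, i2, conjTranspose_one]
  have i4 : (P⁻¹)ᴴ * Pᴴ = 1 := by rw [← conjTranspose_mul, i2, conjTranspose_one]
  rw [adj, adj, Matrix.mul_inv_rev, Matrix.mul_inv_rev, conjTranspose_mul, conjTranspose_mul]
  have e : P⁻¹ * (H⁻¹ * (Pᴴ)⁻¹) * (Pᴴ * (Mᴴ * (P⁻¹)ᴴ)) * (Pᴴ * H * P) =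
    P⁻¹ * (H⁻¹ * ((Pᴴ)⁻¹ * Pᴴ) * Mᴴ * ((P⁻¹)ᴴ * Pᴴ) * H) * P := by noncomm_ring
  rw [e, i3, i4, mul_one, mul_one]

/-! ## The tt*-structure of a solution of the Toda equation -/

/-- The trivial holomorphic bundle. -/
def trivialBundle (r : ℕ) : HolBundle r where
  E := Bundle.Trivial ℂˣ (Fin r → ℂ)

theorem holAt_trivialBundle {r : ℕ} {s : ∀ t, (trivialBundle r).E t} {t : ℂˣ} :
    (trivialBundle r).HolAt s t ↔ HolFunAt (fun x => (s x : Fin r → ℂ)) t :=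
  contMDiffAt_section (F := Fin r → ℂ) (E := Bundle.Trivial ℂˣ (Fin r → ℂ)) t

theorem holAt_pull_trivialBundle {r : ℕ} {u : ℂˣ} {s : ∀ t, ((trivialBundle r).pull u).E t}
    {t : ℂˣ} : ((trivialBundle r).pull u).HolAt s t ↔ HolFunAt (fun x => (s x : Fin r → ℂ)) t :=
  contMDiffAt_section (F := Fin r → ℂ) (E := ((trivialBundle r).pull u).E) t

theorem holFunAt_pi {r : ℕ} {f : ℂˣ → Fin r → ℂ} {t : ℂˣ} :
    HolFunAt f t ↔ ∀ i, HolFunAt (fun x => f x i) t :=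
  contMDiffAt_pi_space

/-- The tt*-structure on the trivial bundle with `η(e_i, e_j) = 1` for `i + j = L`,
`g(e_i, e_i) = exp(W_i)` and `Φ(e_j) = c e_{j+1} dt`. -/
def modelData (c : ℂ) (L : Fin (n + 1)) (W : Fin (n + 1) → ℂˣ → ℝ) : Data (n + 1) where
  toHolBundle := trivialBundle (n + 1)
  η _ := (LinearMap.mk₂ ℂ (fun v w : Fin (n + 1) → ℂ => ∑ i, v (L - i) * w i)
    (fun _ _ _ => by simp [add_mul, Finset.sum_add_distrib])
    (fun _ _ _ => by simp [Finset.mul_sum, mul_assoc])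
    (fun _ _ _ => by simp [mul_add, Finset.sum_add_distrib])
    (fun _ _ _ => by simp [Finset.mul_sum, mul_left_comm]) :
      (Fin (n + 1) → ℂ) →ₗ[ℂ] (Fin (n + 1) → ℂ) →ₗ[ℂ] ℂ)
  g t := (LinearMap.mk₂'ₛₗ (starRingEnd ℂ) (RingHom.id ℂ)
    (fun v w : Fin (n + 1) → ℂ => ∑ i, starRingEnd ℂ (v i) * w i * (Real.exp (W i t) : ℂ))
    (fun _ _ _ => by simp [add_mul, Finset.sum_add_distrib])
    (fun _ _ _ => by simp [Finset.mul_sum, mul_assoc])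
    (fun _ _ _ => by simp [mul_add, add_mul, Finset.sum_add_distrib])
    (fun _ _ _ => by simp [Finset.mul_sum, mul_left_comm, mul_assoc]) :
      (Fin (n + 1) → ℂ) →ₗ⋆[ℂ] (Fin (n + 1) → ℂ) →ₗ[ℂ] ℂ)
  Φ _ := (LinearMap.mk₂ ℂ (fun (X : ℂ) (v : Fin (n + 1) → ℂ) => fun i => c * X * v (i - 1))
    (fun _ _ _ => by ext; simp [mul_add, add_mul])
    (fun _ _ _ => by ext; simp [mul_left_comm, mul_assoc])
    (fun _ _ _ => by ext; simp [mul_add])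
    (fun _ _ _ => by ext; simp [mul_left_comm]) :
      ℂ →ₗ[ℂ] (Fin (n + 1) → ℂ) →ₗ[ℂ] (Fin (n + 1) → ℂ))

variable {c : ℂ} {L : Fin (n + 1)} {W : Fin (n + 1) → ℂˣ → ℝ}

theorem modelData_η (t : ℂˣ) (v w : Fin (n + 1) → ℂ) :
    (modelData c L W).η t v w = ∑ i, v (L - i) * w i := rfl

theorem modelData_g (t : ℂˣ) (v w : Fin (n + 1) → ℂ) :
    (modelData c L W).g t v w = ∑ i, starRingEnd ℂ (v i) * w i * (Real.exp (W i t) : ℂ) := rfl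

theorem modelData_Φ (t : ℂˣ) (X : ℂ) (v : Fin (n + 1) → ℂ) :
    (modelData c L W).Φ t X v = fun i => c * X * v (i - 1) := rfl

theorem sum_smul_apply {r : ℕ} (a : Fin r → ℂ) (v : Fin r → Fin r → ℂ) (i : Fin r) :
    (∑ k, a k • v k) i = ∑ k, a k * v k i := by
  rw [Finset.sum_apply]
  rfl

/-- The standard frame of the trivial bundle. -/
def stdFrame (n : ℕ) (j : Fin (n + 1)) (_ : ℂˣ) : Fin (n + 1) → ℂ := Pi.single j 1

theorem modelData_todaFrame (c : ℂ) (L : Fin (n + 1)) (W : Fin (n + 1) → ℂˣ → ℝ) :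
    TodaFrame (modelData c L W) c L W (stdFrame n) where
  hol i t := holAt_trivialBundle.2 contMDiffAt_const
  η t i j := by
    rw [modelData_η]
    simp only [stdFrame, Pi.single_apply, mul_ite, mul_one, mul_zero, Finset.sum_ite_eq',
      Finset.mem_univ, if_true]
    exact if_congr (sub_eq_iff_eq_add.trans eq_comm) rfl rfl
  Φ t i := by
    rw [modelData_Φ]
    funext k
    change c * 1 * (Pi.single i 1 : Fin (n + 1) → ℂ) (k - 1) =
      c * (Pi.single (i + 1) 1 : Fin (n + 1) → ℂ) k
    simp only [Pi.single_apply, mul_one, sub_eq_iff_eq_add]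
  g t i j := by
    rw [modelData_g]
    simp only [stdFrame, Pi.single_apply]
    by_cases h : i = j
    · simp [h]
    · simp [h, Ne.symm h]

/-- Flatness is required in every local holomorphic frame. In terms of the matrix `P` of the frame,
every ingredient is conjugate by `P` to its form in the standard frame, where the equation is the
Toda equation. -/
theorem modelData_flat (hW : ∀ i (t : ℂˣ), ContDiffAt ℝ ∞ (onPlane (W i)) t)
    (hToda : ∀ i (t : ℂˣ), wirt 1 (wirt (-1) (onPlane fun s => (W i s : ℂ))) t =
      c * starRingEnd ℂ c *
        (Real.exp (W i t - W (i - 1) t) - Real.exp (W (i + 1) t - W i t) : ℝ))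
    {U : Set ℂˣ} (hU : IsOpen U) {e : Fin (n + 1) → ∀ t, (modelData c L W).E t}
    (he : (modelData c L W).IsHolFrame U e) {φ : ℂˣ → Matrix (Fin (n + 1)) (Fin (n + 1)) ℂ}
    (hφ : ∀ t ∈ U, ∀ j, (modelData c L W).Φ t 1 (e j t) = ∑ i, φ t i j • e i t) (lam : Circle)
    {t : ℂˣ} (ht : t ∈ U) : (modelData c L W).curvature e φ lam t = 0 := by
  have hsm : ∀ (t : ℂˣ) i, ContDiffAt ℝ ∞ (onPlane fun s => (W i s : ℂ)) t := fun t i =>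
    contDiffAt_onPlane_ofReal (hW i t)
  set P : ℂˣ → Matrix (Fin (n + 1)) (Fin (n + 1)) ℂ := fun t =>
    Matrix.of fun i j => (e j t : Fin (n + 1) → ℂ) i with hPdef
  set H : ℂ → Matrix (Fin (n + 1)) (Fin (n + 1)) ℂ := fun z =>
    diagonal fun i => Complex.exp (onPlane (fun s => (W i s : ℂ)) z) with hHdef
  have hPe : ∀ t j, e j t = ∑ i, P t i j • stdFrame n i t := by
    intro t j
    funext k
    refine Eq.trans ?_ (sum_smul_apply (fun i => P t i j) (fun i => stdFrame n i t) k).symm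
    simp only [stdFrame, Pi.single_apply, mul_ite, mul_one, mul_zero]
    exact ((Finset.sum_ite_eq Finset.univ k _).trans (if_pos (Finset.mem_univ k))).symm
  have hgram0 : ∀ t : ℂˣ, (modelData c L W).gram (stdFrame n) t = H t := by
    intro t
    ext i j
    refine ((modelData_todaFrame c L W).g t i j).trans ?_
    simp only [hHdef, diagonal_apply, onPlane_coe, Complex.ofReal_exp]
  have hgram : ∀ t : ℂˣ, (modelData c L W).gram e t = (P t)ᴴ * H t * P t := by
    intro t
    rw [← hgram0]
    exact (modelData c L W).gram_change (hPe t)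
  have hPhol : ∀ t ∈ U, ContDiffAt ℂ ω (onPlane P) t := by
    intro t ht
    rw [contDiffAt_matrix]
    intro i j
    simp_rw [onPlane_apply]
    exact holFunAt_iff.1 (holFunAt_pi.1 (holAt_trivialBundle.1 (he.holAt hU ht j)) i)
  have hPu : ∀ t ∈ U, IsUnit (P t) := by
    intro t ht
    obtain ⟨Q, hQ⟩ := (modelData c L W).exists_change (he.linearIndependent ht)
      fun j => stdFrame n j t
    refine (Matrix.isUnit_iff_isUnit_det _).2 (Matrix.isUnit_det_of_right_inverse (B := Q) ?_)
    ext i j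
    have h1 := congrFun (hQ j) i
    have h2 : (∑ k, Q k j • e k t : Fin (n + 1) → ℂ) i = ∑ k, Q k j * P t i k :=
      sum_smul_apply (fun k => Q k j) (fun k => e k t) i
    rw [Matrix.mul_apply, Matrix.one_apply]
    refine (Finset.sum_congr rfl fun k _ => mul_comm _ _).trans (h2.symm.trans (h1.symm.trans ?_))
    exact Pi.single_apply _ _ _
  have hM0 : ∀ t j, (modelData c L W).Φ t 1 (stdFrame n j t) =
      ∑ i, shiftMatrix n c i j • stdFrame n i t := by
    intro t j
    refine ((modelData_todaFrame c L W).Φ t j).trans ?_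
    simp only [shiftMatrix, Matrix.of_apply, ite_smul, zero_smul, Finset.sum_ite_eq',
      Finset.mem_univ, if_true]
    rfl
  have hφP : ∀ t ∈ U, φ t = (P t)⁻¹ * shiftMatrix n c * P t := by
    intro t ht
    have h1 := (modelData c L W).matrix_change ((modelData_todaFrame c L W).linearIndependent t)
      (hM0 t) (hφ t ht) (hPe t)
    rw [mul_assoc, h1, ← mul_assoc, Matrix.nonsing_inv_mul _
      ((Matrix.isUnit_iff_isUnit_det _).1 (hPu t ht)), one_mul]
  have hHs : ∀ t : ℂˣ, ContDiffAt ℝ ∞ H t := fun t => contDiffAt_diagonal fun i => (hsm t i).cexp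
  have hHu : ∀ z, IsUnit (H z) := fun z =>
    (Matrix.isUnit_iff_isUnit_det _).2 (by
      rw [hHdef, det_diagonal]
      exact (Finset.prod_ne_zero_iff.2 fun i _ => Complex.exp_ne_zero _).isUnit)
  -- No holomorphy of `φ` is given; it follows from `φ = P⁻¹ (shift) P` on `U`.
  have hφhol : ContDiffAt ℂ ω (onPlane φ) t := by
    have h1 : ContDiffAt ℂ ω (fun z => (onPlane P z)⁻¹) t := by
      obtain ⟨u, hu⟩ := hPu t ht
      have h2 := contDiffAt_ringInverse ℂ u (n := ω)
      rw [hu] at h2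
      have h3 : onPlane P t = P t := onPlane_coe _ _
      rw [← h3] at h2
      simpa only [Function.comp_def, Matrix.nonsing_inv_eq_ringInverse] using
        h2.comp (t : ℂ) (hPhol t ht)
    refine ((h1.mul contDiffAt_const).mul (hPhol t ht)).congr_of_eventuallyEq
      (eventually_of_mem_units (p := fun z => onPlane φ z =
        (onPlane P z)⁻¹ * shiftMatrix n c * onPlane P z) hU ht fun s hs => ?_)
    rw [onPlane_coe, onPlane_coe, hφP s hs]
  have hgs : onPlane ((modelData c L W).gram e) =ᶠ[𝓝 (t : ℂ)]
      fun z => (onPlane P z)ᴴ * H z * onPlane P z :=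
    eventually_of_mem_units (p := fun z => onPlane ((modelData c L W).gram e) z =
      (onPlane P z)ᴴ * H z * onPlane P z) hU ht fun s hs => by
      rw [onPlane_coe, onPlane_coe, hgram]
  have hPr := ContDiffAt.toReal (hPhol t ht)
  have hgsm : ContDiffAt ℝ ∞ (onPlane ((modelData c L W).gram e)) t :=
    (((contDiffAt_conjTranspose hPr).mul (hHs t)).mul hPr).congr_of_eventuallyEq hgs
  have hPct : IsUnit (P t)ᴴ := by
    rw [Matrix.isUnit_iff_isUnit_det, det_conjTranspose]
    exact ((Matrix.isUnit_iff_isUnit_det _).1 (hPu t ht)).star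
  have hgu : IsUnit ((modelData c L W).gram e t) := by
    rw [hgram]
    exact (hPct.mul (hHu t)).mul (hPu t ht)
  rw [Data.curvature_eq _ lam hgsm hgu hφhol, wirt_chern_gauge
    (eventually_of_mem_units hU ht fun s _ => hHs s) (Eventually.of_forall hHu)
    (eventually_of_mem_units hU ht hPhol)
    (eventually_of_mem_units hU ht fun s hs => by rw [onPlane_coe]; exact hPu s hs) hgs,
    hgram, hφP t ht, adj_gauge (hPu t ht), onPlane_coe]
  have i2 := Matrix.mul_nonsing_inv _ ((Matrix.isUnit_iff_isUnit_det _).1 (hPu t ht))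
  have hbase : wirt 1 (chern H) t = shiftMatrix n c * adj (H t) (shiftMatrix n c) -
      adj (H t) (shiftMatrix n c) * shiftMatrix n c := by
    have h2 : chern H =ᶠ[𝓝 (t : ℂ)]
        fun z => diagonal fun i => wirt (-1) (onPlane fun s => (W i s : ℂ)) z :=
      eventually_of_mem_units (p := fun z => chern H z =
        diagonal fun i => wirt (-1) (onPlane fun s => (W i s : ℂ)) z) hU ht fun s _ =>
        chern_diagonal fun i => hsm s i
    rw [wirt_congr h2, wirt_diagonal fun i => contDiffAt_wirt (hsm t i), hHdef,
      shiftMatrix_commutator]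
    congr 1
    funext i
    rw [hToda]
    simp only [onPlane_coe]
    push_cast
    rfl
  rw [hbase]
  generalize adj (H t) (shiftMatrix n c) = B
  generalize shiftMatrix n c = M
  have e1 : ∀ X Y : Matrix (Fin (n + 1)) (Fin (n + 1)) ℂ,
      (P t)⁻¹ * X * P t * ((P t)⁻¹ * Y * P t) = (P t)⁻¹ * (X * Y) * P t := fun X Y => by
    rw [show (P t)⁻¹ * X * P t * ((P t)⁻¹ * Y * P t) =
      (P t)⁻¹ * X * (P t * (P t)⁻¹) * Y * P t by noncomm_ring, i2]
    noncomm_ring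
  rw [e1, e1]
  noncomm_ring

theorem modelData_isTTStar (hW : ∀ i (t : ℂˣ), ContDiffAt ℝ ∞ (onPlane (W i)) t)
    (hToda : ∀ i (t : ℂˣ), wirt 1 (wirt (-1) (onPlane fun s => (W i s : ℂ))) t =
      c * starRingEnd ℂ c *
        (Real.exp (W i t - W (i - 1) t) - Real.exp (W (i + 1) t - W i t) : ℝ))
    (hanti : ∀ i t, W i t + W (L - i) t = 0) : (modelData c L W).IsTTStar where
  η_symm t a b := by
    refine (modelData_η t a b).trans (Eq.trans ?_ (modelData_η t b a).symm)
    refine Fintype.sum_equiv (Equiv.subLeft L) _ _ fun i => ?_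
    rw [Equiv.subLeft_apply, sub_sub_cancel, mul_comm]
  η_nondeg t a h := by
    funext i
    have h1 := h (Pi.single (L - i) 1 : Fin (n + 1) → ℂ)
    have h2 := (modelData_η (c := c) (W := W) t a (Pi.single (L - i) 1)).symm.trans h1
    simp only [Pi.single_apply, mul_ite, mul_one, mul_zero, Finset.sum_ite_eq',
      Finset.mem_univ, if_true, sub_sub_cancel] at h2
    exact h2
  η_hol U hU s s' hs hs' := by
    have h1 := ((trivialBundle (n + 1)).isHolSection_iff hU).1 hs
    have h2 := ((trivialBundle (n + 1)).isHolSection_iff hU).1 hs'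
    intro t ht
    have h3 : HolFunAt (fun t => ∑ i, (s t : Fin (n + 1) → ℂ) (L - i) *
        (s' t : Fin (n + 1) → ℂ) i) t := contMDiffAt_finsetSum fun i _ =>
      (holFunAt_pi.1 (holAt_trivialBundle.1 (h1 t ht)) (L - i)).mul
      (holFunAt_pi.1 (holAt_trivialBundle.1 (h2 t ht)) i)
    exact ContMDiffAt.contMDiffWithinAt h3
  g_herm t a b := by
    refine (modelData_g t a b).trans (Eq.trans ?_
      (congrArg (starRingEnd ℂ) (modelData_g t b a)).symm)
    rw [map_sum]
    refine Finset.sum_congr rfl fun i _ => ?_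
    simp only [map_mul, Complex.conj_conj, Complex.conj_ofReal]
    ring
  g_pos t a ha := by
    refine lt_of_lt_of_eq ?_ (congrArg Complex.re (modelData_g t a a)).symm
    have h1 : ∀ i, (starRingEnd ℂ ((a : Fin (n + 1) → ℂ) i) * (a : Fin (n + 1) → ℂ) i *
        (Real.exp (W i t) : ℂ)).re = Complex.normSq ((a : Fin (n + 1) → ℂ) i) *
        Real.exp (W i t) := fun i => by
      rw [← Complex.normSq_eq_conj_mul_self, ← Complex.ofReal_mul, Complex.ofReal_re]
    rw [Complex.re_sum]
    simp only [h1]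
    obtain ⟨i, hi⟩ : ∃ i, (a : Fin (n + 1) → ℂ) i ≠ 0 := by
      by_contra! h0
      exact ha (funext h0)
    refine Finset.sum_pos' (fun i _ => mul_nonneg (Complex.normSq_nonneg _) (Real.exp_pos _).le)
      ⟨i, Finset.mem_univ i, mul_pos (Complex.normSq_pos.2 hi) (Real.exp_pos _)⟩
  g_smooth U hU s s' hs hs' := by
    have h1 := ((trivialBundle (n + 1)).isHolSection_iff hU).1 hs
    have h2 := ((trivialBundle (n + 1)).isHolSection_iff hU).1 hs'
    refine smoothOn_of_contDiffAt fun t ht => ?_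
    have d1 := fun i => ContDiffAt.toReal
      (holFunAt_iff.1 (holFunAt_pi.1 (holAt_trivialBundle.1 (h1 t ht)) i))
    have d2 := fun i => ContDiffAt.toReal
      (holFunAt_iff.1 (holFunAt_pi.1 (holAt_trivialBundle.1 (h2 t ht)) i))
    have d3 : ContDiffAt ℝ ∞ (fun z => ∑ i,
        Complex.conjCLE (onPlane (fun x => (s x : Fin (n + 1) → ℂ) i) z) *
          onPlane (fun x => (s' x : Fin (n + 1) → ℂ) i) z *
          Complex.exp (onPlane (fun x => (W i x : ℂ)) z)) t :=
      ContDiffAt.sum fun i _ => ((Complex.conjCLE.contDiff.contDiffAt.comp (t : ℂ) (d1 i)).mul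
        (d2 i)).mul (contDiffAt_onPlane_ofReal (hW i t)).cexp
    refine d3.congr_of_eventuallyEq (onPlane_eventuallyEq (Eventually.of_forall fun x => ?_))
    refine (modelData_g x (s x) (s' x)).trans ?_
    simp only [onPlane_coe, Complex.conjCLE_apply, Complex.ofReal_exp]
  Φ_hol U hU s hs := by
    have h1 := ((trivialBundle (n + 1)).isHolSection_iff hU).1 hs
    refine ((trivialBundle (n + 1)).isHolSection_iff hU).2 fun t ht => ?_
    refine holAt_trivialBundle.2 (holFunAt_pi.2 fun i => ?_)
    exact contMDiffAt_const.mul (holFunAt_pi.1 (holAt_trivialBundle.1 (h1 t ht)) (i - 1))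
  Φ_selfAdj t X a b := by
    refine (modelData_η t _ b).trans (Eq.trans ?_ (modelData_η t a _).symm)
    refine Fintype.sum_equiv (Equiv.addRight 1) _ _ fun i => ?_
    change c * X * (a : Fin (n + 1) → ℂ) (L - i - 1) * (b : Fin (n + 1) → ℂ) i =
      (a : Fin (n + 1) → ℂ) (L - (i + 1)) * (c * X * (b : Fin (n + 1) → ℂ) (i + 1 - 1))
    rw [add_sub_cancel_right, sub_sub]
    ring
  κ_invol t := by
    -- The formula extends `κ e_i = exp(W_i) e_{L-i}` conjugate-linearly; `hanti` makes its square
    -- the identity.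
    refine ⟨({ toFun := fun a i => starRingEnd ℂ (a (L - i)) * (Real.exp (W (L - i) t) : ℂ)
               map_add' := fun a b => by ext; simp [add_mul]
               map_smul' := fun x a => by ext; simp [mul_assoc] } :
        (Fin (n + 1) → ℂ) →ₗ⋆[ℂ] (Fin (n + 1) → ℂ)), fun a b => ?_, fun a => ?_⟩
    · refine (modelData_g t a b).trans (Eq.trans ?_ (modelData_η t _ b).symm)
      refine Finset.sum_congr rfl fun i _ => ?_
      change _ = starRingEnd ℂ ((a : Fin (n + 1) → ℂ) (L - (L - i))) *
        (Real.exp (W (L - (L - i)) t) : ℂ) * _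
      rw [sub_sub_cancel]
      ring
    · funext i
      change starRingEnd ℂ (starRingEnd ℂ ((a : Fin (n + 1) → ℂ) (L - (L - i))) *
        (Real.exp (W (L - (L - i)) t) : ℂ)) * (Real.exp (W (L - i) t) : ℂ) = a i
      rw [sub_sub_cancel, map_mul, Complex.conj_conj, Complex.conj_ofReal, mul_assoc,
        ← Complex.ofReal_mul, ← Real.exp_add, hanti, Real.exp_zero, Complex.ofReal_one, mul_one]
  flat U hU e he φ hφ lam t ht := modelData_flat hW hToda hU he hφ lam ht

end TTStar
end

noncomputable section

namespace TTStar

open Filter Topology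

variable {n : ℕ}

/-! ## The symmetries of the model and the classification -/

variable {c : ℂ} {L : Fin (n + 1)} {W : Fin (n + 1) → ℂˣ → ℝ}

theorem modelData_nonVanishing (hc : c ≠ 0) : (modelData c L W).NonVanishing := by
  intro t h
  have h1 : (modelData c L W).Φ t 1 (stdFrame n 0 t) = 0 := by rw [h]; rfl
  have h2 := congrFun ((modelData_Φ t 1 (stdFrame n 0 t)).symm.trans h1) 1
  simp [stdFrame] at h2
  exact hc h2

/-- The endomorphism `v_i ↦ α ω^i v_i` of `ℂ^{n+1}`. -/
def cyclicEquiv (n : ℕ) {α : ℂ} (hα : α ≠ 0) : (Fin (n + 1) → ℂ) ≃ₗ[ℂ] (Fin (n + 1) → ℂ) :=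
  LinearEquiv.piCongrRight fun i =>
    LinearEquiv.smulOfNeZero ℂ ℂ (α * rootω n ^ (i : ℕ))
      (mul_ne_zero hα (pow_ne_zero _ (rootω_ne_zero n)))

theorem holFunAt_linear {r : ℕ} (T : (Fin r → ℂ) →ₗ[ℂ] (Fin r → ℂ)) {f : ℂˣ → Fin r → ℂ} {t : ℂˣ}
    (hf : HolFunAt f t) : HolFunAt (fun x => T (f x)) t :=
  (LinearMap.toContinuousLinearMap T).contMDiff.contMDiffAt.comp t hf

theorem rootω_pow_succ (i : Fin (n + 1)) :
    rootω n ^ ((i + 1 : Fin (n + 1)) : ℕ) = rootω n * rootω n ^ (i : ℕ) := by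
  rw [Fin.val_add, ← pow_eq_pow_mod _ (rootω_pow n), pow_add, mul_comm]
  congr 1
  rw [Fin.val_one', ← pow_eq_pow_mod _ (rootω_pow n), pow_one]

/-- The isomorphism is `diag(α ω^i)`: its powers of `ω` turn `Φ` into `ωΦ`, and `α² = ω^{-L}` makes
it preserve `η`. Its entries have modulus one, so `g` is preserved. -/
theorem modelData_isCyclicFixed : (modelData c L W).IsCyclicFixed := by
  obtain ⟨α, hα⟩ := IsSquare.exists_sq (a := (rootω n ^ (L : ℕ))⁻¹) (by
    obtain ⟨z, hz⟩ := IsAlgClosed.exists_pow_nat_eq (rootω n ^ (L : ℕ))⁻¹ (n := 2) (by norm_num)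
    exact ⟨z, by rw [← hz, sq]⟩)
  have hL : rootω n ^ (L : ℕ) ≠ 0 := pow_ne_zero _ (rootω_ne_zero n)
  have hα0 : α ≠ 0 := by
    rintro rfl
    exact inv_ne_zero hL (hα.trans (zero_pow two_ne_zero))
  have hω : ‖rootω n‖ = 1 := Complex.norm_eq_one_of_pow_eq_one (rootω_pow n) n.succ_ne_zero
  have hα1 : ‖α‖ = 1 := by
    have h := congrArg norm hα
    rw [norm_inv, norm_pow, norm_pow, hω, one_pow, inv_one] at h
    exact (pow_eq_one_iff_of_nonneg (norm_nonneg _) two_ne_zero).1 h.symm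
  refine ⟨Data.Iso.ofSections
    (S₂ := (modelData c L W).smulΦ (Complex.exp (2 * Real.pi * Complex.I / (n + 1 : ℕ))))
    (fun _ => cyclicEquiv n hα0)
    (fun U _ s hs t ht => holAt_trivialBundle.2
      (holFunAt_linear (cyclicEquiv n hα0 : _ →ₗ[ℂ] _) (holAt_trivialBundle.1 (hs t ht))))
    (fun U _ s hs t ht => holAt_trivialBundle.2
      (holFunAt_linear ((cyclicEquiv n hα0).symm : _ →ₗ[ℂ] _) (holAt_trivialBundle.1 (hs t ht))))
    (fun t a b => ?_) (fun t a b => ?_) fun t X a => ?_⟩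
  · refine (modelData_η t a b).trans
      (Eq.trans ?_ (modelData_η (c := c) (W := W) t (cyclicEquiv n hα0 a) (cyclicEquiv n hα0 b)).symm)
    refine Finset.sum_congr rfl fun i _ => ?_
    set a' : Fin (n + 1) → ℂ := a
    set b' : Fin (n + 1) → ℂ := b
    change a' (L - i) * b' i = α * rootω n ^ ((L - i : Fin (n + 1)) : ℕ) * a' (L - i) *
      (α * rootω n ^ (i : ℕ) * b' i)
    have h := pow_fin_add (rootω_pow n) (L - i) i
    rw [sub_add_cancel] at h
    have h2 : α ^ 2 * (rootω n ^ ((L - i : Fin (n + 1)) : ℕ) * rootω n ^ (i : ℕ)) = 1 := by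
      rw [← h, ← hα, inv_mul_cancel₀ hL]
    linear_combination -(a' (L - i) * b' i) * h2
  · refine (modelData_g t a b).trans
      (Eq.trans ?_ (modelData_g (c := c) (L := L) t (cyclicEquiv n hα0 a) (cyclicEquiv n hα0 b)).symm)
    refine Finset.sum_congr rfl fun i _ => ?_
    set a' : Fin (n + 1) → ℂ := a
    set b' : Fin (n + 1) → ℂ := b
    change starRingEnd ℂ (a' i) * b' i * (Real.exp (W i t) : ℂ) =
      starRingEnd ℂ (α * rootω n ^ (i : ℕ) * a' i) * (α * rootω n ^ (i : ℕ) * b' i) *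
        (Real.exp (W i t) : ℂ)
    rw [map_mul]
    have h2 : starRingEnd ℂ (α * rootω n ^ (i : ℕ)) * (α * rootω n ^ (i : ℕ)) = 1 := by
      rw [Complex.conj_mul', norm_mul, norm_pow, hω, hα1]
      simp
    linear_combination -(starRingEnd ℂ (a' i) * b' i * (Real.exp (W i t) : ℂ)) * h2
  · funext i
    change α * rootω n ^ (i : ℕ) * (c * X * (a : Fin (n + 1) → ℂ) (i - 1)) =
      rootω n * (c * X * (α * rootω n ^ ((i - 1 : Fin (n + 1)) : ℕ) *
        (a : Fin (n + 1) → ℂ) (i - 1)))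
    have h := rootω_pow_succ (i - 1)
    rw [sub_add_cancel] at h
    rw [h]
    ring

/-- Only `g` varies with `t`, and it is radial, so the identity of the fibre serves as `T_u`;
continuity is that of constant sections. -/
theorem modelData_isRhoFixed (hW : ∀ i (u : Circle) t, W i (Circle.toUnits u * t) = W i t) :
    (modelData c L W).IsRhoFixed := by
  refine ⟨fun u => Data.Iso.ofSections (S₁ := (modelData c L W).rho (Circle.toUnits u))
    (fun _ => LinearEquiv.refl ℂ (Fin (n + 1) → ℂ))
    (fun U _ s hs t ht => holAt_trivialBundle.2 (holAt_pull_trivialBundle.1 (hs t ht)))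
    (fun U _ s hs t ht => holAt_pull_trivialBundle.2 (holAt_trivialBundle.1 (hs t ht)))
    (fun t a b => rfl) (fun t a b => ?_) (fun t X a => ?_), fun x a => ?_⟩
  · refine (modelData_g (c := c) (L := L) (W := W) (Circle.toUnits u * t) a b).trans
      (Eq.trans ?_ (modelData_g (c := c) (L := L) t a b).symm)
    simp only [hW]
  · funext i
    change ((Circle.toUnits u : ℂˣ) : ℂ)⁻¹ * (c * (((Circle.toUnits u : ℂˣ) : ℂ) * X) *
      (a : Fin (n + 1) → ℂ) (i - 1)) = c * X * (a : Fin (n + 1) → ℂ) (i - 1)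
    have h := (Circle.toUnits u).ne_zero
    field_simp
  · have h1 : Continuous fun t : ℂˣ => (TotalSpace.mk' (Fin (n + 1) → ℂ) t
        (a : Fin (n + 1) → ℂ) : TotalSpace (Fin (n + 1) → ℂ) (trivialBundle (n + 1)).E) :=
      continuous_iff_continuousAt.2 fun t => ContMDiffAt.continuousAt
        ((holAt_trivialBundle (s := fun _ => (a : Fin (n + 1) → ℂ))).2 contMDiffAt_const)
    have h0 : Continuous fun u : Circle => Circle.toUnits u :=
      (Units.isOpenEmbedding_val (R := ℂ)).isInducing.continuous_iff.2 continuous_subtype_val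
    have h2 : Continuous fun u : Circle => (Circle.toUnits u)⁻¹ * x :=
      (continuous_inv.comp h0).mul continuous_const
    exact h1.comp h2

/-! ### Realisation of solutions and the map to solution classes. -/

theorem exists_model (c : ℂˣ) (w : RadialSolution n) :
    ∃ S : FixedStructure n, S.1.HasTodaFrame c w.1 := by
  obtain ⟨l, hl⟩ := w.2.1.antisymm
  have hp := idx_periodic w.2.1.periodic
  set W : Fin (n + 1) → ℂˣ → ℝ := fun i t => w.1 ((i : ℕ) : ℤ) (c * t) with hWdef
  have hw : ∀ j (t : ℂˣ), ContDiffAt ℝ ∞ (onPlane (w.1 j)) t := fun j t =>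
    (w.2.1.smooth j).contDiffAt isOpen_univ (Set.mem_univ t)
  have hW : ∀ i (t : ℂˣ), ContDiffAt ℝ ∞ (onPlane (W i)) t := fun i t =>
    contDiffAt_onPlane_mul_left (hw _ _)
  have hs : ∀ (i : Fin (n + 1)) t, w.1 (((i - 1 : Fin (n + 1)) : ℕ) : ℤ) t = w.1 ((i : ℕ) - 1) t := by
    intro i t
    rw [← hp (((i : ℕ) : ℤ) - 1), idx_sub, idx_coe, idx_one]
  have ha : ∀ (i : Fin (n + 1)) t, w.1 (((i + 1 : Fin (n + 1)) : ℕ) : ℤ) t = w.1 ((i : ℕ) + 1) t := by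
    intro i t
    rw [← hp (((i : ℕ) : ℤ) + 1), idx_add, idx_coe, idx_one]
  have hS : (modelData (c : ℂ) (idx n (l - 1)) W).IsTTStar := by
    refine modelData_isTTStar hW (fun i t => ?_) fun i t => ?_
    · have h1 := dt_dtbar_mul_left (f := fun s => (W i s : ℂ))
        (fun t => contDiffAt_onPlane_ofReal (hW i t)) c⁻¹ (c * t)
      simp only [hWdef, mul_inv_cancel_left, inv_mul_cancel_left] at h1
      rw [w.2.1.eqn] at h1
      simp only [hWdef, hs, ha]
      rw [h1]
      have h2 : (c : ℂ) ≠ 0 := c.ne_zero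
      have h3 : starRingEnd ℂ (c : ℂ) ≠ 0 := (map_ne_zero _).2 h2
      rw [Units.val_inv_eq_inv_val, map_inv₀]
      field_simp
    · have h1 := hl ((i : ℕ) : ℤ) (c * t)
      rw [show l - ((i : ℕ) : ℤ) - 1 = l - 1 - ((i : ℕ) : ℤ) by ring, ← hp (l - 1 - _), idx_sub,
        idx_coe] at h1
      exact h1
  refine ⟨⟨modelData (c : ℂ) (idx n (l - 1)) W, hS, modelData_nonVanishing c.ne_zero,
    modelData_isCyclicFixed, modelData_isRhoFixed fun i u t => w.2.2 _ _ _ ?_⟩,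
    hasTodaFrame_iff.2 ⟨_, _, modelData_todaFrame (c : ℂ) (idx n (l - 1)) W⟩⟩
  rw [Units.val_mul, Units.val_mul, Units.val_mul, mul_left_comm, norm_mul]
  exact (congrArg (· * _) (Circle.norm_coe u)).trans (one_mul _)

/-- An adapted coordinate of a structure with a Toda frame has a Toda frame too. -/
theorem Data.HasTodaFrame.of_isAdapted {S : Data (n + 1)} {c c' : ℂˣ} {w : RadialSolution n}
    (h : S.HasTodaFrame c w.1) (hc' : S.IsAdapted c') : S.HasTodaFrame c' w.1 :=
  h.of_pow_eq (hc'.pow_eq 1 (h.Φ_pow 1))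

theorem FixedStructure.exists_hasTodaFrame (S : FixedStructure n) :
    ∃ (c : ℂˣ) (w : RadialSolution n), S.1.HasTodaFrame c w.1 :=
  Data.exists_hasTodaFrame S.2.1 S.2.2.1 S.2.2.2.1 S.2.2.2.2

/-- The Toda solution of an isomorphism class of fixed structures. -/
def todaClass (x : FixedClass n) : SolutionClass n :=
  Quotient.mk _ (Quotient.out x).exists_hasTodaFrame.choose_spec.choose

/-- The choices in `todaClass` do not matter: a Toda frame can be moved along an isomorphism and to
any adapted coordinate, and its solution is unique up to a cyclic shift. -/
theorem todaClass_mk_eq_iff {c : ℂˣ} {S : FixedStructure n} (hc : S.1.IsAdapted c)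
    (w : RadialSolution n) :
    todaClass (Quotient.mk (fixedSetoid n) S) = Quotient.mk (shiftSetoid n) w ↔
      S.1.HasTodaFrame c w.1 := by
  set x := Quotient.mk (fixedSetoid n) S with hx
  obtain ⟨T⟩ := Quotient.exact (Quotient.out_eq x)
  have h := ((Quotient.out x).exists_hasTodaFrame.choose_spec.choose_spec.map_iso T).of_isAdapted hc
  exact ⟨fun e => h.of_equiv (Quotient.exact e), fun h' => Quotient.sound (h.unique S.2.1 h')⟩

end TTStar
end

theorem mainTheorem7 (n : ℕ) :
    ∃ F : TTStar.FixedClass n → TTStar.SolutionClass n,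
      (∀ S : TTStar.FixedStructure n, ∃ c : ℂˣ, S.1.IsAdapted c) ∧
      (∀ (c : ℂˣ) (S : TTStar.FixedStructure n), S.1.IsAdapted c →
        ∀ w : TTStar.RadialSolution n,
          F (Quotient.mk (TTStar.fixedSetoid n) S) = Quotient.mk (TTStar.shiftSetoid n) w ↔
            S.1.HasTodaFrame c w.1) ∧
      ∀ c : ℂˣ, Set.BijOn F
        {x | ∃ S : TTStar.FixedStructure n,
          Quotient.mk (TTStar.fixedSetoid n) S = x ∧ S.1.IsAdapted c} Set.univ := by
  refine ⟨TTStar.todaClass, fun S => ?_, fun c S hc w => TTStar.todaClass_mk_eq_iff hc w,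
    fun c => ⟨fun _ _ => Set.mem_univ _, ?_, ?_⟩⟩
  · obtain ⟨c, w, h⟩ := S.exists_hasTodaFrame
    exact ⟨c, h.isAdapted⟩
  · rintro _ ⟨S, rfl, hS⟩ _ ⟨S', rfl, hS'⟩ h
    obtain ⟨w, hw⟩ := Quotient.exists_rep (TTStar.todaClass (Quotient.mk (TTStar.fixedSetoid n) S))
    have h1 := (TTStar.todaClass_mk_eq_iff hS w).1 hw.symm
    have h2 := (TTStar.todaClass_mk_eq_iff hS' w).1 (h.symm.trans hw.symm)
    exact Quotient.sound (h1.nonempty_iso S.2.1 S'.2.1 h2)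
  · intro y _
    obtain ⟨w, rfl⟩ := Quotient.exists_rep y
    obtain ⟨S, hS⟩ := TTStar.exists_model c w
    exact ⟨_, ⟨S, rfl, hS.isAdapted⟩, (TTStar.todaClass_mk_eq_iff hS.isAdapted w).2 hS⟩
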